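/- Fix $0<\theta<1$, $p>1$, $s>0$, $a,\eta\ge 0$, and write $\langle j\rangle=\max\{|j|,1\}$. For complex sequences $u=(u_j)_{j\in\mathbb Z}$ put $|u|_s=\sup_j|u_j|\langle j\rangle^{p}e^{a|j|+s\langle j\rangle^\theta}$, and $\mathtt w_s=\{u:|u|_s<\infty\}$. For $r>0$ let $\mathcal H_{r,s,\eta}$ be the real vector space of Hamiltonians $H(u)=\sum_{\boldsymbol\alpha,\boldsymbol\beta}H_{\boldsymbol\alpha,\boldsymbol\beta}u^{\boldsymbol\alpha}\bar u^{\boldsymbol\beta}$ (sum over pairs of multi-indices in $\mathbb N^{\mathbb Z}$ of finite length) with $H_{\boldsymbol\alpha,\boldsymbol\beta}=\overline{H_{\boldsymbol\beta,\boldsymbol\alpha}}$ and $H_{\boldsymbol\alpha,\boldsymbol\beta}=0$ if $|\boldsymbol\alpha|\ne|\boldsymbol\beta|$, such that the series of $H$ and of its $\eta$-majorant $\underline H_\eta(u)=\sum|H_{\boldsymbol\alpha,\boldsymbol\beta}|e^{\eta|\pi(\boldsymbol\alpha-\boldsymbol\beta)|}u^{\boldsymbol\alpha}\bar u^{\boldsymbol\beta}$,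 $\pi(\boldsymbol\alpha)=\sum_j j\boldsymbol\alpha_j$, converge absolutely at every point of $\{|u|_s\le r\}$, and $$|H|_{r,s,\eta}=\frac1r\sup_{|u|_s\le r}\big|X_{\underline H_\eta}(u)\big|_s<\infty ,\qquad X^{(j)}_{\underline H_\eta}=\mathrm i\,\partial_{\bar u_j}\underline H_\eta .$$ Let $\mathcal O$ be a subset of $\mathcal Q=\{\omega\in\mathbb R^{\mathbb Z}:\sup_j|\omega_j-j^2|\le\frac12\}$, and let $\mathcal H^{\mathcal O}_{r,s,\eta}$ be the space of families $H=(H(\omega))_{\omega\in\mathcal O}$ in $\mathcal H_{r,s,\eta}$ that are bounded and Lipschitz in $\omega$; for $\mu\ge0$, $$\|H\|_{r,s,\eta}=\sup_{\omega\in\mathcal O}|H(\omega)|_{r,s,\eta}+\mu\sup_{\omega\ne\omega'}\frac{|H(\omega)-H(\omega')|_{r,s,\eta}}{|\omega-\omega'|_\infty}.$$ For $H\in\mathcal H_{r,s,\eta}$ the auxiliary Hamiltonian is $\mathtt H(u,w)=\sum H_{\boldsymbol\alpha,\boldsymbol\beta}\,w^{m}u^{\boldsymbol\alpha-m}\bar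 u^{\boldsymbol\beta-m}$, $m_j=\min\{\boldsymbol\alpha_j,\boldsymbol\beta_j\}$, so that $H(u)=\mathtt H(u,|u|^2)$ with $(|u|^2)_j=|u_j|^2$. Let $I=(I_j)_{j\in\mathbb Z}$, $I_j\ge0$, and let $\mathcal T_I=\{u\in\mathtt w_s:|u_j|^2=I_j\ \forall j\}$. **Proposition.** For every even $d=2q-2\ge-2$ ($q\in\mathbb N$) there is an operator $\Pi^d$ such that, for all $r>0$ and $0<\kappa<1$ with $|\sqrt I|_s\le\kappa r$, $\Pi^d$ is a continuous linear operator $\mathcal H^{\mathcal O}_{r,s,\eta}\to\mathcal H^{\mathcal O}_{r,s,\eta}$, given, for $|u|_s<r$ and pointwise in $\omega\in\mathcal O$, by $$\Pi^{2q-2}H(u)=\frac1{q!}D_w^q\mathtt H(u,I)\big[|u|^2-I,\dots,|u|^2-I\big]=\frac1{q!}\frac{d^q}{dt^q}\Big|_{t=0}\mathtt H\big(u,I+t(|u|^2-I)\big)$$ (the function of $t$ being analytic at $0$), and the following holds. (i) $\Pi^d\Pi^d=\Pi^d$, and $\Pi^{d'}\Pi^d=\Pi^d\Pi^{d'}=0$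 for every even $d'\ne d$, $d'\ge-2$. (ii) For every $0<\kappa_*\le1$, $\mu\ge 0$ and $H\in\mathcal H^{\mathcal O}_{r,s,\eta}$, $$\|\Pi^{2q-2}H\|_{\kappa_*r,s,\eta}\le\kappa_*^{-2}\Big(1+\frac{\kappa_*^2}{\kappa^2}\Big)^q c_\kappa^q\,\|H\|_{r,s,\eta},\qquad c_\kappa=\begin{cases}\dfrac1{\ln\kappa^{-2}}&\text{if }\tfrac12<\kappa^2<1,\\[1ex] 2\kappa^2&\text{if }0<\kappa^2\le\tfrac12.\end{cases}$$ (iii) Every $H\in\mathcal H^{\mathcal O}_{r,s,\eta}$ is, for each $\omega\in\mathcal O$, smooth in any finite set of the variables $u_j$ on $\{|u|_s<r\}$. If $\mathtt q\ge0$ and $\Pi^{2q-2}H=0$ for all $q\le\mathtt q$, then $\partial_u^{\boldsymbol\alpha}\partial_{\bar u}^{\boldsymbol\beta}H\equiv0$ on $\mathcal T_I$ whenever $0\le|\boldsymbol\alpha|+|\boldsymbol\beta|\le\mathtt q$. (iv) Let $\Pi^{<d}=\sum_{j\in2\mathbb Z,\,-2\le j\le d-2}\Pi^j$. If $d_1,d_2\ge-2$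 are even and $F,G\in\mathcal H^{\mathcal O}_{r,s,\eta}$ satisfy $\Pi^{<d_1}F=0$ and $\Pi^{<d_2}G=0$, then for every $r'<r$ with $|\sqrt I|_s<r'$ the Poisson bracket $\{F,G\}=\mathrm i\sum_j(\partial_{\bar u_j}F\,\partial_{u_j}G-\partial_{u_j}F\,\partial_{\bar u_j}G)$, with the series over $j$ converging on $\{|u|_s<r'\}$, belongs to $\mathcal H^{\mathcal O}_{r',s,\eta}$, and $\Pi^{<d_1+d_2}\{F,G\}=0$. -/

import Mathlib

namespace TorusProj

open scoped ENNReal ComplexConjugate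

noncomputable section

/-- `⟨j⟩ = max {|j|, 1}`. -/
def japBracket (j : ℤ) : ℝ := max |(j : ℝ)| 1

/-- The weight `⟨j⟩^p e^{a|j| + s⟨j⟩^θ}`. -/
def weight (θ p s a : ℝ) (j : ℤ) : ℝ :=
  japBracket j ^ p * Real.exp (a * |(j : ℝ)| + s * japBracket j ^ θ)

/-- The norm `|v|_{p,s,a} = sup_j |v_j| ⟨j⟩^p e^{a|j| + s⟨j⟩^θ}`, with value `∞` outside the
space `w_{p,s,a}`. For `p > 1`, `s > 0`, `a ≥ 0` (the only case used) a sequence of finite norm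
is automatically in `ℓ²`. -/
def seqNorm (θ p s a : ℝ) (v : ℤ → ℂ) : ℝ≥0∞ :=
  ⨆ j, ENNReal.ofReal (‖v j‖ * weight θ p s a j)

/-- Multi-indices: families of natural numbers indexed by `ℤ`, with finite sum. -/
abbrev MIdx := ℤ →₀ ℕ

/-- `|α| = ∑_j α_j`. -/
def MIdx.len (α : MIdx) : ℕ := α.sum fun _ n => n

/-- The momentum `π(α) = ∑_j j α_j`. -/
def MIdx.mom (α : MIdx) : ℤ := α.sum fun j n => j * (n : ℤ)

/-- `u^α = ∏_j u_j^{α_j}`. -/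
def mpow (u : ℤ → ℂ) (α : MIdx) : ℂ := α.prod fun j n => u j ^ n

/-- A Hamiltonian is given by the coefficients `H_{α,β}` of its expansion
`H(u) = ∑ H_{α,β} u^α ū^β`; for the spaces below the expansion is unique, so that functions and
coefficients determine each other. -/
abbrev Ham := MIdx × MIdx → ℂ

/-- The monomial `H_{α,β} u^α ū^β`. -/
def term (H : Ham) (u : ℤ → ℂ) (x : MIdx × MIdx) : ℂ :=
  H x * mpow u x.1 * mpow (fun j => conj (u j)) x.2

/-- The function `u ↦ H(u) = ∑ H_{α,β} u^α ū^β`. -/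
def eval (H : Ham) (u : ℤ → ℂ) : ℂ := ∑' x, term H u x

/-- Majorant analytic Hamiltonians on the closed ball of radius `r`: pointwise absolutely
convergent expansion, reality and mass conservation. -/
def IsMajorantAnalytic (θ p s a r : ℝ) (H : Ham) : Prop :=
  (∀ u, seqNorm θ p s a u ≤ ENNReal.ofReal r → Summable fun x => ‖term H u x‖) ∧
  (∀ α β, H (α, β) = conj (H (β, α))) ∧
  (∀ α β : MIdx, α.len ≠ β.len → H (α, β) = 0)

/-- The `η`-majorant, with coefficients `|H_{α,β}| e^{η |π(α-β)|}`. -/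
def majorant (η : ℝ) (H : Ham) : Ham := fun x =>
  ((‖H x‖ * Real.exp (η * |((x.1.mom - x.2.mom : ℤ) : ℝ)|) : ℝ) : ℂ)

/-- The power series `∂H/∂ū_j`. -/
def seriesDbar (j : ℤ) (H : Ham) : Ham := fun x =>
  ((x.2 j : ℂ) + 1) * H (x.1, x.2 + Finsupp.single j 1)

/-- The Hamiltonian vector field, `X_H^{(j)} = i ∂H/∂ū_j`. -/
def hamField (H : Ham) (u : ℤ → ℂ) : ℤ → ℂ := fun j => Complex.I * eval (seriesDbar j H) u

/-- `|H|_{r,s,η} = (1/r) sup_{|u|_{p,s,a} ≤ r} |X_{H_η}(u)|_{p,s,a}`, where `H_η` is the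
`η`-majorant of `H`. -/
def hamNorm (θ p s a η r : ℝ) (H : Ham) : ℝ≥0∞ :=
  (⨆ (u : ℤ → ℂ) (_ : seqNorm θ p s a u ≤ ENNReal.ofReal r),
    seqNorm θ p s a (hamField (majorant η H) u)) / ENNReal.ofReal r

/-- `η`-regular Hamiltonians, the space `𝓗_{r,s,η}`: the `η`-majorant is again majorant
analytic, and its vector field is well defined and bounded on the closed ball. -/
def IsRegular (θ p s a η r : ℝ) (H : Ham) : Prop :=
  IsMajorantAnalytic θ p s a r H ∧
  IsMajorantAnalytic θ p s a r (majorant η H) ∧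
  (∀ u, seqNorm θ p s a u ≤ ENNReal.ofReal r →
    ∀ j, Summable fun x => ‖term (seriesDbar j (majorant η H)) u x‖) ∧
  hamNorm θ p s a η r H < ∞

/-- The frequency set `𝒬 = {ω : sup_j |ω_j - j²| ≤ 1/2}`. -/
def freqCube : Set (ℤ → ℝ) := {ω | ∀ j, |ω j - (j : ℝ) ^ 2| ≤ 1 / 2}

/-- `|ω - ω'|_∞`. -/
def supDist (ω ω' : ℤ → ℝ) : ℝ≥0∞ := ⨆ j, ENNReal.ofReal |ω j - ω' j|

/-- `sup_{ω ∈ 𝓞} |H(ω)|_{r,s,η}`. -/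
def famSup (θ p s a η r : ℝ) {O : Set (ℤ → ℝ)} (H : O → Ham) : ℝ≥0∞ :=
  ⨆ ω, hamNorm θ p s a η r (H ω)

/-- The Lipschitz semi-norm `sup_{ω ≠ ω'} |H(ω) - H(ω')|_{r,s,η} / |ω - ω'|_∞`. -/
def famLip (θ p s a η r : ℝ) {O : Set (ℤ → ℝ)} (H : O → Ham) : ℝ≥0∞ :=
  ⨆ (ω : O) (ω' : O) (_ : ω ≠ ω'),
    hamNorm θ p s a η r (H ω - H ω') / supDist (ω : ℤ → ℝ) ω'

/-- `‖H‖_{r,s,η}^{μ,𝓞}`, the weighted Lipschitz norm. -/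
def famNorm (θ p s a η μ r : ℝ) {O : Set (ℤ → ℝ)} (H : O → Ham) : ℝ≥0∞ :=
  famSup θ p s a η r H + ENNReal.ofReal μ * famLip θ p s a η r H

/-- The space `𝓗_{r,s,η}^𝓞` of Lipschitz families of regular Hamiltonians. -/
def HFam (θ p s a η r : ℝ) (O : Set (ℤ → ℝ)) : Set (O → Ham) :=
  {H | (∀ ω, IsRegular θ p s a η r (H ω)) ∧ famSup θ p s a η r H < ∞ ∧
    famLip θ p s a η r H < ∞}

/-- The auxiliary Hamiltonian `𝙷(u,w)`, obtained by writing each monomial `u^α ū^β` as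
`|u|^{2m} u^{α-m} ū^{β-m}`, `m_j = min {α_j, β_j}`, and replacing `|u|^{2m}` by `w^m`. -/
def auxHam (H : Ham) (u w : ℤ → ℂ) : ℂ :=
  ∑' x : MIdx × MIdx, H x * mpow w (x.1 ⊓ x.2) * mpow u (x.1 - x.1 ⊓ x.2) *
    mpow (fun j => conj (u j)) (x.2 - x.1 ⊓ x.2)

/-- The point `I + t (|u|² - I)`. -/
def actionLine (I : ℤ → ℝ) (u : ℤ → ℂ) (t : ℂ) : ℤ → ℂ := fun j =>
  (I j : ℂ) + t * (((‖u j‖ ^ 2 - I j : ℝ)) : ℂ)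

/-- The torus `𝒯_I = {u : |u_j|² = I_j}`. -/
def torus (θ p s a : ℝ) (I : ℤ → ℝ) : Set (ℤ → ℂ) :=
  {u | seqNorm θ p s a u < ∞ ∧ ∀ j, ‖u j‖ ^ 2 = I j}

/-- The Wirtinger derivative `∂f/∂u_j = (∂f/∂x_j - i ∂f/∂y_j)/2`, `u_j = x_j + i y_j`. -/
def dU (j : ℤ) (f : (ℤ → ℂ) → ℂ) (u : ℤ → ℂ) : ℂ :=
  (deriv (fun t : ℝ => f (Function.update u j (u j + (t : ℂ)))) 0
    - Complex.I * deriv (fun t : ℝ => f (Function.update u j (u j + (t : ℂ) * Complex.I))) 0) / 2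

/-- The Wirtinger derivative `∂f/∂ū_j = (∂f/∂x_j + i ∂f/∂y_j)/2`, `u_j = x_j + i y_j`. -/
def dUbar (j : ℤ) (f : (ℤ → ℂ) → ℂ) (u : ℤ → ℂ) : ℂ :=
  (deriv (fun t : ℝ => f (Function.update u j (u j + (t : ℂ)))) 0
    + Complex.I * deriv (fun t : ℝ => f (Function.update u j (u j + (t : ℂ) * Complex.I))) 0) / 2

/-- `∂_u^α f = ∂_{u_{j₁}}^{α_{j₁}} ⋯ ∂_{u_{jₙ}}^{α_{jₙ}} f`, where `j₁ < ⋯ < jₙ` are the indices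
in the support of `α`. -/
def dUs (α : MIdx) (f : (ℤ → ℂ) → ℂ) : (ℤ → ℂ) → ℂ :=
  α.support.sort.foldr (fun j g => (dU j)^[α j] g) f

/-- `∂_ū^β f`. -/
def dUbars (β : MIdx) (f : (ℤ → ℂ) → ℂ) : (ℤ → ℂ) → ℂ :=
  β.support.sort.foldr (fun j g => (dUbar j)^[β j] g) f

/-- The restriction of `f` to a neighbourhood of `u` in finitely many modes,
`z ↦ f(u + ∑_{j ∈ S} z_j e_j)`. -/
def slice (f : (ℤ → ℂ) → ℂ) (u : ℤ → ℂ) (S : Finset ℤ) (z : S → ℂ) : ℂ :=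
  f fun j => if h : j ∈ S then u j + z ⟨j, h⟩ else u j

/-- `K` represents the Poisson bracket
`{f,g} = i ∑_j (∂_{ū_j} f ∂_{u_j} g - ∂_{u_j} f ∂_{ū_j} g)` on the open ball of radius `r`. -/
def IsBracket (θ p s a r : ℝ) (f g : (ℤ → ℂ) → ℂ) (K : Ham) : Prop :=
  ∀ u, seqNorm θ p s a u < ENNReal.ofReal r →
    HasSum (fun j => Complex.I * (dUbar j f u * dU j g u - dU j f u * dUbar j g u)) (eval K u)

/-- The constant `c_κ`. -/
def cKappa (κ : ℝ) : ℝ := if 1 / 2 < κ ^ 2 then 1 / Real.log ((κ ^ 2)⁻¹) else 2 * κ ^ 2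

end

end TorusProj

/-!
A monomial `u^α ū^β` is written as `|u|^{2m} u^a ū^b` with `m = α ⊓ β` and `a`, `b` of disjoint
supports (`splitEquiv`). A Hamiltonian thus becomes, for each class `(a, b)`, a power series
`∑_m h_m w^m` in the actions `w = |u|²`, and the projection of degree `2q - 2` (`taylorProj`) keeps
the part of degree `q` in `w - I` of each of these series, re-expanded in the monomials `w^l`.

All norms are weighted `ℓ¹` sums of coefficients. A power series with non-negative coefficients is
largest at the point of the ball with maximal non-negative coordinates, so the majorant norm is the
quantity `fieldNorm`, the supremum over `j` of `∑ |H_{α,β}| e^{η|π(α-β)|} β_j V^{α+β} / V_j²` with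
`V_j` the radius of the ball in the mode `j` (`isRegular_iff`, `IsRegular.hamNorm_eq`). For a single
monomial the part of degree `q` of `w^m = (I + (w - I))^m` is dominated, as `I_j ≤ κ² V_j²`, by the
coefficient of `t^q` in `(κ² + (κ² + κ'²) t)^{|m|}` (`polyNorm_projPoly_le`), and the maximum of
`binom(M, q) κ^{2M}` over `M` is at most `c_κ^q` (`choose_mul_pow_le`). The projection does not
raise the exponents `m_j`, nor change the momentum, so the bound passes to the vector field
(`fieldNorm_taylorProj_le`). The same domination shows that the expansion in `t` of
`𝙷(u, I + t(|u|² - I))` converges near `0`, with coefficients the projections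
(`hasFPowerSeriesAt_auxHam`).

The projections are mutually orthogonal idempotents because the Taylor coefficients at `w = I` of
the projection are those of the given series of order `q`, and they determine the series
(`taylorProj_taylorProj`). In particular, the projections with index less than `n` vanish exactly if
all Taylor coefficients of order less than `n` do (`VanishesToOrder`, `vanishesToOrder_iff`).
Differentiating in `u_j` or `ū_j` lowers this order by at most one
(`VanishesToOrder.seriesDbar`), and a series vanishing to order one vanishes on the torus; hence
the derivatives vanish on the torus (`dUs_dUbars_eq_zero`).

The Poisson bracket is treated through its coefficients (`brHam`). A Cauchy estimate bounds its norm
on a smaller ball by the product of the norms (`fieldNorm_brHam_le`). If the monomials have common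
parts `m`, `m'` and disjoint parts `(a, b)`, `(a', b')`, the combinatorial factor
`(m_j + b_j)(m'_j + a'_j) - (m_j + a_j)(m'_j + b'_j)` has no term `m_j m'_j`: the product of the two
Taylor series is differentiated at most once in the actions (`natCast_mul_shiftMon_eq`). So the
order of vanishing of the bracket is at least the sum of the orders less one
(`VanishesToOrder.brHam`).
-/

namespace TorusProj

open scoped ENNReal ComplexConjugate

noncomputable section

/-- The monomial `v^α = ∏_j v_j^{α_j}` in an arbitrary commutative semiring. -/
def mon {R : Type*} [CommSemiring R] (v : ℤ → R) (α : MIdx) : R := α.prod fun j n => v j ^ n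

theorem mpow_eq_mon (u : ℤ → ℂ) (α : MIdx) : mpow u α = mon u α := rfl

section mon
variable {R : Type*} [CommSemiring R]

@[simp] theorem mon_zero (v : ℤ → R) : mon v 0 = 1 := Finsupp.prod_zero_index

theorem mon_add (v : ℤ → R) (α β : MIdx) : mon v (α + β) = mon v α * mon v β :=
  Finsupp.prod_add_index' (by simp) (by intros; rw [pow_add])

@[simp] theorem mon_single (v : ℤ → R) (j : ℤ) (n : ℕ) : mon v (Finsupp.single j n) = v j ^ n :=
  Finsupp.prod_single_index (by simp)

theorem mon_mul (v w : ℤ → R) (α : MIdx) : mon (fun j => v j * w j) α = mon v α * mon w α := by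
  simp [mon, mul_pow, Finsupp.prod_mul]

theorem mon_sq (v : ℤ → R) (α : MIdx) : mon (fun j => v j ^ 2) α = mon v α * mon v α := by
  simp_rw [pow_two]; exact mon_mul v v α

theorem map_mon {R' F : Type*} [CommSemiring R'] [FunLike F R R'] [MonoidHomClass F R R']
    (f : F) (v : ℤ → R) (α : MIdx) : f (mon v α) = mon (fun j => f (v j)) α := by
  simp [mon, map_finsuppProd]

end mon

theorem len_eq_degree (α : MIdx) : α.len = Finsupp.degree α := rfl

theorem enorm_mon (u : ℤ → ℂ) (α : MIdx) : ‖mon u α‖ₑ = mon (fun j => ‖u j‖ₑ) α := by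
  have := map_mon (nnnormHom (α := ℂ)) u α
  have h2 := map_mon (ENNReal.ofNNRealHom) (fun j => nnnormHom (u j)) α
  rw [← this] at h2
  exact h2

theorem mon_mono {v w : ℤ → ℝ≥0∞} (h : ∀ j, v j ≤ w j) (α : MIdx) : mon v α ≤ mon w α :=
  Finset.prod_le_prod' fun j _ => pow_le_pow_left' (h j) _

theorem mon_const_mul {R : Type*} [CommSemiring R] (c : R) (v : ℤ → R) (α : MIdx) :
    mon (fun j => c * v j) α = c ^ Finsupp.degree α * mon v α := by
  rw [mon_mul]
  congr 1
  simp [mon, Finsupp.prod, Finset.prod_pow_eq_pow_sum, Finsupp.degree_apply]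

theorem mon_ne_top {v : ℤ → ℝ≥0∞} (h : ∀ j, v j ≠ ∞) (α : MIdx) : mon v α ≠ ∞ :=
  ENNReal.prod_ne_top fun j _ => ENNReal.pow_ne_top (h j)

theorem mon_ne_zero {v : ℤ → ℝ≥0∞} (h : ∀ j, v j ≠ 0) (α : MIdx) : mon v α ≠ 0 :=
  Finset.prod_ne_zero_iff.2 fun j _ => pow_ne_zero _ (h j)

/-- Induction on multi-indices, adding one unit at a time. -/
theorem MIdx.induct {p : MIdx → Prop} (h0 : p 0)
    (h1 : ∀ m j, p m → p (m + Finsupp.single j 1)) (m : MIdx) : p m := by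
  induction m using Finsupp.induction with
  | zero => exact h0
  | single_add a b f _ _ ih =>
    rw [add_comm]
    clear * - ih h1
    induction b with
    | zero => simpa using ih
    | succ b hb => rw [Finsupp.single_add, ← add_assoc]; exact h1 _ _ hb

/-! ### Shifted monomials and weighted `ℓ¹` norms of polynomials -/

section poly
open MvPolynomial

/-- The substitution `X_j ↦ X_j + I_j`. -/
def shift (I : ℤ → ℝ) : MvPolynomial ℤ ℝ →ₐ[ℝ] MvPolynomial ℤ ℝ := aeval fun j => X j + C (I j)

theorem shift_monomial (I : ℤ → ℝ) (m : MIdx) (c : ℝ) :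
    shift I (monomial m c) = C c * mon (fun j => X j + C (I j)) m := by
  rw [shift, aeval_monomial]; rfl

theorem shift_shift_neg (I : ℤ → ℝ) (p : MvPolynomial ℤ ℝ) : shift I (shift (-I) p) = p := by
  have : (shift I).comp (shift (-I)) = AlgHom.id ℝ _ := by
    ext j; simp [shift, MvPolynomial.algebraMap_eq]
  exact DFunLike.congr_fun this p

/-- The polynomial `∏_j (X_j + I_j)^{m_j}`, the Taylor expansion of `w^m` at `w = I`. -/
def shiftMon (I : ℤ → ℝ) (m : MIdx) : MvPolynomial ℤ ℝ := mon (fun j => X j + C (I j)) m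

/-- The Taylor coefficient of order `k` of the monomial `w^m` at `w = I`. -/
def tayCoeff (I : ℤ → ℝ) (m k : MIdx) : ℝ := coeff k (shiftMon I m)

theorem shiftMon_add (I : ℤ → ℝ) (m n : MIdx) :
    shiftMon I (m + n) = shiftMon I m * shiftMon I n := mon_add _ _ _

/-- The homogeneous part of degree `q` in `w - I` of the monomial `w^m`. -/
def projPoly (I : ℤ → ℝ) (q : ℕ) (m : MIdx) : MvPolynomial ℤ ℝ :=
  shift (-I) (homogeneousComponent q (shiftMon I m))

theorem coeff_shift (I : ℤ → ℝ) (p : MvPolynomial ℤ ℝ) (k : MIdx) :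
    coeff k (shift I p) = ∑ l ∈ p.support, coeff l p * tayCoeff I l k := by
  conv_lhs => rw [p.as_sum, map_sum, coeff_sum]
  refine Finset.sum_congr rfl fun l _ => ?_
  rw [shift_monomial, coeff_C_mul]; rfl

/-- The norm `∑_l |p_l| V^l` of a polynomial. -/
def polyNorm (V : ℤ → ℝ≥0∞) (p : MvPolynomial ℤ ℝ) : ℝ≥0∞ := ∑' l, ‖coeff l p‖ₑ * mon V l

theorem polyNorm_add_le (V : ℤ → ℝ≥0∞) (p q : MvPolynomial ℤ ℝ) :
    polyNorm V (p + q) ≤ polyNorm V p + polyNorm V q := by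
  unfold polyNorm
  rw [← ENNReal.tsum_add]
  refine ENNReal.tsum_le_tsum fun l => ?_
  rw [← add_mul, coeff_add]
  gcongr
  exact enorm_add_le _ _

@[simp] theorem polyNorm_zero (V : ℤ → ℝ≥0∞) : polyNorm V 0 = 0 := by simp [polyNorm]

theorem polyNorm_sum_le {ι : Type*} (V : ℤ → ℝ≥0∞) (s : Finset ι) (f : ι → MvPolynomial ℤ ℝ) :
    polyNorm V (∑ i ∈ s, f i) ≤ ∑ i ∈ s, polyNorm V (f i) :=
  Finset.le_sum_of_subadditive _ (polyNorm_zero V).le (polyNorm_add_le V) _ _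

theorem polyNorm_C_mul (V : ℤ → ℝ≥0∞) (c : ℝ) (p : MvPolynomial ℤ ℝ) :
    polyNorm V (C c * p) = ‖c‖ₑ * polyNorm V p := by
  simp [polyNorm, enorm_mul, mul_assoc, ENNReal.tsum_mul_left]

theorem polyNorm_X_mul (V : ℤ → ℝ≥0∞) (j : ℤ) (p : MvPolynomial ℤ ℝ) :
    polyNorm V (X j * p) = V j * polyNorm V p := by
  unfold polyNorm
  rw [← ENNReal.tsum_mul_left]
  rw [← (add_right_injective (Finsupp.single j 1)).tsum_eq]
  · refine tsum_congr fun l => ?_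
    rw [coeff_X_mul, mon_add, mon_single, pow_one]; ring
  · intro l hl
    by_contra h
    apply hl
    have : coeff l (X j * p) = 0 := by
      rw [coeff_X_mul', if_neg]
      intro hj
      apply h
      refine ⟨l - Finsupp.single j 1, ?_⟩
      simp only
      rw [add_tsub_cancel_of_le]
      rw [Finsupp.single_le_iff]
      exact Nat.one_le_iff_ne_zero.2 (Finsupp.mem_support_iff.1 hj)
    simp [this]

@[simp] theorem polyNorm_one (V : ℤ → ℝ≥0∞) : polyNorm V 1 = 1 := by
  unfold polyNorm
  rw [tsum_eq_single 0]
  · simp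
  · intro l hl
    simp [coeff_one, hl.symm]

theorem polyNorm_shiftMon_le (V : ℤ → ℝ≥0∞) (I : ℤ → ℝ) (m : MIdx) :
    polyNorm V (shiftMon I m) ≤ mon (fun j => V j + ‖I j‖ₑ) m := by
  induction m using MIdx.induct with
  | h0 => simp [shiftMon]
  | h1 m j ih =>
    rw [shiftMon_add, mon_add, mul_comm (shiftMon I m), mul_comm (mon _ m)]
    simp only [shiftMon, mon_single, pow_one, add_mul] at ih ⊢
    refine (polyNorm_add_le _ _ _).trans ?_
    rw [polyNorm_X_mul, polyNorm_C_mul, ← add_mul, ← add_mul]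
    gcongr

theorem polyNorm_shift_le (V : ℤ → ℝ≥0∞) (I : ℤ → ℝ) (p : MvPolynomial ℤ ℝ) :
    polyNorm V (shift I p) ≤ polyNorm (fun j => V j + ‖I j‖ₑ) p := by
  conv_lhs => rw [p.as_sum, map_sum]
  refine (polyNorm_sum_le _ _ _).trans ?_
  unfold polyNorm
  refine le_trans ?_ (ENNReal.sum_le_tsum p.support)
  refine Finset.sum_le_sum fun l _ => ?_
  rw [shift_monomial]
  exact (polyNorm_C_mul _ _ _).le.trans (mul_le_mul_right (polyNorm_shiftMon_le V I l) _)

theorem homogeneousComponent_succ_X_mul (q : ℕ) (j : ℤ) (p : MvPolynomial ℤ ℝ) :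
    homogeneousComponent (q + 1) (X j * p) = X j * homogeneousComponent q p := by
  ext l
  simp only [coeff_homogeneousComponent, coeff_X_mul']
  by_cases hj : j ∈ l.support
  · have : Finsupp.degree l = Finsupp.degree (l - Finsupp.single j 1) + 1 := by
      conv_lhs => rw [← tsub_add_cancel_of_le (a := Finsupp.single j 1) (b := l)
        (by rw [Finsupp.single_le_iff]
            exact Nat.one_le_iff_ne_zero.2 (Finsupp.mem_support_iff.1 hj))]
      rw [map_add, Finsupp.degree_single]
    simp [hj, this]
  · simp [hj]

theorem homogeneousComponent_zero_X_mul (j : ℤ) (p : MvPolynomial ℤ ℝ) :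
    homogeneousComponent 0 (X j * p) = 0 := by
  rw [homogeneousComponent_zero]; simp [coeff_X_mul']

/-- The coefficient of `t^q` in `(x + ζ t)^M`. -/
def binCoeff (x ζ : ℝ≥0∞) (M q : ℕ) : ℝ≥0∞ := M.choose q * x ^ (M - q) * ζ ^ q

theorem binCoeff_succ_zero (x ζ : ℝ≥0∞) (M : ℕ) :
    binCoeff x ζ (M + 1) 0 = x * binCoeff x ζ M 0 := by
  simp [binCoeff, pow_succ']

theorem binCoeff_succ_succ (x ζ : ℝ≥0∞) (M q : ℕ) :
    binCoeff x ζ (M + 1) (q + 1) = ζ * binCoeff x ζ M q + x * binCoeff x ζ M (q + 1) := by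
  unfold binCoeff
  rw [Nat.choose_succ_succ, Nat.add_sub_add_right]
  rcases Nat.lt_or_ge q M with h | h
  · obtain ⟨n, rfl⟩ := Nat.exists_eq_add_of_lt h
    rw [show q + n + 1 - q = n + 1 by omega, show q + n + 1 - (q + 1) = n by omega]
    push_cast; ring
  · rw [Nat.choose_eq_zero_of_lt (by omega : M < q + 1)]
    push_cast; ring

/-- The norm of the part of degree `q` of `(X + I)^m` is bounded by the corresponding part of the
one-variable polynomial `(x + ζ t)^{|m|}`; the recursion on `m` is Pascal's rule. -/
theorem polyNorm_homogeneousComponent_shiftMon_le {I : ℤ → ℝ} {U Z : ℤ → ℝ≥0∞} {x ζ : ℝ≥0∞}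
    (hI : ∀ j, ‖I j‖ₑ ≤ x * U j) (hZ : ∀ j, Z j ≤ ζ * U j) (q : ℕ) (m : MIdx) :
    polyNorm Z (homogeneousComponent q (shiftMon I m)) ≤
      binCoeff x ζ (Finsupp.degree m) q * mon U m := by
  induction m using MIdx.induct generalizing q with
  | h0 =>
    rcases q with _ | q
    · simp [shiftMon, binCoeff]
    · rw [shiftMon, mon_zero, homogeneousComponent_eq_zero]
      · simp
      · simp
  | h1 m j ih =>
    rw [shiftMon_add, mon_add, mul_comm (shiftMon I m), mul_comm (mon _ m)]
    simp only [shiftMon, mon_single, pow_one, add_mul, map_add, Finsupp.degree_single] at ih ⊢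
    refine (polyNorm_add_le _ _ _).trans ?_
    rw [homogeneousComponent_C_mul, polyNorm_C_mul]
    rcases q with _ | q
    · rw [homogeneousComponent_zero_X_mul, binCoeff_succ_zero, polyNorm_zero, zero_add]
      calc _ ≤ x * U j * (binCoeff x ζ (Finsupp.degree m) 0 * mon U m) := by
            gcongr; exacts [hI j, ih 0]
        _ = _ := by ring
    · rw [homogeneousComponent_succ_X_mul, binCoeff_succ_succ, polyNorm_X_mul]
      calc _ ≤ ζ * U j * (binCoeff x ζ (Finsupp.degree m) q * mon U m) +
              x * U j * (binCoeff x ζ (Finsupp.degree m) (q + 1) * mon U m) := by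
            gcongr; exacts [hZ j, ih q, hI j, ih (q + 1)]
        _ = _ := by ring

theorem polyNorm_projPoly_le {I : ℤ → ℝ} {U V : ℤ → ℝ≥0∞} {x ζ : ℝ≥0∞}
    (hI : ∀ j, ‖I j‖ₑ ≤ x * U j) (hZ : ∀ j, V j + ‖I j‖ₑ ≤ ζ * U j) (q : ℕ) (m : MIdx) :
    polyNorm V (projPoly I q m) ≤ binCoeff x ζ (Finsupp.degree m) q * mon U m := by
  refine (polyNorm_shift_le V (-I) _).trans ?_
  refine (polyNorm_homogeneousComponent_shiftMon_le hI ?_ q m)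
  simpa using hZ

/-- `w^m` only involves monomials `w^l` with `l ≤ m` in its expansion at `I`. -/
theorem tayCoeff_eq_zero_of_not_le {I : ℤ → ℝ} {m k : MIdx} (h : ¬ k ≤ m) :
    tayCoeff I m k = 0 := by
  induction m using MIdx.induct generalizing k with
  | h0 =>
    have : (0 : MIdx) ≠ k := by rintro rfl; exact h le_rfl
    simp [tayCoeff, shiftMon, coeff_one, this]
  | h1 m j ih =>
    have h1 : ¬ k ≤ m := fun h' => h (h'.trans le_self_add)
    unfold tayCoeff at ih ⊢
    rw [shiftMon_add, mul_comm]
    simp only [shiftMon, mon_single, pow_one, add_mul, coeff_add, coeff_C_mul] at ih ⊢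
    rw [ih h1, mul_zero, add_zero, coeff_X_mul']
    split_ifs with hj
    · refine ih fun h' => h ?_
      rwa [tsub_le_iff_right] at h'
    · rfl

theorem coeff_projPoly (I : ℤ → ℝ) (q : ℕ) (m l : MIdx) :
    coeff l (projPoly I q m) = ∑ k ∈ (shiftMon I m).support,
      (if Finsupp.degree k = q then tayCoeff I m k * tayCoeff (-I) k l else 0) := by
  rw [projPoly, coeff_shift]
  rw [Finset.sum_subset (s₂ := (shiftMon I m).support)]
  · refine Finset.sum_congr rfl fun k _ => ?_
    rw [coeff_homogeneousComponent]; simp [tayCoeff]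
  · intro k hk
    rw [mem_support_iff, coeff_homogeneousComponent] at hk
    rw [mem_support_iff]
    intro h; simp [h] at hk
  · intro k _ hk
    rw [notMem_support_iff.1 hk, zero_mul]

theorem coeff_projPoly_eq_zero {I : ℤ → ℝ} {q : ℕ} {m l : MIdx} (h : ¬ l ≤ m) :
    coeff l (projPoly I q m) = 0 := by
  rw [coeff_projPoly]
  refine Finset.sum_eq_zero fun k _ => ?_
  split_ifs
  · by_cases hk : k ≤ m
    · rw [tayCoeff_eq_zero_of_not_le (fun hl => h (hl.trans hk)), mul_zero]
    · rw [tayCoeff_eq_zero_of_not_le hk, zero_mul]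
  · rfl

/-- Re-expanding the homogeneous part of degree `q` at `I` recovers the Taylor coefficients of
order `q`. -/
theorem sum_coeff_projPoly_mul_tayCoeff (I : ℤ → ℝ) (q : ℕ) (m k : MIdx) :
    ∑ l ∈ (projPoly I q m).support, coeff l (projPoly I q m) * tayCoeff I l k =
      if Finsupp.degree k = q then tayCoeff I m k else 0 := by
  rw [← coeff_shift, projPoly, shift_shift_neg, coeff_homogeneousComponent]; rfl

theorem aeval_projPoly (I : ℤ → ℝ) (q : ℕ) (m : MIdx) (W : ℤ → ℂ) :
    aeval W (projPoly I q m) =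
      aeval (fun j => W j - I j) (homogeneousComponent q (shiftMon I m)) := by
  rw [projPoly, shift, ← AlgHom.comp_apply]
  congr 1
  ext j
  simp [sub_eq_add_neg]

theorem aeval_mul_of_isHomogeneous {p : MvPolynomial ℤ ℝ} {q : ℕ} (hp : p.IsHomogeneous q)
    (t : ℂ) (y : ℤ → ℂ) : aeval (fun j => t * y j) p = t ^ q * aeval y p := by
  rw [aeval_def, aeval_def, eval₂_eq, eval₂_eq, Finset.mul_sum]
  refine Finset.sum_congr rfl fun d hd => ?_
  have hd : Finsupp.degree d = q := by
    by_contra h; exact (mem_support_iff.1 hd) (hp.coeff_eq_zero h)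
  rw [Finset.prod_congr rfl fun i _ => mul_pow t (y i) (d i), Finset.prod_mul_distrib,
    Finset.prod_pow_eq_pow_sum, ← Finsupp.degree_apply, hd]
  ring

theorem homogeneousComponent_shiftMon_eq_zero {I : ℤ → ℝ} {q : ℕ} {m : MIdx}
    (h : Finsupp.degree m < q) : homogeneousComponent q (shiftMon I m) = 0 := by
  ext k
  rw [coeff_homogeneousComponent, coeff_zero]
  split_ifs with hk
  · refine tayCoeff_eq_zero_of_not_le fun hkm => ?_
    have := Finsupp.degree_mono hkm
    omega
  · rfl

theorem projPoly_eq_zero {I : ℤ → ℝ} {q : ℕ} {m : MIdx} (h : Finsupp.degree m < q) :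
    projPoly I q m = 0 := by
  rw [projPoly, homogeneousComponent_shiftMon_eq_zero h, map_zero]

/-- The function `t ↦ (I + t (W - I))^m` has `q`-th coefficient `projPoly I q m` at `W`. -/
theorem mon_line_eq_sum (I : ℤ → ℝ) (m : MIdx) (W : ℤ → ℂ) (t : ℂ) :
    mon (fun j => (I j : ℂ) + t * (W j - I j)) m =
      ∑ q ∈ Finset.range (Finsupp.degree m + 1), t ^ q * aeval W (projPoly I q m) := by
  have h1 : shiftMon I m = ∑ q ∈ Finset.range (Finsupp.degree m + 1),
      homogeneousComponent q (shiftMon I m) := by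
    ext k
    simp only [coeff_sum, coeff_homogeneousComponent, Finset.sum_ite_eq, Finset.mem_range]
    split_ifs with hk
    · rfl
    · refine tayCoeff_eq_zero_of_not_le fun hkm => hk ?_
      have := Finsupp.degree_mono hkm
      omega
  have h2 : mon (fun j => (I j : ℂ) + t * (W j - I j)) m =
      aeval (fun j => t * (W j - I j)) (shiftMon I m) := by
    rw [shiftMon, map_mon]
    congr 1
    ext j
    simp [add_comm]
  rw [h2, h1, map_sum]
  refine Finset.sum_congr rfl fun q _ => ?_
  rw [aeval_projPoly, aeval_mul_of_isHomogeneous (homogeneousComponent_isHomogeneous q _)]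

theorem tsum_coeff_projPoly_mul_mon (I : ℤ → ℝ) (q : ℕ) (m : MIdx) (W : ℤ → ℂ) :
    ∑' l, ((coeff l (projPoly I q m) : ℝ) : ℂ) * mon W l = aeval W (projPoly I q m) := by
  rw [tsum_eq_sum (s := (projPoly I q m).support), aeval_def, eval₂_eq]
  · rfl
  · intro l hl; simp [notMem_support_iff.1 hl]

end poly

/-! ### Exchanging absolutely convergent sums -/

theorem summable_norm_of_tsum_enorm {ι : Type*} {f : ι → ℂ} (h : ∑' i, ‖f i‖ₑ ≠ ∞) :
    Summable fun i => ‖f i‖ := by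
  simpa using ENNReal.summable_toReal h

theorem tsum_enorm_ne_top {ι : Type*} {f : ι → ℂ} (h : Summable fun i => ‖f i‖) :
    ∑' i, ‖f i‖ₑ ≠ ∞ := by
  have h' : Summable fun i => ‖f i‖₊ := NNReal.summable_coe.1 h
  exact ENNReal.tsum_coe_ne_top_iff_summable.2 h'

theorem summable_norm_prod {ι ι' : Type*} {f : ι → ι' → ℂ}
    (h : ∑' i, ∑' k, ‖f i k‖ₑ ≠ ∞) : Summable fun p : ι × ι' => ‖f p.1 p.2‖ := by
  rw [← ENNReal.tsum_prod] at h
  exact summable_norm_of_tsum_enorm h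

theorem tsum_comm_of_enorm {ι ι' : Type*} {f : ι → ι' → ℂ}
    (h : ∑' i, ∑' k, ‖f i k‖ₑ ≠ ∞) : ∑' i, ∑' k, f i k = ∑' k, ∑' i, f i k :=
  (Summable.of_norm (summable_norm_prod h) : Summable (Function.uncurry f)).tsum_comm.symm

/-- Associativity of the product of a row vector, a matrix and a column vector with infinitely
many entries. -/
theorem tsum_mul_matrix_comm {ι ι' : Type*} {h : ι → ℂ} {c : ι → ι' → ℂ} {b : ι' → ℂ}
    {ν : ι → ℝ≥0∞} (hh : ∑' m, ‖h m‖ₑ * ν m ≠ ∞) {K : ℝ≥0∞} (hK : K ≠ ∞)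
    (hc : ∀ m, ∑' l, ‖c m l‖ₑ * ‖b l‖ₑ ≤ K * ν m) :
    ∑' l, (∑' m, h m * c m l) * b l = ∑' m, h m * ∑' l, c m l * b l := by
  simp_rw [← tsum_mul_left, ← tsum_mul_right]
  rw [tsum_comm_of_enorm]
  · simp_rw [mul_assoc]
  · rw [ENNReal.tsum_comm]
    refine ne_top_of_le_ne_top (ENNReal.mul_ne_top hK hh) ?_
    rw [← ENNReal.tsum_mul_left]
    refine ENNReal.tsum_le_tsum fun m => ?_
    simp_rw [enorm_mul, mul_assoc, ENNReal.tsum_mul_left]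
    calc _ ≤ ‖h m‖ₑ * (K * ν m) := by gcongr; exact hc m
      _ = _ := by ring

theorem tsum_enorm_tsum_mul_le {ι ι' : Type*} (h : ι → ℂ) (c : ι → ι' → ℂ) (b : ι' → ℝ≥0∞) :
    ∑' l, ‖∑' m, h m * c m l‖ₑ * b l ≤ ∑' m, ‖h m‖ₑ * ∑' l, ‖c m l‖ₑ * b l := by
  calc _ ≤ ∑' l, (∑' m, ‖h m * c m l‖ₑ) * b l := by
        gcongr; exact enorm_tsum_le_tsum_enorm
    _ = _ := by
        simp_rw [← ENNReal.tsum_mul_right, ← ENNReal.tsum_mul_left]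
        rw [ENNReal.tsum_comm]
        simp_rw [enorm_mul, mul_assoc]

theorem summable_mul_of_enorm_le {ι : Type*} {h c : ι → ℂ} {ν : ι → ℝ≥0∞}
    (hh : ∑' m, ‖h m‖ₑ * ν m ≠ ∞) {K : ℝ≥0∞} (hK : K ≠ ∞) (hc : ∀ m, ‖c m‖ₑ ≤ K * ν m) :
    Summable fun m => ‖h m * c m‖ := by
  refine summable_norm_of_tsum_enorm (ne_top_of_le_ne_top (ENNReal.mul_ne_top hK hh) ?_)
  rw [← ENNReal.tsum_mul_left]
  refine ENNReal.tsum_le_tsum fun m => ?_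
  rw [enorm_mul]
  calc _ ≤ ‖h m‖ₑ * (K * ν m) := by gcongr; exact hc m
    _ = _ := by ring

/-! ### The constant -/

/-- For `κ² ≤ 1/2` use `binom(M,q) ≤ 2^M`; otherwise `(M L)^q / q! ≤ e^{M L}` with
`L = log κ⁻²`. -/
theorem choose_mul_pow_le {κ : ℝ} (hκ : 0 < κ) (hκ1 : κ < 1) (M q : ℕ) :
    (M.choose q : ℝ) * (κ ^ 2) ^ M ≤ cKappa κ ^ q := by
  have h0 : 0 < κ ^ 2 := by positivity
  have h1 : κ ^ 2 < 1 := by nlinarith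
  rcases Nat.lt_or_ge M q with h | h
  · rw [Nat.choose_eq_zero_of_lt h]
    have : 0 ≤ cKappa κ := by
      unfold cKappa; split_ifs
      · exact one_div_nonneg.2 (Real.log_nonneg ((one_le_inv₀ h0).2 h1.le))
      · positivity
    simpa using pow_nonneg this q
  unfold cKappa
  split_ifs with hc
  · set L := Real.log ((κ ^ 2)⁻¹) with hL
    have hLp : 0 < L := Real.log_pos ((one_lt_inv₀ h0).2 h1)
    have hexp : (κ ^ 2) ^ M = Real.exp (-(M * L)) := by
      rw [hL, Real.log_inv, mul_neg, neg_neg, Real.exp_nat_mul, Real.exp_log h0]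
    rw [hexp, one_div, inv_pow, Real.exp_neg, ← div_eq_mul_inv, div_le_iff₀ (Real.exp_pos _),
      ← div_eq_inv_mul, le_div_iff₀ (by positivity)]
    calc (M.choose q : ℝ) * L ^ q ≤ (M : ℝ) ^ q / q.factorial * L ^ q := by
          gcongr; exact Nat.choose_le_pow_div q M
      _ = (M * L) ^ q / q.factorial := by rw [mul_pow]; ring
      _ ≤ _ := Real.pow_div_factorial_le_exp _ (by positivity) q
  · push Not at hc
    calc (M.choose q : ℝ) * (κ ^ 2) ^ M ≤ 2 ^ M * (κ ^ 2) ^ M := by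
          gcongr; exact_mod_cast Nat.choose_le_two_pow M q
      _ = (2 * κ ^ 2) ^ M := by rw [mul_pow]
      _ ≤ _ := pow_le_pow_of_le_one (by positivity) (by linarith) h

theorem binCoeff_le {κ : ℝ} (hκ : 0 < κ) (hκ1 : κ < 1) {y : ℝ} (hy : 0 ≤ y) (M q : ℕ) :
    binCoeff (ENNReal.ofReal (κ ^ 2)) (ENNReal.ofReal (κ ^ 2 + y)) M q ≤
      ENNReal.ofReal ((1 + y / κ ^ 2) ^ q * cKappa κ ^ q) := by
  unfold binCoeff
  rcases Nat.lt_or_ge M q with h | h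
  · simp [Nat.choose_eq_zero_of_lt h]
  rw [← ENNReal.ofReal_pow (by positivity), ← ENNReal.ofReal_pow (by positivity),
    ← ENNReal.ofReal_natCast, ← ENNReal.ofReal_mul (by positivity),
    ← ENNReal.ofReal_mul (by positivity)]
  refine ENNReal.ofReal_le_ofReal ?_
  have h1 : κ ^ 2 + y = κ ^ 2 * (1 + y / κ ^ 2) := by field_simp
  obtain ⟨n, rfl⟩ := Nat.exists_eq_add_of_le h
  rw [h1, mul_pow (κ ^ 2), Nat.add_sub_cancel_left]
  calc _ = (1 + y / κ ^ 2) ^ q * (((q + n).choose q : ℝ) * (κ ^ 2) ^ (q + n)) := by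
        rw [pow_add]; ring
    _ ≤ _ := by gcongr; exact choose_mul_pow_le hκ hκ1 _ _

/-! ### Taylor coefficients and projections in the action variables -/

/-- The Taylor coefficient of order `k` at `w = I` of the series `∑_m h_m w^m`. -/
def taySeq (I : ℤ → ℝ) (h : MIdx → ℂ) (k : MIdx) : ℂ := ∑' m, h m * (tayCoeff I m k : ℝ)

/-- The coefficients of the homogeneous part of degree `q` in `w - I` of `∑_m h_m w^m`. -/
def projSeq (I : ℤ → ℝ) (q : ℕ) (h : MIdx → ℂ) (l : MIdx) : ℂ :=
  ∑' m, h m * (MvPolynomial.coeff l (projPoly I q m) : ℝ)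

section seq
variable {I : ℤ → ℝ} {U : ℤ → ℝ≥0∞} {κ : ℝ}

theorem enorm_ofReal' (x : ℝ) : ‖(x : ℂ)‖ₑ = ‖x‖ₑ := by
  rw [← ofReal_norm, ← ofReal_norm, Complex.norm_real]

theorem polyNorm_projPoly_le_const (hκ : 0 < κ) (hκ1 : κ < 1)
    (hI : ∀ j, ‖I j‖ₑ ≤ ENNReal.ofReal (κ ^ 2) * U j) {V : ℤ → ℝ≥0∞} {y : ℝ} (hy : 0 ≤ y)
    (hV : ∀ j, V j ≤ ENNReal.ofReal y * U j) (q : ℕ) (m : MIdx) :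
    polyNorm V (projPoly I q m) ≤
      ENNReal.ofReal ((1 + y / κ ^ 2) ^ q * cKappa κ ^ q) * mon U m := by
  refine (polyNorm_projPoly_le hI (ζ := ENNReal.ofReal (κ ^ 2 + y)) (fun j => ?_) q m).trans ?_
  · rw [ENNReal.ofReal_add (by positivity) hy, add_mul, add_comm]
    exact add_le_add (hI j) (hV j)
  · gcongr
    exact binCoeff_le hκ hκ1 hy _ _

theorem enorm_coeff_le (p : MvPolynomial ℤ ℝ) {V : ℤ → ℝ≥0∞} (h0 : ∀ j, V j ≠ 0)
    (hT : ∀ j, V j ≠ ∞) (l : MIdx) :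
    ‖MvPolynomial.coeff l p‖ₑ ≤ polyNorm V p * (mon V l)⁻¹ := by
  rw [← div_eq_mul_inv, ENNReal.le_div_iff_mul_le (Or.inl (mon_ne_zero h0 l))
    (Or.inl (mon_ne_top hT l))]
  exact ENNReal.le_tsum (f := fun l => ‖MvPolynomial.coeff l p‖ₑ * mon V l) l

/-- Cauchy estimate for the Taylor coefficients at an interior point. -/
theorem exists_enorm_tayCoeff_le (hκ1 : κ < 1) (hκ : 0 < κ)
    (hI : ∀ j, ‖I j‖ₑ ≤ ENNReal.ofReal (κ ^ 2) * U j) (h0 : ∀ j, U j ≠ 0) (hT : ∀ j, U j ≠ ∞)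
    (k : MIdx) : ∃ K : ℝ≥0∞, K ≠ ∞ ∧ ∀ m, ‖tayCoeff I m k‖ₑ ≤ K * mon U m := by
  -- the polydisc of radii `(1 - κ²) U` around `I` stays within the polydisc of radii `U`
  have h1 : 0 < 1 - κ ^ 2 := by nlinarith
  have hV0 : ∀ j, ENNReal.ofReal (1 - κ ^ 2) * U j ≠ 0 := fun j =>
    mul_ne_zero (by simpa using h1) (h0 j)
  have hVT : ∀ j, ENNReal.ofReal (1 - κ ^ 2) * U j ≠ ∞ := fun j =>
    ENNReal.mul_ne_top ENNReal.ofReal_ne_top (hT j)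
  refine ⟨(mon (fun j => ENNReal.ofReal (1 - κ ^ 2) * U j) k)⁻¹,
    ENNReal.inv_ne_top.2 (mon_ne_zero hV0 k), fun m => ?_⟩
  refine (enorm_coeff_le _ hV0 hVT k).trans ?_
  rw [mul_comm]
  gcongr
  refine (polyNorm_shiftMon_le _ I m).trans (mon_mono (fun j => ?_) m)
  calc _ ≤ ENNReal.ofReal (1 - κ ^ 2) * U j + ENNReal.ofReal (κ ^ 2) * U j := by
        gcongr; exact hI j
    _ = U j := by
        rw [← add_mul, ← ENNReal.ofReal_add h1.le (by positivity)]; simp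

theorem summable_taySeq (hκ : 0 < κ) (hκ1 : κ < 1)
    (hI : ∀ j, ‖I j‖ₑ ≤ ENNReal.ofReal (κ ^ 2) * U j) (h0 : ∀ j, U j ≠ 0) (hT : ∀ j, U j ≠ ∞)
    {h : MIdx → ℂ} (hh : ∑' m, ‖h m‖ₑ * mon U m ≠ ∞) (k : MIdx) :
    Summable fun m => ‖h m * (tayCoeff I m k : ℝ)‖ := by
  obtain ⟨K, hK, hb⟩ := exists_enorm_tayCoeff_le hκ1 hκ hI h0 hT k
  exact summable_mul_of_enorm_le hh hK fun m => by rw [enorm_ofReal']; exact hb m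

/-- The projections do not increase the exponents, so the estimate persists with an additional
monotone weight. -/
theorem tsum_enorm_projSeq_le (hκ : 0 < κ) (hκ1 : κ < 1)
    (hI : ∀ j, ‖I j‖ₑ ≤ ENNReal.ofReal (κ ^ 2) * U j) {V : ℤ → ℝ≥0∞} {y : ℝ} (hy : 0 ≤ y)
    (hV : ∀ j, V j ≤ ENNReal.ofReal y * U j) (q : ℕ) (h : MIdx → ℂ)
    {f : MIdx → ℝ≥0∞} (hf : Monotone f) :
    ∑' l, ‖projSeq I q h l‖ₑ * (f l * mon V l) ≤
      ENNReal.ofReal ((1 + y / κ ^ 2) ^ q * cKappa κ ^ q) *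
        ∑' m, ‖h m‖ₑ * (f m * mon U m) := by
  refine (tsum_enorm_tsum_mul_le _ _ _).trans ?_
  rw [← ENNReal.tsum_mul_left]
  refine ENNReal.tsum_le_tsum fun m => ?_
  rw [mul_left_comm]
  gcongr
  calc _ ≤ ∑' l, f m * (‖MvPolynomial.coeff l (projPoly I q m)‖ₑ * mon V l) := by
        refine ENNReal.tsum_le_tsum fun l => ?_
        rw [enorm_ofReal', mul_left_comm (f m)]
        by_cases hl : l ≤ m
        · gcongr; exact hf hl
        · simp [coeff_projPoly_eq_zero hl]
    _ ≤ _ := by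
        rw [ENNReal.tsum_mul_left, mul_left_comm]
        gcongr
        exact polyNorm_projPoly_le_const hκ hκ1 hI hy hV q m

theorem summable_projSeq (hκ : 0 < κ) (hκ1 : κ < 1)
    (hI : ∀ j, ‖I j‖ₑ ≤ ENNReal.ofReal (κ ^ 2) * U j) (h0 : ∀ j, U j ≠ 0) (hT : ∀ j, U j ≠ ∞)
    {h : MIdx → ℂ} (hh : ∑' m, ‖h m‖ₑ * mon U m ≠ ∞) (q : ℕ) (l : MIdx) :
    Summable fun m => ‖h m * (MvPolynomial.coeff l (projPoly I q m) : ℝ)‖ := by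
  refine summable_mul_of_enorm_le (K := (mon U l)⁻¹ *
    ENNReal.ofReal ((1 + 1 / κ ^ 2) ^ q * cKappa κ ^ q)) hh
    (ENNReal.mul_ne_top (ENNReal.inv_ne_top.2 (mon_ne_zero h0 l)) ENNReal.ofReal_ne_top)
    fun m => ?_
  rw [enorm_ofReal']
  refine (enorm_coeff_le _ h0 hT l).trans ?_
  rw [mul_comm, mul_assoc]
  gcongr
  exact polyNorm_projPoly_le_const hκ hκ1 hI zero_le_one (by simp) q m

/-- The Taylor coefficients of the homogeneous part of degree `q`. -/
theorem taySeq_projSeq (hκ : 0 < κ) (hκ1 : κ < 1)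
    (hI : ∀ j, ‖I j‖ₑ ≤ ENNReal.ofReal (κ ^ 2) * U j) (h0 : ∀ j, U j ≠ 0) (hT : ∀ j, U j ≠ ∞)
    {h : MIdx → ℂ} (hh : ∑' m, ‖h m‖ₑ * mon U m ≠ ∞) (q : ℕ) (k : MIdx) :
    taySeq I (projSeq I q h) k = if Finsupp.degree k = q then taySeq I h k else 0 := by
  obtain ⟨K, hK, hb⟩ := exists_enorm_tayCoeff_le hκ1 hκ hI h0 hT k
  unfold taySeq projSeq
  rw [tsum_mul_matrix_comm hh
    (K := K * ENNReal.ofReal ((1 + 1 / κ ^ 2) ^ q * cKappa κ ^ q))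
    (ENNReal.mul_ne_top hK ENNReal.ofReal_ne_top)]
  · have : ∀ m, ∑' l, ((MvPolynomial.coeff l (projPoly I q m) : ℝ) : ℂ) * (tayCoeff I l k : ℝ) =
        ((if Finsupp.degree k = q then tayCoeff I m k else 0 : ℝ) : ℂ) := by
      intro m
      rw [← sum_coeff_projPoly_mul_tayCoeff, tsum_eq_sum (s := (projPoly I q m).support)]
      · push_cast; rfl
      · intro l hl; simp [MvPolynomial.notMem_support_iff.1 hl]
    simp_rw [this]
    split_ifs <;> simp
  · intro m
    calc _ ≤ ∑' l, K * (‖MvPolynomial.coeff l (projPoly I q m)‖ₑ * mon U l) := by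
          refine ENNReal.tsum_le_tsum fun l => ?_
          rw [enorm_ofReal', enorm_ofReal', mul_left_comm K]
          gcongr; exact hb l
      _ ≤ _ := by
          rw [ENNReal.tsum_mul_left, mul_assoc]
          gcongr
          exact polyNorm_projPoly_le_const hκ hκ1 hI zero_le_one (by simp) q m

/-- The homogeneous part of degree `q` in terms of the Taylor coefficients of order `q`. -/
theorem projSeq_eq_tsum_taySeq (hκ : 0 < κ) (hκ1 : κ < 1)
    (hI : ∀ j, ‖I j‖ₑ ≤ ENNReal.ofReal (κ ^ 2) * U j) (h0 : ∀ j, U j ≠ 0) (hT : ∀ j, U j ≠ ∞)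
    {h : MIdx → ℂ} (hh : ∑' m, ‖h m‖ₑ * mon U m ≠ ∞) (q : ℕ) (l : MIdx) :
    projSeq I q h l = ∑' k, taySeq I h k *
      ((if Finsupp.degree k = q then tayCoeff (-I) k l else 0 : ℝ) : ℂ) := by
  unfold taySeq projSeq
  rw [tsum_mul_matrix_comm hh (K := (mon U l)⁻¹ *
    ENNReal.ofReal ((1 + 1 / κ ^ 2) ^ q * cKappa κ ^ q))
    (ENNReal.mul_ne_top (ENNReal.inv_ne_top.2 (mon_ne_zero h0 l)) ENNReal.ofReal_ne_top)]
  · refine tsum_congr fun m => ?_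
    congr 1
    rw [coeff_projPoly, tsum_eq_sum (s := (shiftMon I m).support)]
    · push_cast
      refine Finset.sum_congr rfl fun k _ => ?_
      split_ifs <;> simp
    · intro k hk
      simp [tayCoeff, MvPolynomial.notMem_support_iff.1 hk]
  · intro m
    have hb : ∀ k, ‖tayCoeff (-I) k l‖ₑ ≤ (mon U l)⁻¹ * mon (fun j => U j + ‖I j‖ₑ) k := by
      intro k
      refine (enorm_coeff_le _ h0 hT l).trans ?_
      rw [mul_comm]
      gcongr
      simpa using polyNorm_shiftMon_le U (-I) k
    calc _ ≤ ∑' k, (mon U l)⁻¹ * (‖MvPolynomial.coeff k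
            (MvPolynomial.homogeneousComponent q (shiftMon I m))‖ₑ *
              mon (fun j => U j + ‖I j‖ₑ) k) := by
          refine ENNReal.tsum_le_tsum fun k => ?_
          rw [enorm_ofReal', enorm_ofReal', MvPolynomial.coeff_homogeneousComponent]
          split_ifs
          · rw [mul_left_comm]
            gcongr
            · rfl
            · exact hb k
          · simp
      _ ≤ _ := by
          rw [ENNReal.tsum_mul_left, mul_assoc]
          gcongr
          refine (polyNorm_homogeneousComponent_shiftMon_le hI
            (ζ := ENNReal.ofReal (κ ^ 2 + 1)) (fun j => ?_) q m).trans ?_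
          · rw [ENNReal.ofReal_add (by positivity) zero_le_one, add_mul, add_comm]
            simp only [ENNReal.ofReal_one, one_mul]
            gcongr; exact hI j
          · gcongr; exact binCoeff_le hκ hκ1 zero_le_one _ _

end seq

/-! ### Weights and balls -/

section weights
variable {θ p s a : ℝ}

theorem one_le_japBracket (j : ℤ) : 1 ≤ japBracket j := le_max_right _ _

theorem japBracket_le_weight (hp : 1 < p) (hs : 0 < s) (ha : 0 ≤ a) (j : ℤ) :
    japBracket j ≤ weight θ p s a j := by
  have h1 := one_le_japBracket j
  have h2 : japBracket j ≤ japBracket j ^ p := by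
    simpa using Real.rpow_le_rpow_of_exponent_le h1 hp.le
  have h3 : 1 ≤ Real.exp (a * |(j : ℝ)| + s * japBracket j ^ θ) :=
    Real.one_le_exp (by positivity [japBracket])
  calc japBracket j ≤ japBracket j ^ p * 1 := by simpa using h2
    _ ≤ _ := by unfold weight; gcongr

theorem weight_pos (j : ℤ) : 0 < weight θ p s a j := by
  have := one_le_japBracket j
  unfold weight; positivity

/-- The largest modulus of the `j`-th entry of a point of the closed ball of radius `r`. -/
def rad (θ p s a r : ℝ) (j : ℤ) : ℝ≥0∞ := ENNReal.ofReal (r / weight θ p s a j)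

theorem rad_ne_top (r : ℝ) (j : ℤ) : rad θ p s a r j ≠ ∞ := ENNReal.ofReal_ne_top

theorem rad_ne_zero {r : ℝ} (hr : 0 < r) (j : ℤ) : rad θ p s a r j ≠ 0 := by
  simpa [rad] using div_pos hr (weight_pos j)

theorem rad_mono {r r' : ℝ} (h : r' ≤ r) (j : ℤ) : rad θ p s a r' j ≤ rad θ p s a r j := by
  have := weight_pos (θ := θ) (p := p) (s := s) (a := a) j
  unfold rad; gcongr

theorem rad_mul {c : ℝ} (hc : 0 ≤ c) (r : ℝ) (j : ℤ) :
    rad θ p s a (c * r) j = ENNReal.ofReal c * rad θ p s a r j := by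
  rw [rad, mul_div_assoc, ENNReal.ofReal_mul hc]; rfl

theorem seqNorm_le_iff {r : ℝ} (hr : 0 ≤ r) (u : ℤ → ℂ) :
    seqNorm θ p s a u ≤ ENNReal.ofReal r ↔ ∀ j, ‖u j‖ₑ ≤ rad θ p s a r j := by
  rw [seqNorm, iSup_le_iff]
  refine forall_congr' fun j => ?_
  have := weight_pos (θ := θ) (p := p) (s := s) (a := a) j
  rw [rad, ← ofReal_norm, ENNReal.ofReal_le_ofReal_iff hr,
    ENNReal.ofReal_le_ofReal_iff (by positivity), le_div_iff₀ this]

theorem exists_of_seqNorm_lt {r : ℝ} {u : ℤ → ℂ} (h : seqNorm θ p s a u < ENNReal.ofReal r) :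
    ∃ ρ, 0 < ρ ∧ ρ < r ∧ ∀ j, ‖u j‖ₑ ≤ rad θ p s a ρ j := by
  obtain ⟨c, hc1, hc2⟩ := exists_between h
  have hr : 0 < r := ENNReal.ofReal_pos.1 (lt_of_le_of_lt zero_le h)
  have hcT : c ≠ ∞ := (hc2.trans ENNReal.ofReal_lt_top).ne
  have hc0 : 0 < c := lt_of_le_of_lt zero_le hc1
  have hρ : 0 < c.toReal := ENNReal.toReal_pos hc0.ne' hcT
  refine ⟨c.toReal, hρ, ?_, (seqNorm_le_iff hρ.le u).1 ?_⟩
  · rwa [← ENNReal.ofReal_lt_ofReal_iff hr, ENNReal.ofReal_toReal hcT]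
  · rw [ENNReal.ofReal_toReal hcT]; exact hc1.le

theorem tsum_rad_sq_ne_top (hp : 1 < p) (hs : 0 < s) (ha : 0 ≤ a) {r : ℝ} (hr : 0 < r) :
    ∑' j, rad θ p s a r j ^ 2 ≠ ∞ := by
  have h1 : Summable fun j : ℤ => (r / weight θ p s a j) ^ 2 := by
    have h2 : Summable fun j : ℤ => r ^ 2 * (1 / (j : ℝ) ^ 2) :=
      (Real.summable_one_div_int_pow.2 (by norm_num)).mul_left _
    have h3 : Summable fun j : ℤ => if j = 0 then r ^ 2 else 0 :=
      summable_of_ne_finset_zero (s := {0}) (by intro b hb; simp at hb; simp [hb])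
    refine Summable.of_nonneg_of_le (fun j => by positivity) (fun j => ?_) (h2.add h3)
    have h4 := japBracket_le_weight (θ := θ) hp hs ha j
    have h5 : |(j : ℝ)| ≤ japBracket j := le_max_left _ _
    have h6 := one_le_japBracket j
    rw [div_pow]
    split_ifs with hj
    · subst hj
      simp only [Int.cast_zero, ne_eq, OfNat.ofNat_ne_zero, not_false_eq_true, zero_pow, div_zero,
        mul_zero, zero_add]
      exact div_le_self (by positivity) (by nlinarith)
    · have hj' : 0 < |(j : ℝ)| := by simpa using hj
      rw [add_zero, mul_one_div, ← sq_abs (j : ℝ)]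
      gcongr
      exact h5.trans h4
  unfold rad
  simp_rw [← ENNReal.ofReal_pow (div_nonneg hr.le (weight_pos _).le)]
  exact h1.tsum_ofReal_ne_top

end weights

/-! ### Splitting monomials into actions and remaining modes -/

/-- Pairs of multi-indices with disjoint supports: they label the monomials `u^a ū^b` without a
factor `|u_j|²`. -/
def Disj := {d : MIdx × MIdx // d.1 ⊓ d.2 = 0}

/-- The bijection `(m, (a, b)) ↦ (m + a, m + b)`, with inverse `m = α ⊓ β`, `a = α - β`,
`b = β - α` (truncated differences). -/
def splitEquiv : MIdx × Disj ≃ MIdx × MIdx where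
  toFun y := (y.1 + y.2.1.1, y.1 + y.2.1.2)
  invFun x := (x.1 ⊓ x.2, ⟨(x.1 - x.2, x.2 - x.1), by ext j; simp; omega⟩)
  left_inv := by
    rintro ⟨m, ⟨⟨a, b⟩, hd⟩⟩
    have h : ∀ j, min (a j) (b j) = 0 := fun j => DFunLike.congr_fun hd j
    refine Prod.ext ?_ (Subtype.ext (Prod.ext ?_ ?_)) <;> ext j <;> have := h j <;> simp <;> omega
  right_inv := by
    rintro ⟨α, β⟩
    refine Prod.ext ?_ ?_ <;> ext j <;> simp <;> omega

theorem splitEquiv_apply (m : MIdx) (d : Disj) :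
    splitEquiv (m, d) = (m + d.1.1, m + d.1.2) := rfl

theorem splitEquiv_inf (m : MIdx) (d : Disj) :
    (splitEquiv (m, d)).1 ⊓ (splitEquiv (m, d)).2 = m :=
  congrArg Prod.fst (splitEquiv.symm_apply_apply (m, d))

theorem tsum_split (f : MIdx × MIdx → ℝ≥0∞) :
    ∑' x, f x = ∑' (d : Disj) (m : MIdx), f (splitEquiv (m, d)) := by
  rw [← splitEquiv.tsum_eq, ENNReal.tsum_prod', ENNReal.tsum_comm]

theorem tsum_split_complex {f : MIdx × MIdx → ℂ} (hf : Summable fun x => ‖f x‖) :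
    ∑' x, f x = ∑' (d : Disj) (m : MIdx), f (splitEquiv (m, d)) := by
  rw [← splitEquiv.tsum_eq, ← (Equiv.prodComm _ _).tsum_eq]
  refine Summable.tsum_prod (f := fun y : Disj × MIdx => f (splitEquiv (y.2, y.1))) ?_
  exact ((Equiv.prodComm _ _).trans splitEquiv).summable_iff.2 hf.of_norm

/-- The coefficients of `u^a ū^b |u|^{2m}`, as a sequence in `m`. -/
def cls (H : Ham) (d : Disj) (m : MIdx) : ℂ := H (splitEquiv (m, d))

/-- The homogeneous part of degree `q` in `w - I` of the auxiliary Hamiltonian `𝙷(u, w)`, at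
`w = |u|²`. -/
def taylorProj (I : ℤ → ℝ) (q : ℕ) (H : Ham) : Ham := fun x =>
  projSeq I q (cls H (splitEquiv.symm x).2) (splitEquiv.symm x).1

@[simp] theorem cls_taylorProj (I : ℤ → ℝ) (q : ℕ) (H : Ham) (d : Disj) :
    cls (taylorProj I q H) d = projSeq I q (cls H d) := by
  ext l; simp [cls, taylorProj]

theorem ham_ext {H K : Ham} (h : ∀ d, cls H d = cls K d) : H = K := by
  funext x
  have := congrFun (h (splitEquiv.symm x).2) (splitEquiv.symm x).1
  simpa [cls] using this

theorem MIdx.mom_add (α β : MIdx) : (α + β).mom = α.mom + β.mom :=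
  Finsupp.sum_add_index' (by simp) (by intros; push_cast; ring)

theorem mon_split {R : Type*} [CommSemiring R] (V : ℤ → R) (m : MIdx) (d : Disj) :
    mon V ((splitEquiv (m, d)).1 + (splitEquiv (m, d)).2) =
      mon (fun j => V j ^ 2) m * mon V (d.1.1 + d.1.2) := by
  rw [splitEquiv_apply, mon_sq]; simp only [mon_add]; ring

/-- The sum `∑ |H_{α,β}| V^{α+β}`. -/
def hamSum (V : ℤ → ℝ≥0∞) (H : Ham) : ℝ≥0∞ := ∑' x, ‖H x‖ₑ * mon V (x.1 + x.2)

theorem hamSum_mono {V W : ℤ → ℝ≥0∞} (h : ∀ j, V j ≤ W j) (H : Ham) :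
    hamSum V H ≤ hamSum W H :=
  ENNReal.tsum_le_tsum fun x => by gcongr; exact mon_mono h _

theorem cls_tsum_ne_top {V : ℤ → ℝ≥0∞} (h0 : ∀ j, V j ≠ 0) {H : Ham} (hH : hamSum V H ≠ ∞)
    (d : Disj) : ∑' m, ‖cls H d m‖ₑ * mon (fun j => V j ^ 2) m ≠ ∞ := by
  intro h
  apply hH
  rw [hamSum, tsum_split]
  refine top_unique (le_trans ?_ (ENNReal.le_tsum d))
  simp_rw [mon_split, ← mul_assoc, ENNReal.tsum_mul_right]
  have : ∑' m, ‖H (splitEquiv (m, d))‖ₑ * mon (fun j => V j ^ 2) m = ∞ := h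
  rw [this, ENNReal.top_mul (mon_ne_zero h0 _)]

/-! ### The majorant norm as a weighted `ℓ¹` norm -/

/-- The factor `e^{η |π(α - β)|}`. -/
def expo (η : ℝ) (x : MIdx × MIdx) : ℝ≥0∞ :=
  ENNReal.ofReal (Real.exp (η * |((x.1.mom - x.2.mom : ℤ) : ℝ)|))

theorem enorm_majorant (η : ℝ) (H : Ham) (x : MIdx × MIdx) :
    ‖majorant η H x‖ₑ = ‖H x‖ₑ * expo η x := by
  rw [majorant, enorm_ofReal', Real.enorm_of_nonneg (by positivity),
    ENNReal.ofReal_mul (norm_nonneg _), ofReal_norm]; rfl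

theorem expo_split (η : ℝ) (m : MIdx) (d : Disj) : expo η (splitEquiv (m, d)) = expo η d.1 := by
  simp [expo, splitEquiv_apply, MIdx.mom_add]

theorem one_le_expo {η : ℝ} (hη : 0 ≤ η) (x : MIdx × MIdx) : 1 ≤ expo η x := by
  rw [expo, ← ENNReal.ofReal_one]
  exact ENNReal.ofReal_le_ofReal (Real.one_le_exp (by positivity))

/-- The value at `V` of `V_j ∂_{ū_j}` of the majorant of `H`. -/
def fieldSum (V : ℤ → ℝ≥0∞) (H : Ham) (j : ℤ) : ℝ≥0∞ :=
  ∑' x : MIdx × MIdx, ‖H x‖ₑ * (x.2 j * mon V (x.1 + x.2))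

/-- The least `N` with `V_j ∂_{ū_j} H(V) ≤ N V_j²` for the majorant of `H`. -/
def fieldNorm (V : ℤ → ℝ≥0∞) (H : Ham) : ℝ≥0∞ := ⨆ j, fieldSum V H j / V j ^ 2

theorem tsum_add_single_snd {M : Type*} [AddCommMonoid M] [TopologicalSpace M]
    (j : ℤ) {f : MIdx × MIdx → M}
    (hf : ∀ x : MIdx × MIdx, x.2 j = 0 → f x = 0) :
    ∑' x : MIdx × MIdx, f (x.1, x.2 + Finsupp.single j 1) = ∑' x, f x := by
  refine Function.Injective.tsum_eq (g := fun x : MIdx × MIdx => (x.1, x.2 + Finsupp.single j 1))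
    ?_ ?_
  · rintro ⟨a, b⟩ ⟨a', b'⟩ h
    simpa using h
  · intro x hx
    refine ⟨(x.1, x.2 - Finsupp.single j 1), Prod.ext rfl ?_⟩
    refine tsub_add_cancel_of_le ?_
    rw [Finsupp.single_le_iff]
    exact Nat.one_le_iff_ne_zero.2 fun h => hx (hf x h)

theorem tsum_add_single_fst {M : Type*} [AddCommMonoid M] [TopologicalSpace M]
    (j : ℤ) {f : MIdx × MIdx → M}
    (hf : ∀ x : MIdx × MIdx, x.1 j = 0 → f x = 0) :
    ∑' x : MIdx × MIdx, f (x.1 + Finsupp.single j 1, x.2) = ∑' x, f x := by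
  rw [← (Equiv.prodComm _ _).tsum_eq, ← (Equiv.prodComm _ _).tsum_eq (f := f)]
  exact tsum_add_single_snd j (f := fun x => f x.swap) (fun x hx => hf _ hx)

theorem enorm_term (H : Ham) (u : ℤ → ℂ) (x : MIdx × MIdx) :
    ‖term H u x‖ₑ = ‖H x‖ₑ * mon (fun j => ‖u j‖ₑ) (x.1 + x.2) := by
  rw [term, mpow_eq_mon, mpow_eq_mon, enorm_mul, enorm_mul, enorm_mon, enorm_mon, mon_add,
    mul_assoc]
  congr 4
  ext j
  rw [← ofReal_norm, ← ofReal_norm, RCLike.norm_conj]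

theorem hamSum_seriesDbar (V : ℤ → ℝ≥0∞) (H : Ham) (j : ℤ) :
    hamSum V (seriesDbar j H) * V j = fieldSum V H j := by
  unfold hamSum fieldSum
  rw [← ENNReal.tsum_mul_right, ← tsum_add_single_snd j
    (f := fun x => ‖H x‖ₑ * (x.2 j * mon V (x.1 + x.2))) (by intro x hx; simp [hx])]
  refine tsum_congr fun x => ?_
  have : ‖(x.2 j : ℂ) + 1‖ₑ = (x.2 j : ℝ≥0∞) + 1 := by
    have : (x.2 j : ℂ) + 1 = ((x.2 j + 1 : ℕ) : ℂ) := by push_cast; rfl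
    rw [this, ← ofReal_norm, Complex.norm_natCast, ENNReal.ofReal_natCast]; push_cast; rfl
  simp only [seriesDbar, enorm_mul, this, mon_add, mon_single, pow_one, Finsupp.add_apply,
    Finsupp.single_eq_same]
  push_cast
  ring

section norm
variable {θ p s a : ℝ}

theorem hamSum_term_le {V : ℤ → ℝ≥0∞} {u : ℤ → ℂ} (hu : ∀ j, ‖u j‖ₑ ≤ V j) (H : Ham) :
    ∑' x, ‖term H u x‖ₑ ≤ hamSum V H := by
  simp_rw [enorm_term]
  exact hamSum_mono hu H

theorem summable_term {V : ℤ → ℝ≥0∞} {u : ℤ → ℂ} (hu : ∀ j, ‖u j‖ₑ ≤ V j) {H : Ham}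
    (hH : hamSum V H ≠ ∞) : Summable fun x => ‖term H u x‖ :=
  summable_norm_of_tsum_enorm (ne_top_of_le_ne_top hH (hamSum_term_le hu H))

/-- The boundary point of the ball with non-negative coordinates of maximal size. -/
def radPt (θ p s a r : ℝ) (j : ℤ) : ℂ := ((r / weight θ p s a j : ℝ) : ℂ)

theorem enorm_radPt {r : ℝ} (hr : 0 < r) (j : ℤ) :
    ‖radPt θ p s a r j‖ₑ = rad θ p s a r j := by
  rw [radPt, enorm_ofReal', Real.enorm_of_nonneg (div_pos hr (weight_pos j)).le]; rfl

theorem hamSum_ne_top_of_summable {r : ℝ} (hr : 0 < r) {H : Ham}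
    (h : Summable fun x => ‖term H (radPt θ p s a r) x‖) : hamSum (rad θ p s a r) H ≠ ∞ := by
  have := tsum_enorm_ne_top h
  simp_rw [enorm_term, enorm_radPt hr] at this
  exact this

theorem enorm_eval_le {V : ℤ → ℝ≥0∞} {u : ℤ → ℂ} (hu : ∀ j, ‖u j‖ₑ ≤ V j) (H : Ham) :
    ‖eval H u‖ₑ ≤ hamSum V H :=
  enorm_tsum_le_tsum_enorm.trans (hamSum_term_le hu H)

theorem enorm_tsum_of_nonneg {ι : Type*} {f : ι → ℝ} (h0 : ∀ i, 0 ≤ f i)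
    (hs : Summable f) : ‖∑' i, (f i : ℂ)‖ₑ = ∑' i, ‖(f i : ℂ)‖ₑ := by
  rw [← Complex.ofReal_tsum]
  simp_rw [enorm_ofReal']
  rw [Real.enorm_of_nonneg (tsum_nonneg h0), ENNReal.ofReal_tsum_of_nonneg h0 hs]
  exact tsum_congr fun i => (Real.enorm_of_nonneg (h0 i)).symm

/-- A power series with non-negative coefficients is largest at the point of the ball with maximal
non-negative coordinates. -/
theorem enorm_eval_radPt {r : ℝ} (hr : 0 < r) {H : Ham} (hpos : ∀ x, ∃ c : ℝ, 0 ≤ c ∧ H x = c)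
    (hH : hamSum (rad θ p s a r) H ≠ ∞) :
    ‖eval H (radPt θ p s a r)‖ₑ = hamSum (rad θ p s a r) H := by
  choose c hc0 hc using hpos
  have hw : ∀ j, 0 ≤ r / weight θ p s a j := fun j => (div_pos hr (weight_pos j)).le
  have ht : ∀ x, term H (radPt θ p s a r) x =
      ((c x * mon (fun j => r / weight θ p s a j) (x.1 + x.2) : ℝ) : ℂ) := by
    intro x
    have h1 : ∀ α, mon (radPt θ p s a r) α = (mon (fun j => r / weight θ p s a j) α : ℝ) :=
      fun α => (map_mon Complex.ofRealHom (fun j => r / weight θ p s a j) α).symm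
    have h2 : (fun j => conj (radPt θ p s a r j)) = radPt θ p s a r :=
      funext fun j => Complex.conj_ofReal _
    rw [term, mpow_eq_mon, mpow_eq_mon, h2, h1, h1, hc, mon_add]; push_cast; ring
  have hn : ∀ x : MIdx × MIdx, 0 ≤ c x * mon (fun j => r / weight θ p s a j) (x.1 + x.2) :=
    fun x => mul_nonneg (hc0 x) (Finset.prod_nonneg fun j _ => pow_nonneg (hw j) _)
  have hs := summable_term (fun j => (enorm_radPt hr j).le) hH
  unfold eval
  simp_rw [ht] at hs ⊢
  rw [enorm_tsum_of_nonneg hn]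
  · simp_rw [← ht, enorm_term, enorm_radPt hr]; rfl
  · exact hs.congr fun x => by rw [Complex.norm_real, Real.norm_of_nonneg (hn x)]

theorem seriesDbar_majorant_nonneg (η : ℝ) (H : Ham) (j : ℤ) (x : MIdx × MIdx) :
    ∃ c : ℝ, 0 ≤ c ∧ seriesDbar j (majorant η H) x = c :=
  ⟨((x.2 j : ℝ) + 1) * (‖H (x.1, x.2 + Finsupp.single j 1)‖ *
    Real.exp (η * |((x.1.mom - (x.2 + Finsupp.single j 1).mom : ℤ) : ℝ)|)), by positivity, by
      simp [seriesDbar, majorant]⟩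

theorem hamSum_seriesDbar_eq_div {V : ℤ → ℝ≥0∞} (h0 : ∀ j, V j ≠ 0) (hT : ∀ j, V j ≠ ∞) (H : Ham)
    (j : ℤ) : hamSum V (seriesDbar j H) = fieldSum V H j / V j := by
  rw [← hamSum_seriesDbar, ENNReal.mul_div_cancel_right (h0 j) (hT j)]

/-- The majorant norm in terms of coefficients: the supremum over the ball is attained at the point
with maximal non-negative coordinates. -/
theorem hamNorm_eq {η r : ℝ} (hr : 0 < r) {H : Ham}
    (hs : ∀ u, seqNorm θ p s a u ≤ ENNReal.ofReal r →
      ∀ j, Summable fun x => ‖term (seriesDbar j (majorant η H)) u x‖) :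
    hamNorm θ p s a η r H = fieldNorm (rad θ p s a r) (majorant η H) := by
  set V := rad θ p s a r with hV
  have h0 : ∀ j, V j ≠ 0 := rad_ne_zero hr
  have hT : ∀ j, V j ≠ ∞ := rad_ne_top r
  have hmem : seqNorm θ p s a (radPt θ p s a r) ≤ ENNReal.ofReal r :=
    (seqNorm_le_iff hr.le _).2 fun j => (enorm_radPt hr j).le
  have hfin : ∀ j, hamSum V (seriesDbar j (majorant η H)) ≠ ∞ := fun j =>
    hamSum_ne_top_of_summable hr (hs _ hmem j)
  have key : ⨆ (u : ℤ → ℂ) (_ : seqNorm θ p s a u ≤ ENNReal.ofReal r),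
      seqNorm θ p s a (hamField (majorant η H) u) =
      ⨆ j, hamSum V (seriesDbar j (majorant η H)) * ENNReal.ofReal (weight θ p s a j) := by
    have hval : ∀ u, seqNorm θ p s a (hamField (majorant η H) u) =
        ⨆ j, ‖eval (seriesDbar j (majorant η H)) u‖ₑ * ENNReal.ofReal (weight θ p s a j) := by
      intro u
      unfold seqNorm hamField
      refine iSup_congr fun j => ?_
      rw [ENNReal.ofReal_mul (norm_nonneg _), norm_mul, Complex.norm_I, one_mul, ofReal_norm]
    refine le_antisymm (iSup₂_le fun u hu => ?_) ?_
    · rw [hval]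
      refine iSup_mono fun j => ?_
      gcongr
      exact enorm_eval_le ((seqNorm_le_iff hr.le u).1 hu) _
    · refine le_trans ?_ (le_iSup₂ (radPt θ p s a r) hmem)
      rw [hval]
      refine iSup_mono fun j => ?_
      rw [enorm_eval_radPt hr (seriesDbar_majorant_nonneg η H j) (hfin j)]
  rw [hamNorm, key, div_eq_mul_inv, ENNReal.iSup_mul]
  unfold fieldNorm
  refine iSup_congr fun j => ?_
  rw [hamSum_seriesDbar_eq_div h0 hT, pow_two, div_eq_mul_inv, div_eq_mul_inv, mul_assoc, mul_assoc,
    ENNReal.mul_inv (Or.inl (h0 j)) (Or.inl (hT j))]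
  congr 2
  have hw := weight_pos (θ := θ) (p := p) (s := s) (a := a) j
  rw [hV, rad, ENNReal.ofReal_div_of_pos hw, ENNReal.inv_div
    (Or.inl ENNReal.ofReal_ne_top) (Or.inl (by simpa using hw))]
  rfl

/-- By mass conservation a non-constant monomial contains some `ū_j`, so the vector field controls
the Hamiltonian up to its constant term. -/
theorem hamSum_le {V : ℤ → ℝ≥0∞} (h0 : ∀ j, V j ≠ 0) (hT : ∀ j, V j ≠ ∞) {H : Ham}
    (hm : ∀ α β : MIdx, α.len ≠ β.len → H (α, β) = 0) :
    hamSum V H ≤ ‖H 0‖ₑ + (∑' j, V j ^ 2) * fieldNorm V H := by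
  have h1 : ∀ j, fieldSum V H j ≤ V j ^ 2 * fieldNorm V H := by
    intro j
    rw [mul_comm, ← ENNReal.div_le_iff (pow_ne_zero _ (h0 j)) (ENNReal.pow_ne_top (hT j))]
    exact le_iSup (fun j => fieldSum V H j / V j ^ 2) j
  rw [← ENNReal.tsum_mul_right]
  refine le_trans ?_ (add_le_add_right (ENNReal.tsum_le_tsum h1) _)
  unfold hamSum fieldSum
  rw [ENNReal.tsum_comm]
  rw [← tsum_ite_eq (0 : MIdx × MIdx) (fun _ => ‖H 0‖ₑ), ← ENNReal.tsum_add]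
  refine ENNReal.tsum_le_tsum fun x => ?_
  rw [ENNReal.tsum_mul_left, ENNReal.tsum_mul_right]
  by_cases hx : x = 0
  · subst hx; simp
  · rw [if_neg hx, zero_add]
    by_cases hl : x.1.len = x.2.len
    · have : x.2 ≠ 0 := by
        intro h
        rw [h, len_eq_degree, len_eq_degree, map_zero, Finsupp.degree_eq_zero_iff] at hl
        exact hx (Prod.ext hl h)
      obtain ⟨j, hj⟩ := Finsupp.ne_iff.1 this
      have h1 : (1 : ℝ≥0∞) ≤ ∑' i, (x.2 i : ℝ≥0∞) := by
        refine le_trans ?_ (ENNReal.le_tsum j)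
        exact_mod_cast Nat.one_le_iff_ne_zero.2 hj
      calc _ = ‖H x‖ₑ * (1 * mon V (x.1 + x.2)) := by rw [one_mul]
        _ ≤ _ := by gcongr
    · rw [show H x = 0 from hm x.1 x.2 hl]; simp

theorem norm_le_majorant {η : ℝ} (hη : 0 ≤ η) (H : Ham) (x : MIdx × MIdx) :
    ‖H x‖ₑ ≤ ‖majorant η H x‖ₑ := by
  rw [enorm_majorant]
  exact le_mul_of_one_le_right zero_le (one_le_expo hη x)

/-- Regularity in terms of coefficients. -/
theorem isRegular_iff (hp : 1 < p) (hs : 0 < s) (ha : 0 ≤ a) {η : ℝ} (hη : 0 ≤ η) {r : ℝ}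
    (hr : 0 < r) {H : Ham} :
    IsRegular θ p s a η r H ↔ (∀ α β, H (α, β) = conj (H (β, α))) ∧
      (∀ α β : MIdx, α.len ≠ β.len → H (α, β) = 0) ∧
      fieldNorm (rad θ p s a r) (majorant η H) ≠ ∞ := by
  constructor
  · rintro ⟨h1, -, h3, h4⟩
    refine ⟨h1.2.1, h1.2.2, ?_⟩
    rw [← hamNorm_eq hr h3]; exact h4.ne
  · rintro ⟨h1, h2, h3⟩
    have h2' : ∀ α β : MIdx, α.len ≠ β.len → majorant η H (α, β) = 0 := by
      intro α β h; simp [majorant, h2 α β h]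
    have hM : hamSum (rad θ p s a r) (majorant η H) ≠ ∞ := by
      refine ne_top_of_le_ne_top ?_ (hamSum_le (rad_ne_zero hr) (rad_ne_top r) h2')
      exact ENNReal.add_ne_top.2
        ⟨enorm_ne_top, ENNReal.mul_ne_top (tsum_rad_sq_ne_top hp hs ha hr) h3⟩
    have hH : hamSum (rad θ p s a r) H ≠ ∞ :=
      ne_top_of_le_ne_top hM (ENNReal.tsum_le_tsum fun x => by
        gcongr; exact norm_le_majorant hη H x)
    have hD : ∀ u, seqNorm θ p s a u ≤ ENNReal.ofReal r →
        ∀ j, Summable fun x => ‖term (seriesDbar j (majorant η H)) u x‖ := by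
      intro u hu j
      refine summable_term ((seqNorm_le_iff hr.le u).1 hu) ?_
      rw [hamSum_seriesDbar_eq_div (rad_ne_zero hr) (rad_ne_top r)]
      refine ENNReal.div_ne_top (fun h => h3 (top_unique ?_)) (rad_ne_zero hr j)
      refine le_trans ?_ (le_iSup _ j)
      rw [h, ENNReal.top_div_of_ne_top (ENNReal.pow_ne_top (rad_ne_top r j))]
    refine ⟨⟨fun u hu => summable_term ((seqNorm_le_iff hr.le u).1 hu) hH, h1, h2⟩,
      ⟨fun u hu => summable_term ((seqNorm_le_iff hr.le u).1 hu) hM, ?_, h2'⟩, hD, ?_⟩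
    · intro α β
      simp only [majorant, Complex.conj_ofReal]
      rw [h1 α β, RCLike.norm_conj, ← abs_neg]
      push_cast; rw [neg_sub]
    · rw [hamNorm_eq hr hD]; exact h3.lt_top

theorem IsRegular.hamNorm_eq {η r : ℝ} (hr : 0 < r) {H : Ham} (h : IsRegular θ p s a η r H) :
    hamNorm θ p s a η r H = fieldNorm (rad θ p s a r) (majorant η H) :=
  TorusProj.hamNorm_eq hr h.2.2.1

theorem IsRegular.hamSum_ne_top {η r : ℝ} (hr : 0 < r) {H : Ham} (h : IsRegular θ p s a η r H) :
    hamSum (rad θ p s a r) H ≠ ∞ :=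
  hamSum_ne_top_of_summable hr (h.1.1 _ ((seqNorm_le_iff hr.le _).2 fun j => (enorm_radPt hr j).le))

end norm

/-! ### The projections on Hamiltonians -/

section proj
variable {I : ℤ → ℝ} {V : ℤ → ℝ≥0∞} {κ : ℝ}

theorem tsum_taylorProj_le (hκ : 0 < κ) (hκ1 : κ < 1)
    (hI : ∀ j, ‖I j‖ₑ ≤ ENNReal.ofReal (κ ^ 2) * V j ^ 2) {c : ℝ} (hc : 0 ≤ c) (hc1 : c ≤ 1)
    (q : ℕ) (H : Ham) (d : Disj) {f : MIdx → ℝ≥0∞} (hf : Monotone f) :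
    ∑' l, ‖projSeq I q (cls H d) l‖ₑ * (f l *
        mon (fun j => ENNReal.ofReal c * V j) ((splitEquiv (l, d)).1 + (splitEquiv (l, d)).2)) ≤
      ENNReal.ofReal ((1 + c ^ 2 / κ ^ 2) ^ q * cKappa κ ^ q) *
        ∑' m, ‖cls H d m‖ₑ * (f m *
          mon V ((splitEquiv (m, d)).1 + (splitEquiv (m, d)).2)) := by
  have key := tsum_enorm_projSeq_le hκ hκ1 hI (V := fun j => (ENNReal.ofReal c * V j) ^ 2)
    (y := c ^ 2) (by positivity)
    (fun j => by rw [mul_pow, ENNReal.ofReal_pow hc]) q (cls H d) hf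
  simp_rw [mon_split, ← mul_assoc, ENNReal.tsum_mul_right]
  simp_rw [← mul_assoc] at key
  rw [← mul_assoc (ENNReal.ofReal _)]
  refine mul_le_mul' key (mon_mono (fun j => ?_) _)
  calc _ ≤ 1 * V j := by gcongr; simpa using hc1
    _ = _ := one_mul _

theorem hamSum_taylorProj_le (hκ : 0 < κ) (hκ1 : κ < 1)
    (hI : ∀ j, ‖I j‖ₑ ≤ ENNReal.ofReal (κ ^ 2) * V j ^ 2) (q : ℕ) (H : Ham) :
    hamSum V (taylorProj I q H) ≤
      ENNReal.ofReal ((1 + 1 / κ ^ 2) ^ q * cKappa κ ^ q) * hamSum V H := by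
  unfold hamSum
  rw [tsum_split, tsum_split, ← ENNReal.tsum_mul_left]
  refine ENNReal.tsum_le_tsum fun d => ?_
  have := tsum_taylorProj_le hκ hκ1 hI zero_le_one le_rfl q H d (f := fun _ => 1)
    monotone_const
  simp only [one_mul, ENNReal.ofReal_one, one_pow] at this
  simpa [taylorProj, cls] using this

theorem splitEquiv_snd (m : MIdx) (d : Disj) (j : ℤ) :
    (splitEquiv (m, d)).2 j = m j + d.1.2 j := rfl

/-- The projections do not change momenta and do not raise the exponents, so the estimate of the
`ℓ¹` norms carries over to the vector fields. -/
theorem fieldNorm_taylorProj_le (h0 : ∀ j, V j ≠ 0) (hT : ∀ j, V j ≠ ∞)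
    (hκ : 0 < κ) (hκ1 : κ < 1)
    (hI : ∀ j, ‖I j‖ₑ ≤ ENNReal.ofReal (κ ^ 2) * V j ^ 2) {c : ℝ} (hc : 0 < c) (hc1 : c ≤ 1)
    (η : ℝ) (q : ℕ) (H : Ham) :
    fieldNorm (fun j => ENNReal.ofReal c * V j) (majorant η (taylorProj I q H)) ≤
      ENNReal.ofReal ((c ^ 2)⁻¹ * (1 + c ^ 2 / κ ^ 2) ^ q * cKappa κ ^ q) *
        fieldNorm V (majorant η H) := by
  have hmain : ∀ j, fieldSum (fun j => ENNReal.ofReal c * V j)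
      (majorant η (taylorProj I q H)) j ≤
      ENNReal.ofReal ((1 + c ^ 2 / κ ^ 2) ^ q * cKappa κ ^ q) * fieldSum V (majorant η H) j := by
    intro j
    unfold fieldSum
    rw [tsum_split, tsum_split, ← ENNReal.tsum_mul_left]
    refine ENNReal.tsum_le_tsum fun d => ?_
    have := tsum_taylorProj_le hκ hκ1 hI hc.le hc1 q H d
      (f := fun l => ((l j + d.1.2 j : ℕ) : ℝ≥0∞)) (fun l m hlm => by
        have := hlm j
        dsimp only
        gcongr)
    simp only [enorm_majorant, expo_split, splitEquiv_snd, mul_right_comm _ (expo η d.1),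
      ENNReal.tsum_mul_right, ← mul_assoc]
    simp only [← mul_assoc] at this
    gcongr
    simpa [taylorProj, cls] using this
  unfold fieldNorm
  refine iSup_le fun j => ?_
  refine le_trans ?_ (mul_le_mul_right (le_iSup _ j) _)
  have hcV : ENNReal.ofReal c ≠ 0 := by simpa using hc
  rw [mul_pow, ENNReal.div_le_iff (mul_ne_zero (pow_ne_zero _ hcV) (pow_ne_zero _ (h0 j)))
    (ENNReal.mul_ne_top (ENNReal.pow_ne_top ENNReal.ofReal_ne_top) (ENNReal.pow_ne_top (hT j)))]
  refine (hmain j).trans_eq ?_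
  have hnn : 0 ≤ (c ^ 2)⁻¹ := by positivity
  rw [mul_assoc ((c ^ 2)⁻¹), ENNReal.ofReal_mul hnn, ← ENNReal.ofReal_pow hc.le]
  calc _ = (ENNReal.ofReal (c ^ 2)⁻¹ * ENNReal.ofReal (c ^ 2)) *
        (ENNReal.ofReal ((1 + c ^ 2 / κ ^ 2) ^ q * cKappa κ ^ q)) *
        ((fieldSum V (majorant η H) j) / V j ^ 2 * V j ^ 2) := by
        rw [← ENNReal.ofReal_mul hnn, inv_mul_cancel₀ (by positivity), ENNReal.ofReal_one, one_mul,
          ENNReal.div_mul_cancel (pow_ne_zero _ (h0 j)) (ENNReal.pow_ne_top (hT j))]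
    _ = _ := by ring

theorem taySeq_taylorProj (h0 : ∀ j, V j ≠ 0) (hT : ∀ j, V j ≠ ∞) (hκ : 0 < κ) (hκ1 : κ < 1)
    (hI : ∀ j, ‖I j‖ₑ ≤ ENNReal.ofReal (κ ^ 2) * V j ^ 2) {H : Ham} (hH : hamSum V H ≠ ∞)
    (q : ℕ) (d : Disj) (k : MIdx) :
    taySeq I (cls (taylorProj I q H) d) k =
      if Finsupp.degree k = q then taySeq I (cls H d) k else 0 := by
  rw [cls_taylorProj]
  exact taySeq_projSeq hκ hκ1 hI (fun j => pow_ne_zero _ (h0 j))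
    (fun j => ENNReal.pow_ne_top (hT j)) (cls_tsum_ne_top h0 hH d) q k

theorem cls_taylorProj_eq_tsum (h0 : ∀ j, V j ≠ 0) (hT : ∀ j, V j ≠ ∞) (hκ : 0 < κ) (hκ1 : κ < 1)
    (hI : ∀ j, ‖I j‖ₑ ≤ ENNReal.ofReal (κ ^ 2) * V j ^ 2) {H : Ham} (hH : hamSum V H ≠ ∞)
    (q : ℕ) (d : Disj) (l : MIdx) :
    cls (taylorProj I q H) d l = ∑' k, taySeq I (cls H d) k *
      ((if Finsupp.degree k = q then tayCoeff (-I) k l else 0 : ℝ) : ℂ) := by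
  rw [cls_taylorProj]
  exact projSeq_eq_tsum_taySeq hκ hκ1 hI (fun j => pow_ne_zero _ (h0 j))
    (fun j => ENNReal.pow_ne_top (hT j)) (cls_tsum_ne_top h0 hH d) q l

/-- The homogeneous part of degree `q` vanishes exactly when all Taylor coefficients of order `q`
do. -/
theorem taylorProj_eq_zero_iff (h0 : ∀ j, V j ≠ 0) (hT : ∀ j, V j ≠ ∞) (hκ : 0 < κ) (hκ1 : κ < 1)
    (hI : ∀ j, ‖I j‖ₑ ≤ ENNReal.ofReal (κ ^ 2) * V j ^ 2) {H : Ham} (hH : hamSum V H ≠ ∞)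
    (q : ℕ) : taylorProj I q H = 0 ↔
      ∀ d k, Finsupp.degree k = q → taySeq I (cls H d) k = 0 := by
  constructor
  · intro h d k hk
    have := taySeq_taylorProj h0 hT hκ hκ1 hI hH q d k
    rw [if_pos hk] at this
    rw [← this, h]
    simp [taySeq, cls]
  · intro h
    refine ham_ext fun d => funext fun l => ?_
    rw [cls_taylorProj_eq_tsum h0 hT hκ hκ1 hI hH]
    have : ∀ k, taySeq I (cls H d) k *
      ((if Finsupp.degree k = q then tayCoeff (-I) k l else 0 : ℝ) : ℂ) = 0 := by
      intro k
      split_ifs with hk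
      · rw [h d k hk, zero_mul]
      · simp
    simp [this, cls]

/-- The projections are mutually orthogonal idempotents, by comparison of Taylor coefficients. -/
theorem taylorProj_taylorProj (h0 : ∀ j, V j ≠ 0) (hT : ∀ j, V j ≠ ∞) (hκ : 0 < κ) (hκ1 : κ < 1)
    (hI : ∀ j, ‖I j‖ₑ ≤ ENNReal.ofReal (κ ^ 2) * V j ^ 2) {H : Ham} (hH : hamSum V H ≠ ∞)
    (q q' : ℕ) : taylorProj I q' (taylorProj I q H) = if q' = q then taylorProj I q H else 0 := by
  have hP : hamSum V (taylorProj I q H) ≠ ∞ := ne_top_of_le_ne_top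
    (ENNReal.mul_ne_top ENNReal.ofReal_ne_top hH) (hamSum_taylorProj_le hκ hκ1 hI q H)
  refine ham_ext fun d => funext fun l => ?_
  rw [cls_taylorProj_eq_tsum h0 hT hκ hκ1 hI hP]
  simp_rw [taySeq_taylorProj h0 hT hκ hκ1 hI hH]
  split_ifs with h
  · subst h
    rw [cls_taylorProj_eq_tsum h0 hT hκ hκ1 hI hH]
    refine tsum_congr fun k => ?_
    split_ifs <;> simp
  · rw [show cls 0 d l = 0 from rfl]
    refine (tsum_congr fun k => ?_).trans tsum_zero
    split_ifs with h1 h2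
    · exact absurd (h2.symm.trans h1) h
    all_goals simp

theorem taylorProj_linear (h0 : ∀ j, V j ≠ 0) (hT : ∀ j, V j ≠ ∞) (hκ : 0 < κ) (hκ1 : κ < 1)
    (hI : ∀ j, ‖I j‖ₑ ≤ ENNReal.ofReal (κ ^ 2) * V j ^ 2) {F G : Ham} (hF : hamSum V F ≠ ∞)
    (hG : hamSum V G ≠ ∞) (q : ℕ) (b c : ℝ) :
    taylorProj I q (b • F + c • G) = b • taylorProj I q F + c • taylorProj I q G := by
  refine ham_ext fun d => funext fun l => ?_
  have hs : ∀ {H : Ham}, hamSum V H ≠ ∞ → Summable fun m =>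
      cls H d m * (MvPolynomial.coeff l (projPoly I q m) : ℝ) := fun hH =>
    (summable_projSeq hκ hκ1 hI (fun j => pow_ne_zero _ (h0 j))
      (fun j => ENNReal.pow_ne_top (hT j)) (cls_tsum_ne_top h0 hH d) q l).of_norm
  have e1 : cls (b • taylorProj I q F + c • taylorProj I q G) d l =
      b * cls (taylorProj I q F) d l + c * cls (taylorProj I q G) d l := by
    simp [cls]
  rw [e1, cls_taylorProj, cls_taylorProj, cls_taylorProj]
  unfold projSeq
  rw [← tsum_mul_left, ← tsum_mul_left,
    ← ((hs hF).mul_left _).tsum_add ((hs hG).mul_left _)]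
  refine tsum_congr fun m => ?_
  simp [cls]; ring

end proj

/-! ### The Taylor expansion of the auxiliary Hamiltonian -/

section expansion
variable {I : ℤ → ℝ} {V : ℤ → ℝ≥0∞} {κ : ℝ}

/-- The squared moduli `|u_j|²`. -/
def actions (u : ℤ → ℂ) (j : ℤ) : ℂ := ((‖u j‖ ^ 2 : ℝ) : ℂ)

theorem mon_mul_mon_conj (u : ℤ → ℂ) (m : MIdx) :
    mon u m * mon (fun j => conj (u j)) m = mon (actions u) m := by
  rw [← mon_mul]
  congr 1
  ext j
  rw [Complex.mul_conj, Complex.normSq_eq_norm_sq]; rfl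

theorem term_split (H : Ham) (u : ℤ → ℂ) (m : MIdx) (d : Disj) :
    term H u (splitEquiv (m, d)) =
      cls H d m * mon (actions u) m * (mon u d.1.1 * mon (fun j => conj (u j)) d.1.2) := by
  rw [term, mpow_eq_mon, mpow_eq_mon, ← mon_mul_mon_conj, splitEquiv_apply]
  simp only [mon_add]
  change cls H d m * _ * _ = _
  ring

/-- The `q`-th coefficient in `t` of the contribution of `x` to `𝙷(u, I + t(|u|² - I))`. -/
def lineCoeff (I : ℤ → ℝ) (H : Ham) (u : ℤ → ℂ) (q : ℕ) (x : MIdx × MIdx) : ℂ :=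
  H x * MvPolynomial.aeval (actions u) (projPoly I q (splitEquiv.symm x).1) *
    (mon u (splitEquiv.symm x).2.1.1 *
      mon (fun j => conj (u j)) (splitEquiv.symm x).2.1.2)

theorem enorm_aeval_le (p : MvPolynomial ℤ ℝ) (W : ℤ → ℂ) :
    ‖MvPolynomial.aeval W p‖ₑ ≤ polyNorm (fun j => ‖W j‖ₑ) p := by
  rw [MvPolynomial.aeval_def, MvPolynomial.eval₂_eq]
  refine (enorm_sum_le _ _).trans ?_
  refine le_trans (Finset.sum_le_sum fun l _ => ?_) (ENNReal.sum_le_tsum p.support)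
  rw [enorm_mul, ← enorm_mon]
  exact mul_le_mul_left (enorm_ofReal' _).le _

theorem enorm_actions_le {u : ℤ → ℂ} (hu : ∀ j, ‖u j‖ₑ ≤ V j) (j : ℤ) :
    ‖actions u j‖ₑ ≤ V j ^ 2 := by
  rw [actions, enorm_ofReal', enorm_pow, enorm_norm]
  exact pow_le_pow_left' (hu j) 2

theorem enorm_mon_mon_conj_le {u : ℤ → ℂ} (hu : ∀ j, ‖u j‖ₑ ≤ V j) (α β : MIdx) :
    ‖mon u α * mon (fun j => conj (u j)) β‖ₑ ≤ mon V (α + β) := by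
  have h : ∀ j, ‖conj (u j)‖ₑ ≤ V j := fun j => by
    rw [← ofReal_norm, RCLike.norm_conj, ofReal_norm]; exact hu j
  rw [enorm_mul, enorm_mon, enorm_mon, mon_add]
  exact mul_le_mul' (mon_mono hu _) (mon_mono h _)

theorem enorm_lineCoeff_le (hI : ∀ j, ‖I j‖ₑ ≤ ENNReal.ofReal (κ ^ 2) * V j ^ 2)
    {u : ℤ → ℂ} (hu : ∀ j, ‖u j‖ₑ ≤ V j) (H : Ham) (q : ℕ) (x : MIdx × MIdx) :
    ‖lineCoeff I H u q x‖ₑ ≤ binCoeff (ENNReal.ofReal (κ ^ 2)) (ENNReal.ofReal (κ ^ 2 + 1))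
      (Finsupp.degree (splitEquiv.symm x).1) q * (‖H x‖ₑ * mon V (x.1 + x.2)) := by
  obtain ⟨⟨m, d⟩, rfl⟩ := splitEquiv.surjective x
  rw [mon_split, lineCoeff, Equiv.symm_apply_apply, enorm_mul, enorm_mul]
  have h1 : ‖MvPolynomial.aeval (actions u) (projPoly I q m)‖ₑ ≤
      binCoeff (ENNReal.ofReal (κ ^ 2)) (ENNReal.ofReal (κ ^ 2 + 1)) (Finsupp.degree m) q *
        mon (fun j => V j ^ 2) m := by
    refine (enorm_aeval_le _ _).trans (polyNorm_projPoly_le hI (fun j => ?_) q m)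
    rw [ENNReal.ofReal_add (by positivity) zero_le_one, add_mul, add_comm, ENNReal.ofReal_one,
      one_mul]
    exact add_le_add (hI j) (enorm_actions_le hu j)
  calc _ ≤ ‖H (splitEquiv (m, d))‖ₑ * (binCoeff (ENNReal.ofReal (κ ^ 2))
          (ENNReal.ofReal (κ ^ 2 + 1)) (Finsupp.degree m) q * mon (fun j => V j ^ 2) m) *
          mon V (d.1.1 + d.1.2) := by
        gcongr; exact enorm_mon_mon_conj_le hu _ _
    _ = _ := by ring

theorem tsum_binCoeff_mul_pow (x ζ t : ℝ≥0∞) (M : ℕ) :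
    ∑' q, binCoeff x ζ M q * t ^ q = (x + ζ * t) ^ M := by
  rw [tsum_eq_sum (s := Finset.range (M + 1)), add_comm x, add_pow]
  · refine Finset.sum_congr rfl fun q _ => ?_
    rw [binCoeff, mul_pow]; ring
  · intro q hq
    rw [binCoeff, Nat.choose_eq_zero_of_lt (by simpa using hq)]; simp

/-- Near `t = 0` the expansion in `t` and in the monomials converges absolutely as a double
series. -/
theorem tsum_lineCoeff_ne_top
    (hI : ∀ j, ‖I j‖ₑ ≤ ENNReal.ofReal (κ ^ 2) * V j ^ 2)
    {u : ℤ → ℂ} (hu : ∀ j, ‖u j‖ₑ ≤ V j) {H : Ham} (hH : hamSum V H ≠ ∞) {t : ℂ}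
    (ht : (κ ^ 2 + 1) * ‖t‖ ≤ 1 - κ ^ 2) :
    ∑' (x : MIdx × MIdx) (q : ℕ), ‖t ^ q * lineCoeff I H u q x‖ₑ ≠ ∞ := by
  refine ne_top_of_le_ne_top hH (ENNReal.tsum_le_tsum fun x => ?_)
  set M := Finsupp.degree (splitEquiv.symm x).1
  calc _ ≤ ∑' q, (binCoeff (ENNReal.ofReal (κ ^ 2)) (ENNReal.ofReal (κ ^ 2 + 1)) M q * ‖t‖ₑ ^ q) *
          (‖H x‖ₑ * mon V (x.1 + x.2)) := by
        refine ENNReal.tsum_le_tsum fun q => ?_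
        rw [enorm_mul, enorm_pow, mul_right_comm, mul_comm]
        gcongr
        exact enorm_lineCoeff_le hI hu H q x
    _ ≤ 1 * (‖H x‖ₑ * mon V (x.1 + x.2)) := by
        rw [ENNReal.tsum_mul_right, tsum_binCoeff_mul_pow]
        gcongr
        refine pow_le_one₀ zero_le ?_
        rw [← ofReal_norm, ← ENNReal.ofReal_mul (by positivity),
          ← ENNReal.ofReal_add (by positivity) (by positivity), ENNReal.ofReal_le_one]
        linarith
    _ = _ := one_mul _

theorem auxHam_actionLine (I : ℤ → ℝ) (H : Ham) (u : ℤ → ℂ) (t : ℂ) :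
    auxHam H u (actionLine I u t) =
      ∑' (x : MIdx × MIdx) (q : ℕ), t ^ q * lineCoeff I H u q x := by
  unfold auxHam
  refine tsum_congr fun x => ?_
  obtain ⟨⟨m, d⟩, rfl⟩ := splitEquiv.surjective x
  have hl : actionLine I u t = fun j => (I j : ℂ) + t * (actions u j - I j) := by
    ext j; simp [actionLine, actions]
  have h1 := splitEquiv_inf m d
  have h2 : (splitEquiv (m, d)).1 - m = d.1.1 := by simp [splitEquiv_apply]
  have h3 : (splitEquiv (m, d)).2 - m = d.1.2 := by simp [splitEquiv_apply]
  rw [h1, h2, h3, hl, mpow_eq_mon, mpow_eq_mon, mpow_eq_mon, mon_line_eq_sum,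
    tsum_eq_sum (s := Finset.range (Finsupp.degree m + 1))]
  · rw [mul_assoc, mul_assoc, Finset.sum_mul, Finset.mul_sum]
    refine Finset.sum_congr rfl fun q _ => ?_
    rw [lineCoeff, Equiv.symm_apply_apply]; ring
  · intro q hq
    rw [lineCoeff, Equiv.symm_apply_apply, projPoly_eq_zero (by simpa using hq)]; simp

theorem tsum_lineCoeff (hκ : 0 < κ) (hκ1 : κ < 1)
    (h0 : ∀ j, V j ≠ 0) (hI : ∀ j, ‖I j‖ₑ ≤ ENNReal.ofReal (κ ^ 2) * V j ^ 2)
    {u : ℤ → ℂ} (hu : ∀ j, ‖u j‖ₑ ≤ V j) {H : Ham} (hH : hamSum V H ≠ ∞) (q : ℕ) :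
    ∑' x, lineCoeff I H u q x = eval (taylorProj I q H) u := by
  have hP : hamSum V (taylorProj I q H) ≠ ∞ := ne_top_of_le_ne_top
    (ENNReal.mul_ne_top ENNReal.ofReal_ne_top hH) (hamSum_taylorProj_le hκ hκ1 hI q H)
  have hs : Summable fun x => ‖lineCoeff I H u q x‖ := by
    refine summable_norm_of_tsum_enorm (ne_top_of_le_ne_top
      (ENNReal.mul_ne_top (ENNReal.ofReal_ne_top (r := (1 + 1 / κ ^ 2) ^ q * cKappa κ ^ q)) hH) ?_)
    rw [hamSum, ← ENNReal.tsum_mul_left]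
    refine ENNReal.tsum_le_tsum fun x => (enorm_lineCoeff_le hI hu H q x).trans ?_
    gcongr
    exact binCoeff_le hκ hκ1 zero_le_one _ _
  rw [eval, tsum_split_complex hs, tsum_split_complex (summable_term hu hP)]
  refine tsum_congr fun d => ?_
  simp_rw [term_split, cls_taylorProj, lineCoeff, Equiv.symm_apply_apply, tsum_mul_right]
  congr 1
  unfold projSeq
  rw [tsum_mul_matrix_comm (cls_tsum_ne_top h0 hH d)
    (K := ENNReal.ofReal ((1 + 1 / κ ^ 2) ^ q * cKappa κ ^ q)) ENNReal.ofReal_ne_top]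
  · simp_rw [tsum_coeff_projPoly_mul_mon]; rfl
  · intro m
    simp_rw [enorm_ofReal', enorm_mon]
    exact polyNorm_projPoly_le_const hκ hκ1 hI zero_le_one
      (fun j => by simpa using enorm_actions_le hu j) q m

/-- The function `t ↦ 𝙷(u, I + t(|u|² - I))` is analytic at `0`, and its Taylor coefficients are
the values at `u` of the projections of `H`. -/
theorem hasFPowerSeriesAt_auxHam (hκ : 0 < κ) (hκ1 : κ < 1)
    (h0 : ∀ j, V j ≠ 0) (hI : ∀ j, ‖I j‖ₑ ≤ ENNReal.ofReal (κ ^ 2) * V j ^ 2)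
    {u : ℤ → ℂ} (hu : ∀ j, ‖u j‖ₑ ≤ V j) {H : Ham} (hH : hamSum V H ≠ ∞) :
    HasFPowerSeriesAt (fun t : ℂ => auxHam H u (actionLine I u t))
      (FormalMultilinearSeries.ofScalars ℂ fun q => eval (taylorProj I q H) u) 0 := by
  rw [hasFPowerSeriesAt_iff]
  -- for `|t|` below this bound, `κ² + (κ² + 1) |t| ≤ 1`
  have h1 : 0 < (1 - κ ^ 2) / (κ ^ 2 + 1) := div_pos (by nlinarith) (by positivity)
  filter_upwards [Metric.closedBall_mem_nhds (0 : ℂ) h1] with t ht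
  rw [mem_closedBall_zero_iff, le_div_iff₀ (by positivity), mul_comm] at ht
  have hfin := tsum_lineCoeff_ne_top hI hu hH ht
  have hs := summable_norm_prod hfin
  have hs' : Summable fun y : ℕ × (MIdx × MIdx) => t ^ y.1 * lineCoeff I H u y.1 y.2 :=
    (Equiv.prodComm _ _).summable_iff.1 hs.of_norm
  simp only [FormalMultilinearSeries.coeff_ofScalars, smul_eq_mul, zero_add, auxHam_actionLine]
  rw [tsum_comm_of_enorm hfin]
  simp_rw [← tsum_lineCoeff hκ hκ1 h0 hI hu hH, ← tsum_mul_left]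
  exact hs'.prod.hasSum

theorem eval_taylorProj (hκ : 0 < κ) (hκ1 : κ < 1)
    (h0 : ∀ j, V j ≠ 0) (hI : ∀ j, ‖I j‖ₑ ≤ ENNReal.ofReal (κ ^ 2) * V j ^ 2)
    {u : ℤ → ℂ} (hu : ∀ j, ‖u j‖ₑ ≤ V j) {H : Ham} (hH : hamSum V H ≠ ∞) (q : ℕ) :
    eval (taylorProj I q H) u = (1 / (q.factorial : ℂ)) *
      iteratedDeriv q (fun t : ℂ => auxHam H u (actionLine I u t)) 0 := by
  have h1 := hasFPowerSeriesAt_auxHam hκ hκ1 h0 hI hu hH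
  have h2 := h1.eq_formalMultilinearSeries h1.analyticAt.hasFPowerSeriesAt
  have h3 := congrArg (fun P => FormalMultilinearSeries.coeff P q) h2
  simp only [FormalMultilinearSeries.coeff_ofScalars] at h3
  rw [h3]; ring

end expansion

/-! ### Regular Hamiltonians and Lipschitz families -/

section regular
variable {θ p s a η r κ : ℝ} {I : ℤ → ℝ}

theorem enorm_action_le (hr : 0 < r) (hκ : 0 < κ) (hI : ∀ j, 0 ≤ I j)
    (h : seqNorm θ p s a (fun j => ((Real.sqrt (I j) : ℝ) : ℂ)) ≤ ENNReal.ofReal (κ * r)) (j : ℤ) :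
    ‖I j‖ₑ ≤ ENNReal.ofReal (κ ^ 2) * rad θ p s a r j ^ 2 := by
  have h1 := (seqNorm_le_iff (by positivity) _).1 h j
  rw [rad_mul hκ.le, enorm_ofReal'] at h1
  rw [ENNReal.ofReal_pow hκ.le, ← mul_pow]
  calc ‖I j‖ₑ = ‖Real.sqrt (I j)‖ₑ ^ 2 := by rw [← enorm_pow, Real.sq_sqrt (hI j)]
    _ ≤ _ := pow_le_pow_left' h1 2

/-- Exchange of the roles of `u` and `ū`. -/
def Disj.swap (d : Disj) : Disj :=
  ⟨d.1.swap, by rw [Prod.fst_swap, Prod.snd_swap, inf_comm]; exact d.2⟩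

theorem splitEquiv_swap (m : MIdx) (d : Disj) :
    splitEquiv (m, d.swap) = (splitEquiv (m, d)).swap := rfl

theorem taylorProj_conj {H : Ham} (h : ∀ α β, H (α, β) = conj (H (β, α))) (I : ℤ → ℝ) (q : ℕ)
    (α β : MIdx) : taylorProj I q H (α, β) = conj (taylorProj I q H (β, α)) := by
  obtain ⟨⟨l, d⟩, hx⟩ := splitEquiv.surjective (α, β)
  have hx' : (β, α) = splitEquiv (l, d.swap) := by rw [splitEquiv_swap, hx]; rfl
  rw [hx', ← hx]
  change cls (taylorProj I q H) d l = conj (cls (taylorProj I q H) d.swap l)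
  rw [cls_taylorProj, cls_taylorProj, projSeq, projSeq, Complex.conj_tsum]
  refine tsum_congr fun m => ?_
  rw [map_mul, Complex.conj_ofReal]
  congr 1
  exact h _ _

theorem len_add (α β : MIdx) : (α + β).len = α.len + β.len := by
  rw [len_eq_degree, map_add]; rfl

theorem taylorProj_mass {H : Ham} (h : ∀ α β : MIdx, α.len ≠ β.len → H (α, β) = 0) (I : ℤ → ℝ)
    (q : ℕ) (α β : MIdx) (hl : α.len ≠ β.len) : taylorProj I q H (α, β) = 0 := by
  obtain ⟨⟨l, d⟩, hx⟩ := splitEquiv.surjective (α, β)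
  have hd : d.1.1.len ≠ d.1.2.len := by
    intro h'
    apply hl
    have h1 := congrArg Prod.fst hx
    have h2 := congrArg Prod.snd hx
    simp only [splitEquiv_apply] at h1 h2
    rw [← h1, ← h2, len_add, len_add, h']
  rw [← hx]
  change cls (taylorProj I q H) d l = 0
  rw [cls_taylorProj, projSeq]
  convert! tsum_zero using 2
  funext m
  rw [cls, splitEquiv_apply, h _ _ (by rw [len_add, len_add]; omega), zero_mul]

theorem fieldNorm_le_of_enorm_le {V : ℤ → ℝ≥0∞} {F G K : Ham}
    (h : ∀ x, ‖K x‖ₑ ≤ ‖F x‖ₑ + ‖G x‖ₑ) : fieldNorm V K ≤ fieldNorm V F + fieldNorm V G := by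
  refine iSup_le fun j => ?_
  refine le_trans ?_ (add_le_add (le_iSup _ j) (le_iSup _ j))
  rw [← ENNReal.add_div]
  gcongr
  unfold fieldSum
  rw [← ENNReal.tsum_add]
  refine ENNReal.tsum_le_tsum fun x => ?_
  rw [← add_mul]
  gcongr
  exact h x

theorem IsRegular.sub (hp : 1 < p) (hs : 0 < s) (ha : 0 ≤ a) (hη : 0 ≤ η) (hr : 0 < r) {F G : Ham}
    (hF : IsRegular θ p s a η r F) (hG : IsRegular θ p s a η r G) :
    IsRegular θ p s a η r (F - G) := by
  rw [isRegular_iff hp hs ha hη hr] at hF hG ⊢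
  refine ⟨fun α β => ?_, fun α β h => ?_, ne_top_of_le_ne_top
    (ENNReal.add_ne_top.2 ⟨hF.2.2, hG.2.2⟩) (fieldNorm_le_of_enorm_le fun x => ?_)⟩
  · simp only [Pi.sub_apply, map_sub]; rw [← hF.1, ← hG.1]
  · simp only [Pi.sub_apply]; rw [hF.2.1 α β h, hG.2.1 α β h, sub_zero]
  · simp only [enorm_majorant, ← add_mul]
    gcongr
    rw [Pi.sub_apply, sub_eq_add_neg]
    exact (enorm_add_le _ _).trans_eq (by rw [enorm_neg])

theorem IsRegular.taylorProj (hp : 1 < p) (hs : 0 < s) (ha : 0 ≤ a) (hη : 0 ≤ η) (hr : 0 < r)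
    (hκ : 0 < κ) (hκ1 : κ < 1)
    (hI : ∀ j, ‖I j‖ₑ ≤ ENNReal.ofReal (κ ^ 2) * rad θ p s a r j ^ 2) {c : ℝ} (hc : 0 < c)
    (hc1 : c ≤ 1) (q : ℕ) {H : Ham} (hH : IsRegular θ p s a η r H) :
    IsRegular θ p s a η (c * r) (taylorProj I q H) ∧
      hamNorm θ p s a η (c * r) (taylorProj I q H) ≤
        ENNReal.ofReal ((c ^ 2)⁻¹ * (1 + c ^ 2 / κ ^ 2) ^ q * cKappa κ ^ q) *
          hamNorm θ p s a η r H := by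
  have hb := fieldNorm_taylorProj_le (rad_ne_zero hr) (rad_ne_top r) hκ hκ1 hI hc hc1 η q H
  have hrad : (fun j => ENNReal.ofReal c * rad θ p s a r j) = rad θ p s a (c * r) :=
    funext fun j => (rad_mul hc.le r j).symm
  rw [hrad] at hb
  have hreg := (isRegular_iff hp hs ha hη hr).1 hH
  have hP : IsRegular θ p s a η (c * r) (TorusProj.taylorProj I q H) :=
    (isRegular_iff hp hs ha hη (mul_pos hc hr)).2 ⟨taylorProj_conj hreg.1 I q,
      taylorProj_mass hreg.2.1 I q, ne_top_of_le_ne_top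
        (ENNReal.mul_ne_top ENNReal.ofReal_ne_top hreg.2.2) hb⟩
  refine ⟨hP, ?_⟩
  rw [hP.hamNorm_eq (mul_pos hc hr), hH.hamNorm_eq hr]
  exact hb

end regular

section families
variable {θ p s a η r : ℝ} {O : Set (ℤ → ℝ)}

theorem famSup_le {r' : ℝ} {A B : O → Ham} {K : ℝ≥0∞}
    (h : ∀ ω, hamNorm θ p s a η r' (A ω) ≤ K * hamNorm θ p s a η r (B ω)) :
    famSup θ p s a η r' A ≤ K * famSup θ p s a η r B := by
  refine iSup_le fun ω => (h ω).trans ?_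
  gcongr
  exact le_iSup (fun ω => hamNorm θ p s a η r (B ω)) ω

theorem famLip_le {r' : ℝ} {A B : O → Ham} {K : ℝ≥0∞}
    (h : ∀ ω ω', hamNorm θ p s a η r' (A ω - A ω') ≤ K * hamNorm θ p s a η r (B ω - B ω')) :
    famLip θ p s a η r' A ≤ K * famLip θ p s a η r B := by
  refine iSup_le fun ω => iSup_le fun ω' => iSup_le fun hne => ?_
  calc _ ≤ K * hamNorm θ p s a η r (B ω - B ω') / supDist (ω : ℤ → ℝ) ω' := by
        gcongr; exact h ω ω'
    _ = K * (hamNorm θ p s a η r (B ω - B ω') / supDist (ω : ℤ → ℝ) ω') := mul_div_assoc _ _ _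
    _ ≤ _ := by
        gcongr
        exact le_iSup_of_le ω (le_iSup_of_le ω' (le_iSup_of_le hne le_rfl))

theorem famNorm_le {μ r' : ℝ} {A B : O → Ham} {K : ℝ≥0∞}
    (h1 : ∀ ω, hamNorm θ p s a η r' (A ω) ≤ K * hamNorm θ p s a η r (B ω))
    (h2 : ∀ ω ω', hamNorm θ p s a η r' (A ω - A ω') ≤ K * hamNorm θ p s a η r (B ω - B ω')) :
    famNorm θ p s a η μ r' A ≤ K * famNorm θ p s a η μ r B := by
  unfold famNorm
  rw [mul_add, mul_left_comm]
  gcongr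
  · exact famSup_le h1
  · exact famLip_le h2

/-- The projection of degree `2q - 2` of a family, acting pointwise in `ω`. -/
def famProj (I : ℤ → ℝ) (q : ℕ) (H : O → Ham) : O → Ham := fun ω => taylorProj I q (H ω)

end families

/-! ### Term-by-term differentiation -/

/-- The power series `∂H/∂u_j`. -/
def seriesD (j : ℤ) (H : Ham) : Ham := fun x =>
  ((x.1 j : ℂ) + 1) * H (x.1 + Finsupp.single j 1, x.2)

/-- Exchange of `u` and `ū`. -/
def swapHam (H : Ham) : Ham := fun x => H x.swap

theorem hamSum_swapHam (V : ℤ → ℝ≥0∞) (H : Ham) : hamSum V (swapHam H) = hamSum V H := by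
  unfold hamSum
  rw [← (Equiv.prodComm _ _).tsum_eq]
  refine tsum_congr fun x => ?_
  simp [swapHam, add_comm]

theorem exists_nat_mul_pow_le {c : ℝ} (hc : 0 ≤ c) (hc1 : c < 1) :
    ∃ C : ℝ, 0 ≤ C ∧ ∀ n : ℕ, n * c ^ n ≤ C := by
  obtain ⟨C, hC⟩ := (tendsto_self_mul_const_pow_of_lt_one hc hc1).bddAbove_range
  exact ⟨C, by simpa using hC ⟨0, rfl⟩, fun n => hC ⟨n, rfl⟩⟩

theorem exists_degree_mul_mon_le {c : ℝ} (hc : 0 ≤ c) (hc1 : c < 1) :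
    ∃ C : ℝ, 0 ≤ C ∧ ∀ (V : ℤ → ℝ≥0∞) (α : MIdx), ((Finsupp.degree α : ℕ) : ℝ≥0∞) *
      mon (fun j => ENNReal.ofReal c * V j) α ≤ ENNReal.ofReal C * mon V α := by
  obtain ⟨C, hC0, hC⟩ := exists_nat_mul_pow_le hc hc1
  refine ⟨C, hC0, fun V α => ?_⟩
  rw [mon_const_mul, ← mul_assoc, ← ENNReal.ofReal_natCast, ← ENNReal.ofReal_pow hc,
    ← ENNReal.ofReal_mul (by positivity)]
  gcongr
  exact hC _

theorem fieldSum_lt_top_of_lt {c : ℝ} (hc : 0 ≤ c) (hc1 : c < 1) {V : ℤ → ℝ≥0∞} {H : Ham}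
    (hH : hamSum V H ≠ ∞) (j : ℤ) : fieldSum (fun j => ENNReal.ofReal c * V j) H j ≠ ∞ := by
  obtain ⟨C, -, hC⟩ := exists_degree_mul_mon_le hc hc1
  refine ne_top_of_le_ne_top (ENNReal.mul_ne_top (ENNReal.ofReal_ne_top (r := C)) hH) ?_
  unfold fieldSum hamSum
  rw [← ENNReal.tsum_mul_left]
  refine ENNReal.tsum_le_tsum fun x => ?_
  rw [mul_left_comm (ENNReal.ofReal C)]
  refine mul_le_mul_right (le_trans ?_ (hC V _)) _
  gcongr
  exact (Finsupp.le_degree j x.2).trans (by rw [map_add]; omega)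

section domain
variable {θ p s a r : ℝ}

/-- The expansion converges absolutely on the open ball of radius `r`. -/
def OpenSummable (θ p s a r : ℝ) (H : Ham) : Prop :=
  ∀ ρ, 0 < ρ → ρ < r → hamSum (rad θ p s a ρ) H ≠ ∞

theorem OpenSummable.of_hamSum {H : Ham} (h : hamSum (rad θ p s a r) H ≠ ∞) :
    OpenSummable θ p s a r H := fun _ _ hρ =>
  ne_top_of_le_ne_top h (hamSum_mono (rad_mono hρ.le) H)

theorem OpenSummable.swapHam {H : Ham} (h : OpenSummable θ p s a r H) :
    OpenSummable θ p s a r (swapHam H) := fun ρ h0 h1 => by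
  rw [hamSum_swapHam]; exact h ρ h0 h1

theorem OpenSummable.seriesDbar {H : Ham} (h : OpenSummable θ p s a r H) (j : ℤ) :
    OpenSummable θ p s a r (seriesDbar j H) := fun ρ h0 h1 => by
  obtain ⟨ρ', h2, h3⟩ := exists_between h1
  rw [hamSum_seriesDbar_eq_div (rad_ne_zero h0) (rad_ne_top ρ)]
  refine ENNReal.div_ne_top ?_ (rad_ne_zero h0 j)
  have hρ' : 0 < ρ' := h0.trans h2
  have := fieldSum_lt_top_of_lt (c := ρ / ρ') (by positivity) ((div_lt_one hρ').2 h2)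
    (h ρ' hρ' h3) j
  simp_rw [← rad_mul (show 0 ≤ ρ / ρ' by positivity), div_mul_cancel₀ ρ hρ'.ne'] at this
  exact this

theorem OpenSummable.seriesD {H : Ham} (h : OpenSummable θ p s a r H) (j : ℤ) :
    OpenSummable θ p s a r (seriesD j H) :=
  (h.swapHam.seriesDbar j).swapHam

end domain

/-- The summand of `∂H/∂u_j` coming from the monomial `x` of `H`. -/
def termD (j : ℤ) (H : Ham) (u : ℤ → ℂ) (x : MIdx × MIdx) : ℂ :=
  H x * (x.1 j * mon u (x.1 - Finsupp.single j 1)) * mon (fun i => conj (u i)) x.2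

/-- The summand of `∂H/∂ū_j` coming from the monomial `x` of `H`. -/
def termDbar (j : ℤ) (H : Ham) (u : ℤ → ℂ) (x : MIdx × MIdx) : ℂ :=
  H x * mon u x.1 * (x.2 j * mon (fun i => conj (u i)) (x.2 - Finsupp.single j 1))

theorem termD_add_single (j : ℤ) (H : Ham) (u : ℤ → ℂ) (x : MIdx × MIdx) :
    termD j H u (x.1 + Finsupp.single j 1, x.2) = term (seriesD j H) u x := by
  simp only [termD, term, seriesD, mpow_eq_mon, Finsupp.add_apply, Finsupp.single_eq_same,
    add_tsub_cancel_right]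
  push_cast; ring

theorem termDbar_add_single (j : ℤ) (H : Ham) (u : ℤ → ℂ) (x : MIdx × MIdx) :
    termDbar j H u (x.1, x.2 + Finsupp.single j 1) = term (seriesDbar j H) u x := by
  simp only [termDbar, term, seriesDbar, mpow_eq_mon, Finsupp.add_apply, Finsupp.single_eq_same,
    add_tsub_cancel_right]
  push_cast; ring

theorem termD_eq_zero {j : ℤ} (H : Ham) (u : ℤ → ℂ) {x : MIdx × MIdx} (h : x.1 j = 0) :
    termD j H u x = 0 := by simp [termD, h]

theorem termDbar_eq_zero {j : ℤ} (H : Ham) (u : ℤ → ℂ) {x : MIdx × MIdx} (h : x.2 j = 0) :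
    termDbar j H u x = 0 := by simp [termDbar, h]

theorem tsum_termD (j : ℤ) (H : Ham) (u : ℤ → ℂ) :
    ∑' x, termD j H u x = eval (seriesD j H) u := by
  rw [← tsum_add_single_fst j fun x hx => termD_eq_zero H u hx]
  exact tsum_congr fun x => termD_add_single j H u x

theorem tsum_termDbar (j : ℤ) (H : Ham) (u : ℤ → ℂ) :
    ∑' x, termDbar j H u x = eval (seriesDbar j H) u := by
  rw [← tsum_add_single_snd j fun x hx => termDbar_eq_zero H u hx]
  exact tsum_congr fun x => termDbar_add_single j H u x

/-- A majorant of the summands of `∂H/∂u_j` on the polydisc of radii `V`. -/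
def majD (j : ℤ) (H : Ham) (V : ℤ → ℝ≥0∞) (x : MIdx × MIdx) : ℝ≥0∞ :=
  ‖H x‖ₑ * (x.1 j * mon V (x.1 - Finsupp.single j 1 + x.2))

/-- A majorant of the summands of `∂H/∂ū_j` on the polydisc of radii `V`. -/
def majDbar (j : ℤ) (H : Ham) (V : ℤ → ℝ≥0∞) (x : MIdx × MIdx) : ℝ≥0∞ :=
  ‖H x‖ₑ * (x.2 j * mon V (x.1 + (x.2 - Finsupp.single j 1)))

theorem enorm_natCast' (n : ℕ) : ‖(n : ℂ)‖ₑ = n := by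
  rw [← ofReal_norm, Complex.norm_natCast, ENNReal.ofReal_natCast]

theorem enorm_natCast_add_one (n : ℕ) : ‖(n : ℂ) + 1‖ₑ = (n : ℝ≥0∞) + 1 := by
  have := enorm_natCast' (n + 1)
  push_cast at this; exact this

theorem tsum_majDbar (j : ℤ) (H : Ham) (V : ℤ → ℝ≥0∞) :
    ∑' x, majDbar j H V x = hamSum V (seriesDbar j H) := by
  rw [← tsum_add_single_snd j fun x hx => by simp [majDbar, hx]]
  refine tsum_congr fun x => ?_
  simp only [majDbar, seriesDbar, Finsupp.add_apply, Finsupp.single_eq_same,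
    add_tsub_cancel_right, enorm_mul, enorm_natCast_add_one]
  push_cast; ring

theorem tsum_majD (j : ℤ) (H : Ham) (V : ℤ → ℝ≥0∞) :
    ∑' x, majD j H V x = hamSum V (seriesD j H) := by
  rw [← tsum_add_single_fst j fun x hx => by simp [majD, hx]]
  refine tsum_congr fun x => ?_
  simp only [majD, seriesD, Finsupp.add_apply, Finsupp.single_eq_same,
    add_tsub_cancel_right, enorm_mul, enorm_natCast_add_one]
  push_cast; ring

theorem enorm_mon_conj (u : ℤ → ℂ) (α : MIdx) :
    ‖mon (fun j => conj (u j)) α‖ₑ = mon (fun j => ‖u j‖ₑ) α := by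
  rw [enorm_mon]
  congr 1; ext j
  rw [← ofReal_norm, RCLike.norm_conj, ofReal_norm]

theorem enorm_termD_le {V : ℤ → ℝ≥0∞} {u : ℤ → ℂ} (hu : ∀ j, ‖u j‖ₑ ≤ V j) (j : ℤ) (H : Ham)
    (x : MIdx × MIdx) : ‖termD j H u x‖ₑ ≤ majD j H V x := by
  rw [termD, majD, enorm_mul, enorm_mul, enorm_mul, enorm_natCast', enorm_mon, enorm_mon_conj,
    mon_add, mul_assoc, mul_assoc]
  gcongr <;> exact mon_mono hu _

theorem enorm_termDbar_le {V : ℤ → ℝ≥0∞} {u : ℤ → ℂ} (hu : ∀ j, ‖u j‖ₑ ≤ V j) (j : ℤ) (H : Ham)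
    (x : MIdx × MIdx) : ‖termDbar j H u x‖ₑ ≤ majDbar j H V x := by
  rw [termDbar, majDbar, enorm_mul, enorm_mul, enorm_mul, enorm_natCast', enorm_mon,
    enorm_mon_conj, mon_add, mul_assoc, mul_left_comm (x.2 j : ℝ≥0∞)]
  gcongr <;> exact mon_mono hu _

section slice
variable {S : Finset ℤ}

/-- The point `u + ∑_{j ∈ S} z_j e_j`. -/
def modify (u : ℤ → ℂ) (S : Finset ℤ) (z : S → ℂ) (j : ℤ) : ℂ :=
  if h : j ∈ S then u j + z ⟨j, h⟩ else u j

theorem slice_eq (f : (ℤ → ℂ) → ℂ) (u : ℤ → ℂ) (S : Finset ℤ) (z : S → ℂ) :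
    slice f u S z = f (modify u S z) := rfl

/-- The `j`-th coordinate, as a real-linear map (zero for `j ∉ S`). -/
def coordL (S : Finset ℤ) (j : ℤ) : (S → ℂ) →L[ℝ] ℂ :=
  if h : j ∈ S then ContinuousLinearMap.proj (R := ℝ) ⟨j, h⟩ else 0

/-- The complex conjugate of the `j`-th coordinate. -/
def coordConjL (S : Finset ℤ) (j : ℤ) : (S → ℂ) →L[ℝ] ℂ :=
  (Complex.conjCLE : ℂ →L[ℝ] ℂ).comp (coordL S j)

theorem norm_coordL_le (S : Finset ℤ) (j : ℤ) : ‖coordL S j‖ ≤ 1 := by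
  unfold coordL
  split_ifs with h
  · exact ContinuousLinearMap.opNorm_le_bound _ zero_le_one fun z => by
      simpa using norm_le_pi_norm z ⟨j, h⟩
  · simp

theorem norm_coordConjL_le (S : Finset ℤ) (j : ℤ) : ‖coordConjL S j‖ ≤ 1 :=
  ContinuousLinearMap.opNorm_le_bound _ zero_le_one fun z => by
    have := (coordL S j).le_of_opNorm_le (norm_coordL_le S j) z
    simpa [coordConjL] using this

theorem hasFDerivAt_modify (u : ℤ → ℂ) (j : ℤ) (z : S → ℂ) :
    HasFDerivAt (fun z => modify u S z j) (coordL S j) z := by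
  unfold modify coordL
  split_ifs with h
  · exact ((ContinuousLinearMap.proj (R := ℝ) (φ := fun _ : S => ℂ)
      ⟨j, h⟩).hasFDerivAt).const_add (u j)
  · exact hasFDerivAt_const _ _

theorem mon_add_single_deriv {R : Type*} [CommSemiring R] (v : ℤ → R) (α : MIdx) (i j : ℤ) :
    (((α + Finsupp.single i 1 : MIdx) j : ℕ) : R) *
        mon v (α + Finsupp.single i 1 - Finsupp.single j 1) =
      v i * (α j * mon v (α - Finsupp.single j 1)) + if j = i then mon v α else 0 := by
  have h1 : α j ≠ 0 → mon v α = v j * mon v (α - Finsupp.single j 1) := by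
    intro h
    conv_lhs => rw [← tsub_add_cancel_of_le (a := Finsupp.single j 1) (b := α)
      (by rw [Finsupp.single_le_iff]; exact Nat.one_le_iff_ne_zero.2 h)]
    rw [mon_add, mon_single, pow_one, mul_comm]
  by_cases hji : j = i
  · subst hji
    rw [if_pos rfl, add_tsub_cancel_right, Finsupp.add_apply, Finsupp.single_eq_same]
    by_cases h : α j = 0
    · simp [h]
    · rw [h1 h]; push_cast; ring
  · rw [if_neg hji, add_zero, Finsupp.add_apply, Finsupp.single_eq_of_ne hji, add_zero]
    by_cases h : α j = 0
    · simp [h]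
    · have h2 : α + Finsupp.single i 1 - Finsupp.single j 1 =
          α - Finsupp.single j 1 + Finsupp.single i 1 := by
        refine tsub_add_eq_add_tsub ?_ |>.symm
        rw [Finsupp.single_le_iff]; exact Nat.one_le_iff_ne_zero.2 h
      rw [h2, mon_add, mon_single, pow_one]; ring

theorem hasFDerivAt_mon (u : ℤ → ℂ) (α : MIdx) (z : S → ℂ) :
    HasFDerivAt (fun z => mon (modify u S z) α)
      (∑ j ∈ S, (α j * mon (modify u S z) (α - Finsupp.single j 1) : ℂ) • coordL S j) z := by
  induction α using MIdx.induct with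
  | h0 =>
    simp only [mon_zero]
    refine (hasFDerivAt_const (𝕜 := ℝ) (1 : ℂ) z).congr_fderiv ?_
    ext v
    simp
  | h1 α i ih =>
    have h := ih.mul (hasFDerivAt_modify u i z)
    have e : (fun z : S → ℂ => mon (modify u S z) (α + Finsupp.single i 1)) =
        fun z => mon (modify u S z) α * modify u S z i := by
      ext z; rw [mon_add, mon_single, pow_one]
    rw [e]
    refine h.congr_fderiv ?_
    ext v
    have hi : (∑ j ∈ S, (if j = i then mon (modify u S z) α else 0) * coordL S j v) =
        mon (modify u S z) α * coordL S i v := by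
      simp_rw [ite_mul, zero_mul, Finset.sum_ite_eq']
      split_ifs with hi
      · rfl
      · simp [coordL, hi]
    simp only [add_apply, sum_apply, smul_apply, smul_eq_mul, mon_add_single_deriv, add_mul,
      Finset.sum_add_distrib, hi, Finset.mul_sum]
    rw [add_comm]
    congr 1
    refine Finset.sum_congr rfl fun j _ => ?_
    ring

theorem hasFDerivAt_mon_conj (u : ℤ → ℂ) (α : MIdx) (z : S → ℂ) :
    HasFDerivAt (fun z => mon (fun i => conj (modify u S z i)) α)
      (∑ j ∈ S, (α j * mon (fun i => conj (modify u S z i)) (α - Finsupp.single j 1) : ℂ) •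
        coordConjL S j) z := by
  have h := (Complex.conjCLE : ℂ →L[ℝ] ℂ).hasFDerivAt.comp z (hasFDerivAt_mon u α z)
  have e : ∀ z α, mon (fun i => conj (modify u S z i)) α = conj (mon (modify u S z) α) :=
    fun z α => (map_mon (starRingEnd ℂ) _ _).symm
  simp_rw [e]
  refine h.congr_fderiv ?_
  ext v
  simp [coordConjL]

theorem hasFDerivAt_term (H : Ham) (u : ℤ → ℂ) (x : MIdx × MIdx) (z : S → ℂ) :
    HasFDerivAt (fun z => term H (modify u S z) x)
      (∑ j ∈ S, (termD j H (modify u S z) x • coordL S j +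
        termDbar j H (modify u S z) x • coordConjL S j)) z := by
  have h := ((hasFDerivAt_mon u x.1 z).const_mul (H x)).mul (hasFDerivAt_mon_conj u x.2 z)
  refine h.congr_fderiv ?_
  ext v
  simp only [termD, termDbar, Finset.smul_sum, Finset.sum_add_distrib, smul_smul,
    add_apply, sum_apply, smul_apply,
    smul_eq_mul]
  rw [add_comm]
  congr 1
  refine Finset.sum_congr rfl fun j _ => ?_
  ring

end slice

/-! ### Smoothness in finitely many modes -/

section smooth
variable {θ p s a r : ℝ} {S : Finset ℤ} {u : ℤ → ℂ}

/-- The increments `z` for which the coordinates of `u + ∑_{j ∈ S} z_j e_j` in `S` have weighted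
modulus less than `ρ`. -/
def polydisc (θ p s a ρ : ℝ) (u : ℤ → ℂ) (S : Finset ℤ) : Set (S → ℂ) :=
  Set.univ.pi fun j => Metric.ball (-u j) (ρ / weight θ p s a j)

theorem isOpen_polydisc (ρ : ℝ) : IsOpen (polydisc θ p s a ρ u S) :=
  isOpen_set_pi Set.finite_univ fun _ _ => Metric.isOpen_ball

theorem isPreconnected_polydisc (ρ : ℝ) : IsPreconnected (polydisc θ p s a ρ u S) :=
  (convex_pi fun _ _ => convex_ball _ _ : Convex ℝ (polydisc θ p s a ρ u S)).isPreconnected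

theorem zero_mem_polydisc {ρ₀ ρ : ℝ} (h0 : 0 < ρ₀) (h : ρ₀ < ρ)
    (hu : ∀ j, ‖u j‖ₑ ≤ rad θ p s a ρ₀ j) : (0 : S → ℂ) ∈ polydisc θ p s a ρ u S := by
  intro j _
  have hw := weight_pos (θ := θ) (p := p) (s := s) (a := a) j
  have h1 := hu j
  rw [rad, ← ofReal_norm, ENNReal.ofReal_le_ofReal_iff (by positivity)] at h1
  simp only [Pi.zero_apply, Metric.mem_ball, dist_eq_norm, zero_sub, neg_neg]
  exact h1.trans_lt (by gcongr)

theorem enorm_modify_le {ρ₀ ρ : ℝ} (h : ρ₀ < ρ)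
    (hu : ∀ j, ‖u j‖ₑ ≤ rad θ p s a ρ₀ j) {z : S → ℂ} (hz : z ∈ polydisc θ p s a ρ u S) (j : ℤ) :
    ‖modify u S z j‖ₑ ≤ rad θ p s a ρ j := by
  unfold modify
  split_ifs with hj
  · have h1 := hz ⟨j, hj⟩ trivial
    rw [Metric.mem_ball, dist_eq_norm, sub_neg_eq_add, add_comm] at h1
    rw [rad, ← ofReal_norm]
    exact ENNReal.ofReal_le_ofReal h1.le
  · exact (hu j).trans (rad_mono h.le j)

theorem modify_zero (u : ℤ → ℂ) (S : Finset ℤ) : modify u S 0 = u := by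
  ext j; simp [modify]

theorem hasSum_termD {V : ℤ → ℝ≥0∞} (hu : ∀ j, ‖u j‖ₑ ≤ V j) {H : Ham} {j : ℤ}
    (hH : hamSum V (seriesD j H) ≠ ∞) :
    HasSum (termD j H u) (eval (seriesD j H) u) := by
  rw [← tsum_termD]
  refine (summable_norm_of_tsum_enorm (ne_top_of_le_ne_top hH ?_)).of_norm.hasSum
  rw [← tsum_majD]
  exact ENNReal.tsum_le_tsum (enorm_termD_le hu j H)

theorem hasSum_termDbar {V : ℤ → ℝ≥0∞} (hu : ∀ j, ‖u j‖ₑ ≤ V j) {H : Ham} {j : ℤ}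
    (hH : hamSum V (seriesDbar j H) ≠ ∞) :
    HasSum (termDbar j H u) (eval (seriesDbar j H) u) := by
  rw [← tsum_termDbar]
  refine (summable_norm_of_tsum_enorm (ne_top_of_le_ne_top hH ?_)).of_norm.hasSum
  rw [← tsum_majDbar]
  exact ENNReal.tsum_le_tsum (enorm_termDbar_le hu j H)

/-- The derivative of `H` at `u` in the modes of `S`. -/
def sliceDeriv (S : Finset ℤ) (H : Ham) (u : ℤ → ℂ) : (S → ℂ) →L[ℝ] ℂ :=
  ∑ j ∈ S, (eval (seriesD j H) u • coordL S j + eval (seriesDbar j H) u • coordConjL S j)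

/-- The derivative at `u` of the term of index `x` in the modes of `S`. -/
def termDeriv (S : Finset ℤ) (H : Ham) (u : ℤ → ℂ) (x : MIdx × MIdx) : (S → ℂ) →L[ℝ] ℂ :=
  ∑ j ∈ S, (termD j H u x • coordL S j + termDbar j H u x • coordConjL S j)

theorem tsum_termDeriv {V : ℤ → ℝ≥0∞} (hu : ∀ j, ‖u j‖ₑ ≤ V j) {H : Ham}
    (hD : ∀ j, hamSum V (seriesD j H) ≠ ∞) (hDb : ∀ j, hamSum V (seriesDbar j H) ≠ ∞)
    (S : Finset ℤ) : ∑' x, termDeriv S H u x = sliceDeriv S H u := by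
  refine HasSum.tsum_eq ?_
  unfold termDeriv sliceDeriv
  exact hasSum_sum fun j _ => ((hasSum_termD hu (hD j)).smul_const _).add
    ((hasSum_termDbar hu (hDb j)).smul_const _)

/-- A majorant of the derivatives of the terms on the polydisc of radii `V`. -/
def majDeriv (S : Finset ℤ) (H : Ham) (V : ℤ → ℝ≥0∞) (x : MIdx × MIdx) : ℝ≥0∞ :=
  ∑ j ∈ S, (majD j H V x + majDbar j H V x)

theorem tsum_majDeriv_ne_top {V : ℤ → ℝ≥0∞} {H : Ham}
    (hD : ∀ j, hamSum V (seriesD j H) ≠ ∞) (hDb : ∀ j, hamSum V (seriesDbar j H) ≠ ∞)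
    (S : Finset ℤ) : ∑' x, majDeriv S H V x ≠ ∞ := by
  unfold majDeriv
  rw [Summable.tsum_finsetSum (fun _ _ => ENNReal.summable)]
  refine (ENNReal.sum_lt_top.2 fun j _ => ?_).ne
  rw [ENNReal.tsum_add, tsum_majD, tsum_majDbar]
  exact ENNReal.add_lt_top.2 ⟨(hD j).lt_top, (hDb j).lt_top⟩

theorem norm_termDeriv_le {V : ℤ → ℝ≥0∞} (hu : ∀ j, ‖u j‖ₑ ≤ V j) (S : Finset ℤ) (H : Ham)
    (x : MIdx × MIdx) (hx : majDeriv S H V x ≠ ∞) :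
    ‖termDeriv S H u x‖ ≤ (majDeriv S H V x).toReal := by
  have h1 : ‖termDeriv S H u x‖ ≤ ∑ j ∈ S, (‖termD j H u x‖ + ‖termDbar j H u x‖) := by
    refine ContinuousLinearMap.opNorm_le_bound _ (Finset.sum_nonneg fun _ _ => by positivity)
      fun z => ?_
    rw [termDeriv]
    simp only [sum_apply, add_apply, smul_apply, smul_eq_mul]
    rw [Finset.sum_mul]
    refine (norm_sum_le _ _).trans (Finset.sum_le_sum fun j _ => (norm_add_le _ _).trans ?_)
    rw [norm_mul, norm_mul, add_mul]
    have e1 := (coordL S j).le_of_opNorm_le (norm_coordL_le S j) z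
    have e2 := (coordConjL S j).le_of_opNorm_le (norm_coordConjL_le S j) z
    rw [one_mul] at e1 e2
    gcongr
  refine h1.trans ((ENNReal.ofReal_le_iff_le_toReal hx).1 ?_)
  rw [ENNReal.ofReal_sum_of_nonneg fun _ _ => by positivity]
  refine Finset.sum_le_sum fun j _ => ?_
  rw [ENNReal.ofReal_add (norm_nonneg _) (norm_nonneg _), ofReal_norm, ofReal_norm]
  exact add_le_add (enorm_termD_le hu j H x) (enorm_termDbar_le hu j H x)

/-- Term-by-term differentiation on a polydisc in finitely many modes. -/
theorem hasFDerivAt_slice {H : Ham} (hH : OpenSummable θ p s a r H) {ρ₀ ρ : ℝ} (h0 : 0 < ρ₀)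
    (h1 : ρ₀ < ρ) (h2 : ρ < r) (hu : ∀ j, ‖u j‖ₑ ≤ rad θ p s a ρ₀ j) {z : S → ℂ}
    (hz : z ∈ polydisc θ p s a ρ u S) :
    HasFDerivAt (slice (eval H) u S) (sliceDeriv S H (modify u S z)) z := by
  have hρ : 0 < ρ := h0.trans h1
  have hV : ∀ z ∈ polydisc θ p s a ρ u S, ∀ j, ‖modify u S z j‖ₑ ≤ rad θ p s a ρ j :=
    fun z hz => enorm_modify_le h1 hu hz
  have hD : ∀ j, hamSum (rad θ p s a ρ) (seriesD j H) ≠ ∞ := fun j => hH.seriesD j ρ hρ h2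
  have hDb : ∀ j, hamSum (rad θ p s a ρ) (seriesDbar j H) ≠ ∞ := fun j => hH.seriesDbar j ρ hρ h2
  have hB := tsum_majDeriv_ne_top hD hDb S
  rw [← tsum_termDeriv (hV z hz) hD hDb S]
  have hf' : ∀ x, ∀ z ∈ polydisc θ p s a ρ u S, ‖termDeriv S H (modify u S z) x‖ ≤
      (majDeriv S H (rad θ p s a ρ) x).toReal := by
    exact fun x z hz => norm_termDeriv_le (hV z hz) S H x (ENNReal.ne_top_of_tsum_ne_top hB x)
  exact hasFDerivAt_tsum_of_isPreconnected (f := fun x z => term H (modify u S z) x)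
    (f' := fun x z => termDeriv S H (modify u S z) x)
    (ENNReal.summable_toReal hB) (isOpen_polydisc ρ) (isPreconnected_polydisc ρ)
    (fun x z _ => hasFDerivAt_term H u x z) hf' hz
    ((summable_term (hV z hz) (hH ρ hρ h2)).of_norm) hz

theorem contDiffOn_slice {ρ₀ ρ : ℝ} (h0 : 0 < ρ₀) (h1 : ρ₀ < ρ) (h2 : ρ < r)
    (hu : ∀ j, ‖u j‖ₑ ≤ rad θ p s a ρ₀ j) (n : ℕ) {H : Ham} (hH : OpenSummable θ p s a r H) :
    ContDiffOn ℝ n (slice (eval H) u S) (polydisc θ p s a ρ u S) := by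
  -- the partial derivatives are sums of series of the same kind, so the induction runs over all `H`
  induction n generalizing H with
  | zero =>
    exact contDiffOn_zero.2 fun z hz =>
      (hasFDerivAt_slice hH h0 h1 h2 hu hz).continuousAt.continuousWithinAt
  | succ n ih =>
    push_cast
    rw [contDiffOn_succ_iff_fderiv_of_isOpen (isOpen_polydisc ρ)]
    refine ⟨fun z hz =>
      (hasFDerivAt_slice hH h0 h1 h2 hu hz).differentiableAt.differentiableWithinAt,
      by simp, ?_⟩
    refine ContDiffOn.congr (f := fun z => sliceDeriv S H (modify u S z)) ?_
      fun z hz => (hasFDerivAt_slice hH h0 h1 h2 hu hz).fderiv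
    unfold sliceDeriv
    refine ContDiffOn.sum fun j _ => ContDiffOn.add ?_ ?_
    · exact (ih (hH.seriesD j)).smul contDiffOn_const
    · exact (ih (hH.seriesDbar j)).smul contDiffOn_const

theorem contDiffAt_slice {H : Ham} (hH : OpenSummable θ p s a r H)
    (hu : seqNorm θ p s a u < ENNReal.ofReal r) (S : Finset ℤ) :
    ContDiffAt ℝ (⊤ : ℕ∞) (slice (eval H) u S) 0 := by
  obtain ⟨ρ₀, h0, h1, hu⟩ := exists_of_seqNorm_lt hu
  obtain ⟨ρ, h2, h3⟩ := exists_between h1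
  refine contDiffAt_infty.2 fun n => (contDiffOn_slice h0 h2 h3 hu n hH).contDiffAt
    ((isOpen_polydisc ρ).mem_nhds (zero_mem_polydisc h0 h2 hu))

/-- A function on sequences that coincides on the open ball of radius `r` with the sum of an
absolutely convergent expansion. -/
structure Represents (θ p s a r : ℝ) (f : (ℤ → ℂ) → ℂ) (H : Ham) : Prop where
  summable : OpenSummable θ p s a r H
  eq_eval : ∀ u, seqNorm θ p s a u < ENNReal.ofReal r → f u = eval H u

theorem modify_singleton (u : ℤ → ℂ) (j : ℤ) (c : ℂ) :
    modify u {j} (fun _ => c) = Function.update u j (u j + c) := by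
  ext i
  by_cases h : i = j
  · subst h; simp [modify]
  · simp [modify, h]

theorem Represents.hasDerivAt {f : (ℤ → ℂ) → ℂ} {H : Ham} (h : Represents θ p s a r f H)
    (hu : seqNorm θ p s a u < ENNReal.ofReal r) (j : ℤ) (c : ℂ) :
    HasDerivAt (fun t : ℝ => f (Function.update u j (u j + (t : ℂ) * c)))
      (eval (seriesD j H) u * c + eval (seriesDbar j H) u * conj c) 0 := by
  obtain ⟨ρ₀, h0, h1, hu⟩ := exists_of_seqNorm_lt hu
  obtain ⟨ρ, h2, h3⟩ := exists_between h1
  have hz := zero_mem_polydisc (S := {j}) h0 h2 hu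
  have hd := hasFDerivAt_slice h.summable h0 h2 h3 hu hz
  have hd' : HasFDerivAt (slice f u {j}) (sliceDeriv {j} H (modify u {j} 0)) 0 := by
    refine hd.congr_of_eventuallyEq ?_
    filter_upwards [(isOpen_polydisc ρ).mem_nhds hz] with z hz
    refine h.eq_eval _ (lt_of_le_of_lt ((seqNorm_le_iff (h0.trans h2).le _).2
      (enorm_modify_le h2 hu hz)) ?_)
    exact (ENNReal.ofReal_lt_ofReal_iff (h0.trans h1)).2 h3
  have hl : HasDerivAt (fun (t : ℝ) (_ : ({j} : Finset ℤ)) => (t : ℂ) * c) (fun _ => c) 0 := by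
    refine hasDerivAt_pi.2 fun _ => ?_
    simpa using (Complex.ofRealCLM.hasDerivAt (x := (0 : ℝ))).mul_const c
  have hl0 : (fun _ : ({j} : Finset ℤ) => ((0 : ℝ) : ℂ) * c) = 0 := by ext; simp
  rw [modify_zero, ← hl0] at hd'
  have := hd'.comp_hasDerivAt (0 : ℝ) hl
  simp only [Function.comp_def, slice_eq, modify_singleton] at this
  refine this.congr_deriv ?_
  simp [sliceDeriv, coordL, coordConjL]

theorem Represents.dU {f : (ℤ → ℂ) → ℂ} {H : Ham} (h : Represents θ p s a r f H) (j : ℤ) :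
    Represents θ p s a r (dU j f) (seriesD j H) where
  summable := h.summable.seriesD j
  eq_eval u hu := by
    have h1 := h.hasDerivAt hu j 1
    have h2 := h.hasDerivAt hu j Complex.I
    simp only [mul_one] at h1
    rw [TorusProj.dU, h1.deriv, h2.deriv, map_one, Complex.conj_I]
    linear_combination (1 / 2) * (eval (seriesDbar j H) u - eval (seriesD j H) u) * Complex.I_sq

theorem Represents.dUbar {f : (ℤ → ℂ) → ℂ} {H : Ham} (h : Represents θ p s a r f H) (j : ℤ) :
    Represents θ p s a r (dUbar j f) (seriesDbar j H) where
  summable := h.summable.seriesDbar j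
  eq_eval u hu := by
    have h1 := h.hasDerivAt hu j 1
    have h2 := h.hasDerivAt hu j Complex.I
    simp only [mul_one] at h1
    rw [TorusProj.dUbar, h1.deriv, h2.deriv, map_one, Complex.conj_I]
    linear_combination (1 / 2) * (eval (seriesD j H) u - eval (seriesDbar j H) u) * Complex.I_sq

end smooth

/-! ### Order of vanishing on the torus -/

section order
variable {I : ℤ → ℝ} {V : ℤ → ℝ≥0∞} {κ : ℝ}

/-- All Taylor coefficients at `w = I` of order less than `n` of the auxiliary Hamiltonian `𝙷(u, w)`
vanish: each of the series in `w` attached to the classes vanishes to order `n` at `I`. -/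
def VanishesToOrder (I : ℤ → ℝ) (n : ℕ) (H : Ham) : Prop :=
  ∀ d k, Finsupp.degree k < n → taySeq I (cls H d) k = 0

theorem VanishesToOrder.mono {m n : ℕ} (hmn : m ≤ n) {H : Ham} (h : VanishesToOrder I n H) :
    VanishesToOrder I m H := fun d k hk => h d k (hk.trans_le hmn)

theorem vanishesToOrder_iff (h0 : ∀ j, V j ≠ 0) (hT : ∀ j, V j ≠ ∞) (hκ : 0 < κ) (hκ1 : κ < 1)
    (hI : ∀ j, ‖I j‖ₑ ≤ ENNReal.ofReal (κ ^ 2) * V j ^ 2) {H : Ham} (hH : hamSum V H ≠ ∞)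
    (n : ℕ) : VanishesToOrder I n H ↔ ∀ q < n, taylorProj I q H = 0 := by
  refine ⟨fun h q hq => (taylorProj_eq_zero_iff h0 hT hκ hκ1 hI hH q).2
    fun d k hk => h d k (hk ▸ hq), fun h d k hk =>
      (taylorProj_eq_zero_iff h0 hT hκ hκ1 hI hH _).1 (h _ hk) d k rfl⟩

/-- If the sum of the projections of degree less than `n` vanishes, so does each of them. -/
theorem vanishesToOrder_of_sum (h0 : ∀ j, V j ≠ 0) (hT : ∀ j, V j ≠ ∞) (hκ : 0 < κ) (hκ1 : κ < 1)
    (hI : ∀ j, ‖I j‖ₑ ≤ ENNReal.ofReal (κ ^ 2) * V j ^ 2) {H : Ham} (hH : hamSum V H ≠ ∞)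
    {n : ℕ} (h : ∑ q ∈ Finset.range n, taylorProj I q H = 0) : VanishesToOrder I n H := by
  intro d k hk
  have hP : ∀ q, hamSum V (taylorProj I q H) ≠ ∞ := fun q => ne_top_of_le_ne_top
    (ENNReal.mul_ne_top ENNReal.ofReal_ne_top hH) (hamSum_taylorProj_le hκ hκ1 hI q H)
  have h1 : ∑ q ∈ Finset.range n, taySeq I (cls (taylorProj I q H) d) k = 0 := by
    unfold taySeq
    rw [← Summable.tsum_finsetSum fun q _ =>
      (summable_taySeq hκ hκ1 hI (fun j => pow_ne_zero _ (h0 j))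
        (fun j => ENNReal.pow_ne_top (hT j)) (cls_tsum_ne_top h0 (hP q) d) k).of_norm]
    simp_rw [← Finset.sum_mul]
    have h2 : ∀ m, ∑ q ∈ Finset.range n, cls (taylorProj I q H) d m = 0 := fun m => by
      have := congrFun h (splitEquiv (m, d))
      rw [Finset.sum_apply] at this
      exact this
    simp_rw [h2, zero_mul, tsum_zero]
  simp_rw [taySeq_taylorProj h0 hT hκ hκ1 hI hH] at h1
  rwa [Finset.sum_ite_eq, if_pos (Finset.mem_range.2 hk)] at h1

theorem pderiv_shiftMon (I : ℤ → ℝ) (j : ℤ) (m : MIdx) :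
    MvPolynomial.pderiv j (shiftMon I m) =
      (m j : MvPolynomial ℤ ℝ) * shiftMon I (m - Finsupp.single j 1) := by
  induction m using MIdx.induct with
  | h0 => simp [shiftMon]
  | h1 m i ih =>
    have := mon_add_single_deriv (fun j => MvPolynomial.X j + MvPolynomial.C (I j)) m i j
    unfold shiftMon at ih ⊢
    rw [this, mon_add, mon_single, pow_one, MvPolynomial.pderiv_mul, ih]
    by_cases h : j = i
    · subst h; simp; ring
    · rw [if_neg h]
      simp [MvPolynomial.pderiv_X_of_ne (Ne.symm h)]; ring

theorem tayCoeff_add_single (I : ℤ → ℝ) (j : ℤ) (m k : MIdx) :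
    ((m j : ℝ) + 1) * tayCoeff I m k =
      (k j + 1) * tayCoeff I (m + Finsupp.single j 1) (k + Finsupp.single j 1) := by
  have h := congrArg (MvPolynomial.coeff k) (pderiv_shiftMon I j (m + Finsupp.single j 1))
  rw [MvPolynomial.coeff_pderiv, add_tsub_cancel_right, ← map_natCast MvPolynomial.C,
    MvPolynomial.coeff_C_mul] at h
  simp only [Finsupp.add_apply, Finsupp.single_eq_same, Nat.cast_add, Nat.cast_one] at h
  unfold tayCoeff
  linarith

/-- The action of the Euler operator `w_j ∂_{w_j}` on Taylor coefficients. -/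
theorem natCast_mul_tayCoeff (I : ℤ → ℝ) (j : ℤ) (m k : MIdx) :
    (m j : ℝ) * tayCoeff I m k =
      I j * (k j + 1) * tayCoeff I m (k + Finsupp.single j 1) + k j * tayCoeff I m k := by
  rcases Nat.eq_zero_or_pos (m j) with hm | hm
  · have h1 : ¬ k + Finsupp.single j 1 ≤ m := fun h => by
      have := h j
      simp [hm] at this
    rw [hm, tayCoeff_eq_zero_of_not_le h1]
    by_cases hk : k j = 0
    · simp [hk]
    · rw [tayCoeff_eq_zero_of_not_le (k := k) fun h => hk (Nat.le_zero.1 (hm ▸ h j))]; simp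
  · obtain ⟨m', rfl⟩ : ∃ m', m = m' + Finsupp.single j 1 :=
      ⟨m - Finsupp.single j 1, (tsub_add_cancel_of_le (by rwa [Finsupp.single_le_iff])).symm⟩
    have e : ∀ k, tayCoeff I (m' + Finsupp.single j 1) k =
        (if j ∈ k.support then tayCoeff I m' (k - Finsupp.single j 1) else 0) +
          I j * tayCoeff I m' k := by
      intro k
      unfold tayCoeff
      rw [shiftMon_add, mul_comm, shiftMon, mon_single, pow_one, add_mul,
        MvPolynomial.coeff_add, MvPolynomial.coeff_X_mul', MvPolynomial.coeff_C_mul]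
    have h1 := tayCoeff_add_single I j m' k
    have h2 : (m' j + 1 : ℝ) * (if j ∈ k.support then tayCoeff I m' (k - Finsupp.single j 1) else 0)
        = k j * tayCoeff I (m' + Finsupp.single j 1) k := by
      split_ifs with hk
      · have hk' : k - Finsupp.single j 1 + Finsupp.single j 1 = k := by
          refine tsub_add_cancel_of_le ?_
          rw [Finsupp.single_le_iff]
          exact Nat.one_le_iff_ne_zero.2 (Finsupp.mem_support_iff.1 hk)
        have h3 := tayCoeff_add_single I j m' (k - Finsupp.single j 1)
        have h4 : (k j : ℝ) = ((k - Finsupp.single j 1 : MIdx) j : ℕ) + 1 := by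
          conv_lhs => rw [← hk']
          simp
        rw [h3, hk', h4]
      · rw [Finsupp.notMem_support_iff.1 hk]; simp
    have h3 := e k
    rw [Finsupp.add_apply, Finsupp.single_eq_same]
    push_cast
    linear_combination (m' j + 1 : ℝ) * h3 + h2 + I j * h1

theorem tsum_midx_add_single {M : Type*} [AddCommMonoid M] [TopologicalSpace M]
    (j : ℤ) {f : MIdx → M} (hf : ∀ m : MIdx, m j = 0 → f m = 0) :
    ∑' m : MIdx, f (m + Finsupp.single j 1) = ∑' m, f m := by
  refine Function.Injective.tsum_eq (add_left_injective (Finsupp.single j 1)) fun m hm => ?_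
  refine ⟨m - Finsupp.single j 1, tsub_add_cancel_of_le ?_⟩
  rw [Finsupp.single_le_iff]
  exact Nat.one_le_iff_ne_zero.2 fun h => hm (hf m h)

/-- Differentiation lowers the order of vanishing by at most one. -/
theorem VanishesToOrder.seriesDbar (h0 : ∀ j, V j ≠ 0) (hT : ∀ j, V j ≠ ∞) (hκ : 0 < κ)
    (hκ1 : κ < 1) (hI : ∀ j, ‖I j‖ₑ ≤ ENNReal.ofReal (κ ^ 2) * V j ^ 2) {H : Ham}
    (hH : hamSum V H ≠ ∞) {n : ℕ} (h : VanishesToOrder I (n + 1) H) (j : ℤ) :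
    VanishesToOrder I n (seriesDbar j H) := by
  have hsum : ∀ d k, Summable fun m => cls H d m * (tayCoeff I m k : ℝ) := fun d k =>
    (summable_taySeq hκ hκ1 hI (fun j => pow_ne_zero _ (h0 j))
      (fun j => ENNReal.pow_ne_top (hT j)) (cls_tsum_ne_top h0 hH d) k).of_norm
  rintro ⟨⟨a, b⟩, hd⟩ k hk
  have hd' : ∀ i, min (a i) (b i) = 0 := fun i => DFunLike.congr_fun hd i
  have hk1 : Finsupp.degree (k + Finsupp.single j 1) < n + 1 := by
    rw [map_add, Finsupp.degree_single]; omega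
  by_cases ha : a j = 0
  · -- the class `(a, b)` of `∂H/∂ū_j` comes from the class `(a, b + e_j)` of `H`
    let d' : Disj := ⟨(a, b + Finsupp.single j 1), by
      ext i
      have := hd' i
      by_cases hij : i = j
      · subst hij; simp [ha]
      · simpa [Finsupp.single_eq_of_ne hij] using this⟩
    have key : ∀ m, cls (TorusProj.seriesDbar j H) ⟨(a, b), hd⟩ m * (tayCoeff I m k : ℝ) =
        (I j * (k j + 1)) * (cls H d' m * (tayCoeff I m (k + Finsupp.single j 1) : ℝ)) +
        (k j + b j + 1) * (cls H d' m * (tayCoeff I m k : ℝ)) := by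
      intro m
      have h1 : cls (TorusProj.seriesDbar j H) ⟨(a, b), hd⟩ m =
          ((m j : ℂ) + b j + 1) * cls H d' m := by
        change (((m + b : MIdx) j : ℂ) + 1) * H (m + a, m + b + Finsupp.single j 1) =
          ((m j : ℂ) + b j + 1) * H (m + a, m + (b + Finsupp.single j 1))
        rw [Finsupp.add_apply, Nat.cast_add, add_assoc m]
      have h2 := congrArg (fun x : ℝ => (x : ℂ)) (natCast_mul_tayCoeff I j m k)
      push_cast at h2
      rw [h1]
      linear_combination (cls H d' m) * h2
    rw [taySeq]
    simp_rw [key]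
    rw [((hsum _ _).mul_left _).tsum_add ((hsum _ _).mul_left _), tsum_mul_left, tsum_mul_left]
    have e1 : ∑' m, cls H d' m * (tayCoeff I m (k + Finsupp.single j 1) : ℝ) = 0 := h d' _ hk1
    have e2 : ∑' m, cls H d' m * (tayCoeff I m k : ℝ) = 0 := h d' _ (by omega)
    rw [e1, e2]; simp
  · -- the class `(a, b)` of `∂H/∂ū_j` comes from the class `(a - e_j, b)` of `H`
    have hb : b j = 0 := by have := hd' j; omega
    let d' : Disj := ⟨(a - Finsupp.single j 1, b), by
      ext i
      have := hd' i
      by_cases hij : i = j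
      · subst hij; simp [hb]
      · simpa [Finsupp.single_eq_of_ne hij] using this⟩
    have ha' : Finsupp.single j 1 + (a - Finsupp.single j 1) = a := by
      refine add_tsub_cancel_of_le ?_
      rw [Finsupp.single_le_iff]; exact Nat.one_le_iff_ne_zero.2 ha
    have key : ∀ m, cls (TorusProj.seriesDbar j H) ⟨(a, b), hd⟩ m * (tayCoeff I m k : ℝ) =
        (k j + 1) * (cls H d' (m + Finsupp.single j 1) *
          (tayCoeff I (m + Finsupp.single j 1) (k + Finsupp.single j 1) : ℝ)) := by
      intro m
      have h1 : cls (TorusProj.seriesDbar j H) ⟨(a, b), hd⟩ m =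
          ((m j : ℂ) + 1) * cls H d' (m + Finsupp.single j 1) := by
        change (((m + b : MIdx) j : ℂ) + 1) * H (m + a, m + b + Finsupp.single j 1) =
          ((m j : ℂ) + 1) * H (m + Finsupp.single j 1 + (a - Finsupp.single j 1),
            m + Finsupp.single j 1 + b)
        rw [add_assoc m _ (a - _), ha', Finsupp.add_apply, hb, add_zero, add_right_comm]
      have h2 := congrArg (fun x : ℝ => (x : ℂ)) (tayCoeff_add_single I j m k)
      push_cast at h2
      rw [h1]
      linear_combination (cls H d' (m + Finsupp.single j 1)) * h2
    rw [taySeq]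
    simp_rw [key]
    rw [tsum_mul_left, tsum_midx_add_single j
      (f := fun m => cls H d' m * (tayCoeff I m (k + Finsupp.single j 1) : ℝ))]
    · have e1 : ∑' m, cls H d' m * (tayCoeff I m (k + Finsupp.single j 1) : ℝ) = 0 := h d' _ hk1
      rw [e1, mul_zero]
    · intro m hm
      rw [tayCoeff_eq_zero_of_not_le, Complex.ofReal_zero, mul_zero]
      intro hle
      have := hle j
      simp [hm] at this

theorem VanishesToOrder.swapHam {n : ℕ} {H : Ham} (h : VanishesToOrder I n H) :
    VanishesToOrder I n (swapHam H) := fun d k hk => h d.swap k hk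

theorem VanishesToOrder.seriesD (h0 : ∀ j, V j ≠ 0) (hT : ∀ j, V j ≠ ∞) (hκ : 0 < κ)
    (hκ1 : κ < 1) (hI : ∀ j, ‖I j‖ₑ ≤ ENNReal.ofReal (κ ^ 2) * V j ^ 2) {H : Ham}
    (hH : hamSum V H ≠ ∞) {n : ℕ} (h : VanishesToOrder I (n + 1) H) (j : ℤ) :
    VanishesToOrder I n (seriesD j H) :=
  (h.swapHam.seriesDbar h0 hT hκ hκ1 hI (by rwa [hamSum_swapHam]) j).swapHam

theorem tayCoeff_zero (I : ℤ → ℝ) (m : MIdx) : tayCoeff I m 0 = mon I m := by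
  have := map_mon (MvPolynomial.constantCoeff (R := ℝ) (σ := ℤ))
    (fun j => MvPolynomial.X j + MvPolynomial.C (I j)) m
  simpa [tayCoeff, shiftMon, MvPolynomial.constantCoeff_eq] using this

theorem VanishesToOrder.eval_eq_zero {H : Ham} (h : VanishesToOrder I 1 H)
    {u : ℤ → ℂ} (hu : ∀ j, ‖u j‖ₑ ≤ V j) (hH : hamSum V H ≠ ∞) (huI : ∀ j, ‖u j‖ ^ 2 = I j) :
    eval H u = 0 := by
  rw [eval, tsum_split_complex (summable_term hu hH)]
  have : ∀ d, ∑' m, term H u (splitEquiv (m, d)) = 0 := by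
    intro d
    simp_rw [term_split, tsum_mul_right]
    have h1 := h d 0 (by simp)
    have h2 : ∀ m, ((tayCoeff I m 0 : ℝ) : ℂ) = mon (actions u) m := by
      intro m
      rw [tayCoeff_zero]
      have := map_mon Complex.ofRealHom I m
      simp only [Complex.ofRealHom_eq_coe] at this
      rw [this]
      congr 1; ext j; simp [actions, huI]
    simp_rw [taySeq, h2] at h1
    rw [h1, zero_mul]
  simp [this]

end order

section torus
variable {θ p s a r : ℝ} {I : ℤ → ℝ}

/-- If the torus lies in the open ball of radius `r`, it lies in the interior of a smaller ball,
which leaves room for Cauchy estimates. -/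
theorem exists_interior_radius (hI : ∀ j, 0 ≤ I j)
    (h : seqNorm θ p s a (fun j => ((Real.sqrt (I j) : ℝ) : ℂ)) < ENNReal.ofReal r) :
    ∃ ρ κ, 0 < ρ ∧ ρ < r ∧ 0 < κ ∧ κ < 1 ∧
      ∀ j, ‖I j‖ₑ ≤ ENNReal.ofReal (κ ^ 2) * rad θ p s a ρ j ^ 2 := by
  obtain ⟨ρ₀, h0, h1, hu⟩ := exists_of_seqNorm_lt h
  obtain ⟨ρ, h2, h3⟩ := exists_between h1
  have hρ := h0.trans h2
  refine ⟨ρ, ρ₀ / ρ, hρ, h3, by positivity, (div_lt_one hρ).2 h2,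
    enorm_action_le hρ (by positivity) hI ?_⟩
  rw [div_mul_cancel₀ _ hρ.ne']
  exact (seqNorm_le_iff h0.le _).2 hu

/-- A function given on the ball by an expansion that vanishes to order `n` on the torus. -/
def RepresentsOrder (θ p s a r : ℝ) (I : ℤ → ℝ) (n : ℕ) (f : (ℤ → ℂ) → ℂ) : Prop :=
  ∃ H, Represents θ p s a r f H ∧ VanishesToOrder I n H

theorem RepresentsOrder.dU (hI : ∀ j, 0 ≤ I j)
    (h : seqNorm θ p s a (fun j => ((Real.sqrt (I j) : ℝ) : ℂ)) < ENNReal.ofReal r) {n : ℕ}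
    {f : (ℤ → ℂ) → ℂ} (hf : RepresentsOrder θ p s a r I (n + 1) f) (j : ℤ) :
    RepresentsOrder θ p s a r I n (dU j f) := by
  obtain ⟨ρ, κ, h1, h2, h3, h4, h5⟩ := exists_interior_radius hI h
  obtain ⟨H, hH, hv⟩ := hf
  exact ⟨_, hH.dU j, hv.seriesD (rad_ne_zero h1) (rad_ne_top ρ) h3 h4 h5
    (hH.summable ρ h1 h2) j⟩

theorem RepresentsOrder.dUbar (hI : ∀ j, 0 ≤ I j)
    (h : seqNorm θ p s a (fun j => ((Real.sqrt (I j) : ℝ) : ℂ)) < ENNReal.ofReal r) {n : ℕ}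
    {f : (ℤ → ℂ) → ℂ} (hf : RepresentsOrder θ p s a r I (n + 1) f) (j : ℤ) :
    RepresentsOrder θ p s a r I n (dUbar j f) := by
  obtain ⟨ρ, κ, h1, h2, h3, h4, h5⟩ := exists_interior_radius hI h
  obtain ⟨H, hH, hv⟩ := hf
  exact ⟨_, hH.dUbar j, hv.seriesDbar (rad_ne_zero h1) (rad_ne_top ρ) h3 h4 h5
    (hH.summable ρ h1 h2) j⟩

theorem foldr_iterate_lowers {X : Type*} {P : ℕ → X → Prop} {D : ℤ → X → X}
    (hD : ∀ n x j, P (n + 1) x → P n (D j x)) (α : MIdx) (n : ℕ) (x : X)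
    (hx : P (n + α.len) x) : P n (α.support.sort.foldr (fun j g => (D j)^[α j] g) x) := by
  have hit : ∀ j k n x, P (n + k) x → P n ((D j)^[k] x) := by
    intro j k
    induction k with
    | zero => intro n x h; exact h
    | succ k ih =>
      intro n x h
      rw [Function.iterate_succ_apply]
      exact ih n _ (hD _ _ j h)
  have hfold : ∀ (L : List ℤ) n, P (n + (L.map α).sum) x →
      P n (L.foldr (fun j g => (D j)^[α j] g) x) := by
    intro L
    induction L with
    | nil => intro n h; simpa using h
    | cons j L ih =>
      intro n h
      refine hit j (α j) n _ (ih _ ?_)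
      rw [List.map_cons, List.sum_cons] at h
      rwa [add_assoc]
  refine hfold _ n ?_
  have : ((α.support.sort).map α).sum = α.len := by
    rw [← Multiset.sum_coe, ← Multiset.map_coe, Finset.sort_eq]; rfl
  rwa [this]

/-- Each of the at most `Q` derivatives costs one order, which leaves a series vanishing on the
torus. -/
theorem dUs_dUbars_eq_zero (hI : ∀ j, 0 ≤ I j)
    (h : seqNorm θ p s a (fun j => ((Real.sqrt (I j) : ℝ) : ℂ)) < ENNReal.ofReal r) {Q : ℕ}
    {H : Ham} (hH : OpenSummable θ p s a r H) (hv : VanishesToOrder I (Q + 1) H) {α β : MIdx}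
    (hαβ : α.len + β.len ≤ Q) {u : ℤ → ℂ} (hu : u ∈ torus θ p s a I) :
    dUs α (dUbars β (eval H)) u = 0 := by
  have h1 : RepresentsOrder θ p s a r I (1 + α.len + β.len) (eval H) :=
    ⟨H, ⟨hH, fun _ _ => rfl⟩, hv.mono (by omega)⟩
  have h2 := foldr_iterate_lowers (P := RepresentsOrder θ p s a r I) (D := dUbar)
    (fun n f j hf => hf.dUbar hI h j) β _ _ h1
  obtain ⟨K, hK, hKv⟩ := foldr_iterate_lowers (P := RepresentsOrder θ p s a r I) (D := dU)
    (fun n f j hf => hf.dU hI h j) α _ _ h2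
  have hun : seqNorm θ p s a u < ENNReal.ofReal r := by
    refine lt_of_eq_of_lt ?_ h
    unfold seqNorm
    refine iSup_congr fun j => ?_
    change _ = ENNReal.ofReal (‖((Real.sqrt (I j) : ℝ) : ℂ)‖ * _)
    rw [← hu.2 j, Real.sqrt_sq (norm_nonneg _), Complex.norm_real, norm_norm]
  obtain ⟨ρ, hρ, hρr, huρ⟩ := exists_of_seqNorm_lt hun
  exact (hK.eq_eval u hun).trans (hKv.eval_eq_zero huρ (hK.summable ρ hρ hρr) hu.2)

end torus

/-! ### Coefficients of the Poisson bracket -/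

/-- Indices of the elementary contributions to a Poisson bracket: a mode and a monomial of each
factor. -/
abbrev BrIdx := ℤ × (MIdx × MIdx) × (MIdx × MIdx)

/-- The monomial `u^{α + α' - e_j} ū^{β + β' - e_j}` to which `(j, (α, β), (α', β'))`
contributes. The truncated subtraction is a true one whenever the contribution is nonzero. -/
def brTarget (i : BrIdx) : MIdx × MIdx :=
  (i.2.1.1 + i.2.2.1 - Finsupp.single i.1 1, i.2.1.2 + i.2.2.2 - Finsupp.single i.1 1)

/-- The contribution `i (β_j α'_j - α_j β'_j) F_{α,β} G_{α',β'}` to the bracket `{F, G}`. -/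
def brTerm (F G : Ham) (i : BrIdx) : ℂ :=
  Complex.I * ((i.2.1.2 i.1 : ℂ) * i.2.2.1 i.1 - i.2.1.1 i.1 * i.2.2.2 i.1) * F i.2.1 * G i.2.2

/-- The coefficients of the Poisson bracket `{F, G}`. -/
def brHam (F G : Ham) : Ham := fun z => ∑' i, brTerm F G i * if brTarget i = z then 1 else 0

/-- The absolute value of the combinatorial factor is at most `β_j α'_j + α_j β'_j`. -/
def brWeight (i : BrIdx) : ℕ := i.2.1.2 i.1 * i.2.2.1 i.1 + i.2.1.1 i.1 * i.2.2.2 i.1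

theorem enorm_brTerm_le (F G : Ham) (i : BrIdx) :
    ‖brTerm F G i‖ₑ ≤ brWeight i * (‖F i.2.1‖ₑ * ‖G i.2.2‖ₑ) := by
  have h : ‖(i.2.1.2 i.1 : ℂ) * i.2.2.1 i.1 - i.2.1.1 i.1 * i.2.2.2 i.1‖ₑ ≤ brWeight i := by
    refine (enorm_sub_le).trans ?_
    rw [enorm_mul, enorm_mul, enorm_natCast', enorm_natCast', enorm_natCast', enorm_natCast',
      brWeight]
    push_cast; rfl
  have hI : ‖Complex.I‖ₑ = 1 := by rw [← ofReal_norm]; simp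
  rw [brTerm, enorm_mul, enorm_mul, enorm_mul, hI, one_mul, mul_assoc]
  gcongr

theorem brTerm_eq_zero {F G : Ham} {i : BrIdx} (h : brWeight i = 0) : brTerm F G i = 0 := by
  have := enorm_brTerm_le F G i
  rw [h] at this
  simpa using this

theorem brTarget_fst {i : BrIdx} (h : brWeight i ≠ 0) :
    (brTarget i).1 + Finsupp.single i.1 1 = i.2.1.1 + i.2.2.1 := by
  refine tsub_add_cancel_of_le ?_
  rw [Finsupp.single_le_iff, Finsupp.add_apply]
  by_contra hlt
  apply h
  rw [brWeight, show i.2.1.1 i.1 = 0 by omega, show i.2.2.1 i.1 = 0 by omega]; simp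

theorem brTarget_snd {i : BrIdx} (h : brWeight i ≠ 0) :
    (brTarget i).2 + Finsupp.single i.1 1 = i.2.1.2 + i.2.2.2 := by
  refine tsub_add_cancel_of_le ?_
  rw [Finsupp.single_le_iff, Finsupp.add_apply]
  by_contra hlt
  apply h
  rw [brWeight, show i.2.1.2 i.1 = 0 by omega, show i.2.2.2 i.1 = 0 by omega]; simp

theorem mon_brTarget {R : Type*} [CommSemiring R] (V : ℤ → R) {i : BrIdx} (h : brWeight i ≠ 0) :
    mon V ((brTarget i).1 + (brTarget i).2) * V i.1 ^ 2 =
      mon V (i.2.1.1 + i.2.1.2) * mon V (i.2.2.1 + i.2.2.2) := by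
  have h1 := congrArg (mon V) (brTarget_fst h)
  have h2 := congrArg (mon V) (brTarget_snd h)
  simp only [mon_add, mon_single, pow_one] at h1 h2 ⊢
  calc _ = (mon V (brTarget i).1 * V i.1) * (mon V (brTarget i).2 * V i.1) := by ring
    _ = _ := by rw [h1, h2]; ring

/-- Summation against the coefficients of the bracket. -/
theorem tsum_brHam_mul {F G : Ham} {T : MIdx × MIdx → ℂ}
    (h : ∑' i, ‖brTerm F G i‖ₑ * ‖T (brTarget i)‖ₑ ≠ ∞) :
    ∑' z, brHam F G z * T z = ∑' i, brTerm F G i * T (brTarget i) := by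
  unfold brHam
  rw [tsum_mul_matrix_comm h (K := 1) ENNReal.one_ne_top]
  · refine tsum_congr fun i => ?_
    congr 1
    rw [tsum_eq_single (brTarget i)]
    · simp
    · intro z hz; simp [hz.symm]
  · intro i
    rw [tsum_eq_single (brTarget i)]
    · simp
    · intro z hz; simp [hz.symm]

theorem tsum_enorm_brHam_le (F G : Ham) (b : MIdx × MIdx → ℝ≥0∞) :
    ∑' z, ‖brHam F G z‖ₑ * b z ≤ ∑' i, ‖brTerm F G i‖ₑ * b (brTarget i) := by
  refine (tsum_enorm_tsum_mul_le _ _ _).trans (ENNReal.tsum_le_tsum fun i => ?_)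
  gcongr
  rw [tsum_eq_single (brTarget i)]
  · simp
  · intro z hz; simp [hz.symm]

theorem tsum_brIdx (f : BrIdx → ℝ≥0∞) : ∑' i, f i = ∑' (j : ℤ) (x) (y), f (j, x, y) := by
  rw [ENNReal.tsum_prod']
  exact tsum_congr fun j => ENNReal.tsum_prod'

/-- By reality, the derivatives in `u_j` and in `ū_j` have majorants of the same size. -/
theorem fieldSum_swapHam {V : ℤ → ℝ≥0∞} {H : Ham} (h : ∀ α β, H (α, β) = conj (H (β, α))) (j : ℤ) :
    ∑' x : MIdx × MIdx, ‖H x‖ₑ * (x.1 j * mon V (x.1 + x.2)) = fieldSum V H j := by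
  unfold fieldSum
  rw [← (Equiv.prodComm _ _).tsum_eq]
  refine tsum_congr fun x => ?_
  have : ‖H x.swap‖ₑ = ‖H x‖ₑ := by
    have e : H x = conj (H x.swap) := h x.1 x.2
    rw [← ofReal_norm, ← ofReal_norm, e, RCLike.norm_conj]
  simp only [Equiv.prodComm_apply, this, Prod.fst_swap, Prod.snd_swap, add_comm]

theorem fieldSum_le {V : ℤ → ℝ≥0∞} (h0 : ∀ j, V j ≠ 0) (hT : ∀ j, V j ≠ ∞) (H : Ham) (j : ℤ) :
    fieldSum V H j ≤ fieldNorm V H * V j ^ 2 := by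
  rw [← ENNReal.div_le_iff (pow_ne_zero _ (h0 j)) (ENNReal.pow_ne_top (hT j))]
  exact le_iSup (fun j => fieldSum V H j / V j ^ 2) j

/-- Summation over the second factor of the contributions to a bracket. -/
theorem tsum_brWeight_le {V : ℤ → ℝ≥0∞} (h0 : ∀ j, V j ≠ 0) (hT : ∀ j, V j ≠ ∞) {G : Ham}
    (hG : ∀ α β, G (α, β) = conj (G (β, α))) (j : ℤ) (x : MIdx × MIdx) :
    ∑' y : MIdx × MIdx, brWeight (j, x, y) * (‖G y‖ₑ * mon V (y.1 + y.2)) ≤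
      (x.1 j + x.2 j) * (fieldNorm V G * V j ^ 2) := by
  calc _ = x.2 j * (∑' y : MIdx × MIdx, ‖G y‖ₑ * (y.1 j * mon V (y.1 + y.2))) +
        x.1 j * fieldSum V G j := by
        rw [fieldSum, ← ENNReal.tsum_mul_left, ← ENNReal.tsum_mul_left, ← ENNReal.tsum_add]
        refine tsum_congr fun y => ?_
        simp only [brWeight]
        push_cast; ring
    _ ≤ x.2 j * (fieldNorm V G * V j ^ 2) + x.1 j * (fieldNorm V G * V j ^ 2) := by
        rw [fieldSum_swapHam hG]
        gcongr <;> exact fieldSum_le h0 hT G j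
    _ = _ := by ring

theorem ennreal_eq_mul_inv_of_mul_eq {a b V : ℝ≥0∞} (h0 : V ≠ 0) (hT : V ≠ ∞) (h : a * V = b) :
    a = b * V⁻¹ := by
  rw [← h, mul_assoc, ENNReal.mul_inv_cancel h0 hT, mul_one]

/-- The contributions to a bracket are absolutely summable on a common ball: the bracket is a sum of
products of components of the two vector fields, and the weights are square summable. -/
theorem tsum_brTerm_ne_top {V : ℤ → ℝ≥0∞} (h0 : ∀ j, V j ≠ 0) (hT : ∀ j, V j ≠ ∞)
    (hV : ∑' j, V j ^ 2 ≠ ∞) {F G : Ham} (hF : ∀ α β, F (α, β) = conj (F (β, α)))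
    (hG : ∀ α β, G (α, β) = conj (G (β, α))) (hFN : fieldNorm V F ≠ ∞)
    (hGN : fieldNorm V G ≠ ∞) :
    ∑' i, ‖brTerm F G i‖ₑ * mon V ((brTarget i).1 + (brTarget i).2) ≠ ∞ := by
  have hj : ∀ j, ∑' (x) (y), ‖brTerm F G (j, x, y)‖ₑ *
      mon V ((brTarget (j, x, y)).1 + (brTarget (j, x, y)).2) ≤
      2 * (fieldNorm V F * fieldNorm V G) * V j ^ 2 := by
    intro j
    have hV0 : V j ^ 2 ≠ 0 := pow_ne_zero _ (h0 j)
    have hVT : V j ^ 2 ≠ ∞ := ENNReal.pow_ne_top (hT j)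
    calc _ ≤ ∑' (x : MIdx × MIdx) (y : MIdx × MIdx), (‖F x‖ₑ * mon V (x.1 + x.2) * (V j ^ 2)⁻¹) *
          (brWeight (j, x, y) * (‖G y‖ₑ * mon V (y.1 + y.2))) := by
          refine ENNReal.tsum_le_tsum fun x => ENNReal.tsum_le_tsum fun y => ?_
          by_cases hw : brWeight (j, x, y) = 0
          · simp [brTerm_eq_zero hw]
          · rw [ennreal_eq_mul_inv_of_mul_eq hV0 hVT (mon_brTarget V hw)]
            calc _ ≤ brWeight (j, x, y) * (‖F x‖ₑ * ‖G y‖ₑ) *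
                  (mon V (x.1 + x.2) * mon V (y.1 + y.2) * (V j ^ 2)⁻¹) := by
                  gcongr; exact enorm_brTerm_le F G _
              _ = _ := by ring
      _ ≤ ∑' x : MIdx × MIdx, (‖F x‖ₑ * mon V (x.1 + x.2) * (V j ^ 2)⁻¹) *
          ((x.1 j + x.2 j) * (fieldNorm V G * V j ^ 2)) := by
          refine ENNReal.tsum_le_tsum fun x => ?_
          rw [ENNReal.tsum_mul_left]
          gcongr
          exact tsum_brWeight_le h0 hT hG j x
      _ = fieldNorm V G * (∑' x : MIdx × MIdx, ‖F x‖ₑ * (x.1 j * mon V (x.1 + x.2)) +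
            fieldSum V F j) := by
          rw [fieldSum, ← ENNReal.tsum_add, ← ENNReal.tsum_mul_left]
          refine tsum_congr fun x => ?_
          calc _ = ‖F x‖ₑ * mon V (x.1 + x.2) * (x.1 j + x.2 j) * fieldNorm V G *
                ((V j ^ 2)⁻¹ * V j ^ 2) := by ring
            _ = _ := by rw [ENNReal.inv_mul_cancel hV0 hVT]; ring
      _ ≤ fieldNorm V G * (fieldNorm V F * V j ^ 2 + fieldNorm V F * V j ^ 2) := by
          rw [fieldSum_swapHam hF]
          gcongr <;> exact fieldSum_le h0 hT F j
      _ = _ := by ring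
  rw [tsum_brIdx]
  refine ne_top_of_le_ne_top ?_ (ENNReal.tsum_le_tsum hj)
  rw [ENNReal.tsum_mul_left]
  exact ENNReal.mul_ne_top (ENNReal.mul_ne_top (by simp) (ENNReal.mul_ne_top hFN hGN)) hV

/-! ### The norm of the Poisson bracket -/

theorem expo_brTarget_le {η : ℝ} (hη : 0 ≤ η) {i : BrIdx} (h : brWeight i ≠ 0) :
    expo η (brTarget i) ≤ expo η i.2.1 * expo η i.2.2 := by
  unfold expo
  rw [← ENNReal.ofReal_mul (Real.exp_pos _).le, ← Real.exp_add, ← mul_add]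
  refine ENNReal.ofReal_le_ofReal (Real.exp_le_exp.2 (mul_le_mul_of_nonneg_left ?_ hη))
  have h1 := congrArg MIdx.mom (brTarget_fst h)
  have h2 := congrArg MIdx.mom (brTarget_snd h)
  simp only [MIdx.mom_add] at h1 h2
  have h3 : (brTarget i).1.mom - (brTarget i).2.mom =
      (i.2.1.1.mom - i.2.1.2.mom) + (i.2.2.1.mom - i.2.2.2.mom) := by linarith
  rw [h3]
  push_cast
  exact abs_add_le _ _

theorem majorant_conj (η : ℝ) {H : Ham} (h : ∀ α β, H (α, β) = conj (H (β, α))) (α β : MIdx) :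
    majorant η H (α, β) = conj (majorant η H (β, α)) := by
  simp only [majorant, Complex.conj_ofReal]
  rw [h α β, RCLike.norm_conj, ← abs_neg]
  push_cast; rw [neg_sub]

theorem tsum_natCast_midx (α : MIdx) : ∑' j, (α j : ℝ≥0∞) = (Finsupp.degree α : ℕ) := by
  rw [tsum_eq_sum (s := α.support), Finsupp.degree_apply]
  · push_cast; rfl
  · intro j hj; simp [Finsupp.notMem_support_iff.1 hj]

/-- The part of the vector field of the bracket in which the outer derivative falls on the first
factor: the derivative of the field of `F` in the direction of the field of `G`, controlled on a
smaller ball by a Cauchy estimate. -/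
theorem tsum_bracket_part_le {V : ℤ → ℝ≥0∞} (h0 : ∀ j, V j ≠ 0) (hT : ∀ j, V j ≠ ∞) {c C : ℝ}
    (hC : ∀ (V : ℤ → ℝ≥0∞) (α : MIdx), ((Finsupp.degree α : ℕ) : ℝ≥0∞) *
      mon (fun j => ENNReal.ofReal c * V j) α ≤ ENNReal.ofReal C * mon V α) {F G : Ham}
    (hG : ∀ α β, G (α, β) = conj (G (β, α))) (i : ℤ) :
    ∑' (j : ℤ) (x : MIdx × MIdx) (y : MIdx × MIdx), brWeight (j, x, y) * (‖F x‖ₑ * ‖G y‖ₑ) *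
      (x.2 i * (mon (fun j => ENNReal.ofReal c * V j) (x.1 + x.2) * mon V (y.1 + y.2) *
        (V j ^ 2)⁻¹)) ≤ ENNReal.ofReal C * fieldNorm V G * fieldSum V F i := by
  set cV : ℤ → ℝ≥0∞ := fun j => ENNReal.ofReal c * V j
  calc _ = ∑' (j : ℤ) (x : MIdx × MIdx), (‖F x‖ₑ * x.2 i * mon cV (x.1 + x.2) * (V j ^ 2)⁻¹) *
        ∑' y : MIdx × MIdx, brWeight (j, x, y) * (‖G y‖ₑ * mon V (y.1 + y.2)) := by
        simp_rw [← ENNReal.tsum_mul_left]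
        refine tsum_congr fun j => tsum_congr fun x => tsum_congr fun y => ?_
        ring
    _ ≤ ∑' (j : ℤ) (x : MIdx × MIdx), (‖F x‖ₑ * x.2 i * mon cV (x.1 + x.2) * (V j ^ 2)⁻¹) *
        ((x.1 j + x.2 j) * (fieldNorm V G * V j ^ 2)) := by
        gcongr with j x
        exact tsum_brWeight_le h0 hT hG j x
    _ = fieldNorm V G * ∑' x : MIdx × MIdx, ‖F x‖ₑ * (x.2 i *
          (((Finsupp.degree (x.1 + x.2) : ℕ) : ℝ≥0∞) * mon cV (x.1 + x.2))) := by
        rw [ENNReal.tsum_comm, ← ENNReal.tsum_mul_left]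
        refine tsum_congr fun x => ?_
        rw [map_add, Nat.cast_add, ← tsum_natCast_midx, ← tsum_natCast_midx, ← ENNReal.tsum_add]
        calc _ = ∑' j, (x.1 j + x.2 j : ℝ≥0∞) *
              (fieldNorm V G * (‖F x‖ₑ * (x.2 i * mon cV (x.1 + x.2)))) := by
              refine tsum_congr fun j => ?_
              calc _ = (x.1 j + x.2 j : ℝ≥0∞) *
                    (fieldNorm V G * (‖F x‖ₑ * (x.2 i * mon cV (x.1 + x.2)))) *
                    ((V j ^ 2)⁻¹ * V j ^ 2) := by ring
                _ = _ := by
                    rw [ENNReal.inv_mul_cancel (pow_ne_zero _ (h0 j))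
                      (ENNReal.pow_ne_top (hT j)), mul_one]
          _ = _ := by rw [ENNReal.tsum_mul_right]; ring
    _ ≤ fieldNorm V G * ∑' x : MIdx × MIdx, ‖F x‖ₑ * (x.2 i *
          (ENNReal.ofReal C * mon V (x.1 + x.2))) := by
        exact mul_le_mul_right (ENNReal.tsum_le_tsum fun x =>
          mul_le_mul_right (mul_le_mul_right (hC V _) _) _) _
    _ = fieldNorm V G * (ENNReal.ofReal C * fieldSum V F i) := by
        rw [fieldSum, ← ENNReal.tsum_mul_left (a := ENNReal.ofReal C)]
        congr 1
        refine tsum_congr fun x => ?_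
        ring
    _ = _ := by ring

theorem brWeight_swap (j : ℤ) (x y : MIdx × MIdx) : brWeight (j, x, y) = brWeight (j, y, x) := by
  simp only [brWeight]; ring

/-- The norm of a bracket on a smaller ball, with a constant independent of the factors. -/
theorem fieldNorm_brHam_le {V : ℤ → ℝ≥0∞} (h0 : ∀ j, V j ≠ 0) (hT : ∀ j, V j ≠ ∞) {η c : ℝ}
    (hη : 0 ≤ η) (hc : 0 < c) (hc1 : c < 1) : ∃ C : ℝ, ∀ F G : Ham,
    (∀ α β, F (α, β) = conj (F (β, α))) → (∀ α β, G (α, β) = conj (G (β, α))) →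
    fieldNorm (fun j => ENNReal.ofReal c * V j) (majorant η (brHam F G)) ≤
      ENNReal.ofReal C * (fieldNorm V (majorant η F) * fieldNorm V (majorant η G)) := by
  obtain ⟨C, hC0, hC⟩ := exists_degree_mul_mon_le hc.le hc1
  refine ⟨2 * C * (c ^ 2)⁻¹ * (c ^ 2)⁻¹, fun F G hF hG => iSup_le fun i => ?_⟩
  set cV : ℤ → ℝ≥0∞ := fun j => ENNReal.ofReal c * V j with hcV
  set f := majorant η F
  set g := majorant η G
  have hc0 : ENNReal.ofReal c ≠ 0 := by simpa using hc
  have hcT : ENNReal.ofReal c ≠ ∞ := ENNReal.ofReal_ne_top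
  have hcV0 : ∀ j, cV j ≠ 0 := fun j => mul_ne_zero hc0 (h0 j)
  have hcVT : ∀ j, cV j ≠ ∞ := fun j => ENNReal.mul_ne_top hcT (hT j)
  have hcVle : ∀ j, cV j ≤ V j := fun j => by
    calc cV j ≤ 1 * V j := mul_le_mul_left (by simpa using hc1.le) _
      _ = V j := one_mul _
  set b : ℝ≥0∞ := (ENNReal.ofReal c ^ 2)⁻¹ with hb
  have hinv : ∀ j, (cV j ^ 2)⁻¹ = b * (V j ^ 2)⁻¹ := fun j => by
    rw [hcV, mul_pow, ENNReal.mul_inv (Or.inl (pow_ne_zero _ hc0))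
      (Or.inl (ENNReal.pow_ne_top hcT))]
  have hfield : fieldSum cV (majorant η (brHam F G)) i ≤
      b * (ENNReal.ofReal C * fieldNorm V g * fieldSum V f i) +
      b * (ENNReal.ofReal C * fieldNorm V f * fieldSum V g i) := by
    calc _ = ∑' z, ‖brHam F G z‖ₑ * (expo η z * (z.2 i * mon cV (z.1 + z.2))) := by
          unfold fieldSum
          simp_rw [enorm_majorant, mul_assoc]
      _ ≤ ∑' k, ‖brTerm F G k‖ₑ * (expo η (brTarget k) * ((brTarget k).2 i *
            mon cV ((brTarget k).1 + (brTarget k).2))) := tsum_enorm_brHam_le F G _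
      _ ≤ ∑' k : BrIdx, (b * (brWeight k * (‖f k.2.1‖ₑ * ‖g k.2.2‖ₑ) * (k.2.1.2 i *
            (mon cV (k.2.1.1 + k.2.1.2) * mon V (k.2.2.1 + k.2.2.2) * (V k.1 ^ 2)⁻¹))) +
            b * (brWeight k * (‖f k.2.1‖ₑ * ‖g k.2.2‖ₑ) * (k.2.2.2 i *
            (mon V (k.2.1.1 + k.2.1.2) * mon cV (k.2.2.1 + k.2.2.2) * (V k.1 ^ 2)⁻¹)))) := by
          refine ENNReal.tsum_le_tsum fun k => ?_
          by_cases hw : brWeight k = 0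
          · simp [brTerm_eq_zero hw]
          have e1 : ((brTarget k).2 i : ℝ≥0∞) ≤ k.2.1.2 i + k.2.2.2 i := by
            have := DFunLike.congr_fun (brTarget_snd hw) i
            simp only [Finsupp.add_apply] at this
            have h2 : (brTarget k).2 i ≤ k.2.1.2 i + k.2.2.2 i := by omega
            exact_mod_cast h2
          have e2 := ennreal_eq_mul_inv_of_mul_eq (pow_ne_zero 2 (hcV0 k.1))
            (ENNReal.pow_ne_top (hcVT k.1)) (mon_brTarget cV hw)
          have e3 := mon_mono hcVle (k.2.1.1 + k.2.1.2)
          have e4 := mon_mono hcVle (k.2.2.1 + k.2.2.2)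
          rw [e2, hinv]
          calc _ ≤ brWeight k * (‖F k.2.1‖ₑ * ‖G k.2.2‖ₑ) *
                ((expo η k.2.1 * expo η k.2.2) * ((k.2.1.2 i + k.2.2.2 i) *
                  (mon cV (k.2.1.1 + k.2.1.2) * mon cV (k.2.2.1 + k.2.2.2) *
                    (b * (V k.1 ^ 2)⁻¹)))) := by
                gcongr
                · exact enorm_brTerm_le F G k
                · exact expo_brTarget_le hη hw
            _ = b * (brWeight k * (‖f k.2.1‖ₑ * ‖g k.2.2‖ₑ) * (k.2.1.2 i *
                (mon cV (k.2.1.1 + k.2.1.2) * mon cV (k.2.2.1 + k.2.2.2) * (V k.1 ^ 2)⁻¹))) +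
                b * (brWeight k * (‖f k.2.1‖ₑ * ‖g k.2.2‖ₑ) * (k.2.2.2 i *
                (mon cV (k.2.1.1 + k.2.1.2) * mon cV (k.2.2.1 + k.2.2.2) *
                  (V k.1 ^ 2)⁻¹))) := by
                rw [enorm_majorant, enorm_majorant]; ring
            _ ≤ _ := by gcongr
      _ ≤ _ := by
          rw [ENNReal.tsum_add, ENNReal.tsum_mul_left, ENNReal.tsum_mul_left]
          gcongr
          · rw [tsum_brIdx]
            exact tsum_bracket_part_le h0 hT hC (majorant_conj η hG) i
          · rw [tsum_brIdx]
            refine le_trans (le_of_eq ?_) (tsum_bracket_part_le h0 hT hC (majorant_conj η hF) i)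
            refine tsum_congr fun j => ?_
            rw [ENNReal.tsum_comm]
            refine tsum_congr fun x => tsum_congr fun y => ?_
            rw [brWeight_swap, mul_comm ‖f y‖ₑ, mul_comm (mon V _)]
  have hV0 : V i ^ 2 ≠ 0 := pow_ne_zero _ (h0 i)
  have hVT : V i ^ 2 ≠ ∞ := ENNReal.pow_ne_top (hT i)
  rw [div_eq_mul_inv, hinv]
  have hbr : ENNReal.ofReal ((c ^ 2)⁻¹) = b := by
    rw [hb, ENNReal.ofReal_inv_of_pos (by positivity), ENNReal.ofReal_pow hc.le]
  calc _ ≤ (b * (ENNReal.ofReal C * fieldNorm V g * (fieldNorm V f * V i ^ 2)) +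
      b * (ENNReal.ofReal C * fieldNorm V f * (fieldNorm V g * V i ^ 2))) *
        (b * (V i ^ 2)⁻¹) := by
        refine mul_le_mul_left (hfield.trans ?_) _
        gcongr
        · exact fieldSum_le h0 hT f i
        · exact fieldSum_le h0 hT g i
    _ = 2 * ENNReal.ofReal C * b * b * (fieldNorm V f * fieldNorm V g) *
        (V i ^ 2 * (V i ^ 2)⁻¹) := by ring
    _ = _ := by
        rw [ENNReal.mul_inv_cancel hV0 hVT, mul_one, ENNReal.ofReal_mul (by positivity),
          ENNReal.ofReal_mul (by positivity), ENNReal.ofReal_mul zero_le_two, hbr]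
        simp

/-! ### Order of vanishing of the Poisson bracket -/

theorem hasSum_mul_of_summable_norm {ι ι' : Type*} {f : ι → ℂ} {g : ι' → ℂ}
    (hf : Summable fun x => ‖f x‖) (hg : Summable fun y => ‖g y‖) :
    HasSum (fun z : ι × ι' => f z.1 * g z.2) ((∑' x, f x) * ∑' y, g y) :=
  hf.of_norm.hasSum.mul hg.of_norm.hasSum (summable_mul_of_summable_norm hf hg)

open MvPolynomial in
/-- Orders of vanishing add up in a product. The series `∑ F_m p_m` and `∑ G_n q_n` of polynomials
are only summed coefficient by coefficient. -/
theorem hasSum_coeff_mul_eq_zero {ι ι' : Type*} {F : ι → ℂ} {G : ι' → ℂ}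
    {p : ι → MvPolynomial ℤ ℝ} {q : ι' → MvPolynomial ℤ ℝ} {m n : ℕ}
    (hFs : ∀ l, Summable fun x => ‖F x * (coeff l (p x) : ℝ)‖)
    (hGs : ∀ l, Summable fun y => ‖G y * (coeff l (q y) : ℝ)‖)
    (hF : ∀ l, Finsupp.degree l < m → ∑' x, F x * (coeff l (p x) : ℝ) = 0)
    (hG : ∀ l, Finsupp.degree l < n → ∑' y, G y * (coeff l (q y) : ℝ) = 0)
    (R : MvPolynomial ℤ ℝ) {k : MIdx} (hk : Finsupp.degree k < m + n) :
    HasSum (fun z : ι × ι' => F z.1 * G z.2 * (coeff k (p z.1 * q z.2 * R) : ℝ)) 0 := by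
  have h : ∀ l l' (c : ℝ), Finsupp.degree l + Finsupp.degree l' < m + n →
      HasSum (fun z : ι × ι' => (F z.1 * (coeff l (p z.1) : ℝ)) * (G z.2 * (coeff l' (q z.2) : ℝ))
        * (c : ℂ)) 0 := by
    intro l l' c hl
    have h1 := (hasSum_mul_of_summable_norm (hFs l) (hGs l')).mul_right (c : ℂ)
    have h2 : (∑' x, F x * (coeff l (p x) : ℝ)) * (∑' y, G y * (coeff l' (q y) : ℝ)) * (c : ℂ) =
        0 := by
      by_cases hlm : Finsupp.degree l < m
      · rw [hF l hlm]; simp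
      · rw [hG l' (by omega)]; simp
    rwa [h2] at h1
  have h2 := hasSum_sum (f := fun (x : MIdx × MIdx) (z : ι × ι') =>
      ∑ y ∈ Finset.HasAntidiagonal.antidiagonal x.1, (F z.1 * (coeff y.1 (p z.1) : ℝ)) *
        (G z.2 * (coeff y.2 (q z.2) : ℝ)) * ((coeff x.2 R : ℝ) : ℂ)) (a := fun _ => 0)
      (s := Finset.HasAntidiagonal.antidiagonal k) (fun x hx => by
    have := hasSum_sum (f := fun (y : MIdx × MIdx) (z : ι × ι') =>
      (F z.1 * (coeff y.1 (p z.1) : ℝ)) * (G z.2 * (coeff y.2 (q z.2) : ℝ)) *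
        ((coeff x.2 R : ℝ) : ℂ)) (a := fun _ => 0)
        (s := Finset.HasAntidiagonal.antidiagonal x.1) (fun y hy => by
      refine h _ _ _ ?_
      have e1 := Finset.HasAntidiagonal.mem_antidiagonal.1 hx
      have e2 := Finset.HasAntidiagonal.mem_antidiagonal.1 hy
      have : Finsupp.degree k = Finsupp.degree y.1 + Finsupp.degree y.2 + Finsupp.degree x.2 := by
        rw [← e1, ← e2]; simp
      omega)
    simpa using this)
  rw [Finset.sum_const_zero] at h2
  refine h2.congr_fun fun z => ?_
  rw [coeff_mul]
  push_cast
  rw [Finset.mul_sum]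
  refine Finset.sum_congr rfl fun x _ => ?_
  rw [coeff_mul]
  push_cast
  rw [Finset.sum_mul, Finset.mul_sum]
  refine Finset.sum_congr rfl fun y _ => ?_
  ring

/-- The part `c` of `(α, β) = (c + a, c + b)` for `(α, β)` the sum of two disjoint pairs. -/
def commonPart (d d' : Disj) : MIdx := (splitEquiv.symm (d.1.1 + d'.1.1, d.1.2 + d'.1.2)).1

/-- The disjoint part of the sum of two disjoint pairs. -/
def disjPart (d d' : Disj) : Disj := (splitEquiv.symm (d.1.1 + d'.1.1, d.1.2 + d'.1.2)).2

theorem commonPart_add (d d' : Disj) :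
    commonPart d d' + (disjPart d d').1.1 = d.1.1 + d'.1.1 ∧
      commonPart d d' + (disjPart d d').1.2 = d.1.2 + d'.1.2 := by
  have h := splitEquiv.apply_symm_apply (d.1.1 + d'.1.1, d.1.2 + d'.1.2)
  exact ⟨congrArg Prod.fst h, congrArg Prod.snd h⟩

theorem Disj.min_eq_zero (d : Disj) (j : ℤ) : min (d.1.1 j) (d.1.2 j) = 0 :=
  DFunLike.congr_fun d.2 j

theorem brTarget_split (j : ℤ) (d d' : Disj) (m m' : MIdx)
    (h : brWeight (j, splitEquiv (m, d), splitEquiv (m', d')) ≠ 0) :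
    brTarget (j, splitEquiv (m, d), splitEquiv (m', d')) =
      splitEquiv (m + m' + commonPart d d' - Finsupp.single j 1, disjPart d d') := by
  obtain ⟨e1, e2⟩ := commonPart_add d d'
  have h1 := brTarget_fst h
  have h2 := brTarget_snd h
  refine Prod.ext ?_ ?_ <;> ext i
  all_goals
    have f1 := DFunLike.congr_fun e1 i
    have f2 := DFunLike.congr_fun e2 i
    have f3 := (disjPart d d').min_eq_zero i
    have g1 := DFunLike.congr_fun h1 i
    have g2 := DFunLike.congr_fun h2 i
    simp only [splitEquiv_apply, Finsupp.add_apply, Finsupp.tsub_apply] at f1 f2 g1 g2 ⊢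
    omega

/-- The Taylor expansion of a contribution to the bracket. The products of the common parts cancel,
so that at most one factor is differentiated with respect to the actions. -/
theorem natCast_mul_shiftMon_eq (I : ℤ → ℝ) (j : ℤ) (d d' : Disj) (m m' : MIdx) :
    (((m j + d.1.2 j : ℕ) : MvPolynomial ℤ ℝ) * ((m' j + d'.1.1 j : ℕ) : MvPolynomial ℤ ℝ) -
      ((m j + d.1.1 j : ℕ) : MvPolynomial ℤ ℝ) * ((m' j + d'.1.2 j : ℕ) : MvPolynomial ℤ ℝ)) *
        shiftMon I (m + m' + commonPart d d' - Finsupp.single j 1) =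
      MvPolynomial.pderiv j (shiftMon I m) * shiftMon I m' *
          (((d'.1.1 j : MvPolynomial ℤ ℝ) - d'.1.2 j) * shiftMon I (commonPart d d')) +
        shiftMon I m * MvPolynomial.pderiv j (shiftMon I m') *
          (((d.1.2 j : MvPolynomial ℤ ℝ) - d.1.1 j) * shiftMon I (commonPart d d')) +
        shiftMon I m * shiftMon I m' * (((d.1.2 j : MvPolynomial ℤ ℝ) * d'.1.1 j -
          d.1.1 j * d'.1.2 j) * shiftMon I (commonPart d d' - Finsupp.single j 1)) := by
  set c := commonPart d d'
  have hle : ∀ {n : MIdx}, n j ≠ 0 → Finsupp.single j 1 ≤ n := fun {n} hn => by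
    rw [Finsupp.single_le_iff]; omega
  have h1 : (m j : MvPolynomial ℤ ℝ) * shiftMon I (m + m' + c - Finsupp.single j 1) =
      MvPolynomial.pderiv j (shiftMon I m) * shiftMon I m' * shiftMon I c := by
    rw [pderiv_shiftMon]
    by_cases h : m j = 0
    · simp [h]
    · rw [add_assoc, tsub_add_eq_add_tsub (hle h) |>.symm, shiftMon_add, shiftMon_add]; ring
  have h2 : (m' j : MvPolynomial ℤ ℝ) * shiftMon I (m + m' + c - Finsupp.single j 1) =
      shiftMon I m * MvPolynomial.pderiv j (shiftMon I m') * shiftMon I c := by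
    rw [pderiv_shiftMon]
    by_cases h : m' j = 0
    · simp [h]
    · rw [add_comm m, add_assoc, tsub_add_eq_add_tsub (hle h) |>.symm, shiftMon_add, shiftMon_add]
      ring
  have h3 : ((d.1.2 j : MvPolynomial ℤ ℝ) * d'.1.1 j - d.1.1 j * d'.1.2 j) *
      shiftMon I (m + m' + c - Finsupp.single j 1) =
      ((d.1.2 j : MvPolynomial ℤ ℝ) * d'.1.1 j - d.1.1 j * d'.1.2 j) *
        (shiftMon I m * shiftMon I m' * shiftMon I (c - Finsupp.single j 1)) := by
    by_cases h : c j = 0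
    · change commonPart d d' j = 0 at h
      obtain ⟨e1, e2⟩ := commonPart_add d d'
      have f1 := DFunLike.congr_fun e1 j
      have f2 := DFunLike.congr_fun e2 j
      have f3 := (disjPart d d').min_eq_zero j
      simp only [Finsupp.add_apply] at f1 f2
      have f4 : d.1.2 j * d'.1.1 j = 0 ∧ d.1.1 j * d'.1.2 j = 0 := by
        rw [Nat.mul_eq_zero, Nat.mul_eq_zero]; omega
      have : (d.1.2 j : MvPolynomial ℤ ℝ) * d'.1.1 j - d.1.1 j * d'.1.2 j = 0 := by
        rw [← Nat.cast_mul, ← Nat.cast_mul, f4.1, f4.2]; simp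
      rw [this, zero_mul, zero_mul]
    · rw [add_comm, tsub_add_eq_add_tsub (hle h) |>.symm, shiftMon_add, shiftMon_add]; ring
  push_cast
  linear_combination ((d'.1.1 j : MvPolynomial ℤ ℝ) - d'.1.2 j) * h1 +
    ((d.1.2 j : MvPolynomial ℤ ℝ) - d.1.1 j) * h2 + h3

/-- The indices of the contributions to the bracket, sorted by the disjoint parts of the
monomials. -/
def brSplit : (ℤ × Disj × Disj) × (MIdx × MIdx) ≃ BrIdx where
  toFun y := (y.1.1, splitEquiv (y.2.1, y.1.2.1), splitEquiv (y.2.2, y.1.2.2))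
  invFun i := ((i.1, (splitEquiv.symm i.2.1).2, (splitEquiv.symm i.2.2).2),
    ((splitEquiv.symm i.2.1).1, (splitEquiv.symm i.2.2).1))
  left_inv y := by simp
  right_inv i := by simp

/-- The Taylor coefficient of order `k` of the monomial `z`, provided it belongs to the class
`d`. -/
def clsTay (I : ℤ → ℝ) (d : Disj) (k : MIdx) (z : MIdx × MIdx) : ℂ :=
  open scoped Classical in
  if (splitEquiv.symm z).2 = d then ((tayCoeff I (splitEquiv.symm z).1 k : ℝ) : ℂ) else 0

theorem taySeq_cls_eq_tsum (I : ℤ → ℝ) (H : Ham) (d : Disj) (k : MIdx) :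
    taySeq I (cls H d) k = ∑' z, H z * clsTay I d k z := by
  classical
  have hinj : Function.Injective fun m : MIdx => splitEquiv (m, d) := fun m m' h => by
    simpa using h
  rw [← hinj.tsum_eq]
  · refine tsum_congr fun m => ?_
    simp [cls, clsTay]
  · intro z hz
    refine ⟨(splitEquiv.symm z).1, ?_⟩
    by_cases h : (splitEquiv.symm z).2 = d
    · change splitEquiv _ = z
      rw [← h]; exact splitEquiv.apply_symm_apply z
    · exact absurd (by simp [clsTay, h]) hz

theorem exists_enorm_clsTay_le {I : ℤ → ℝ} {V : ℤ → ℝ≥0∞} {κ : ℝ} (h0 : ∀ j, V j ≠ 0)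
    (hT : ∀ j, V j ≠ ∞) (hκ : 0 < κ) (hκ1 : κ < 1)
    (hI : ∀ j, ‖I j‖ₑ ≤ ENNReal.ofReal (κ ^ 2) * V j ^ 2) (d : Disj) (k : MIdx) :
    ∃ K : ℝ≥0∞, K ≠ ∞ ∧ ∀ z, ‖clsTay I d k z‖ₑ ≤ K * mon V (z.1 + z.2) := by
  classical
  obtain ⟨K, hK, hb⟩ := exists_enorm_tayCoeff_le hκ1 hκ hI (fun j => pow_ne_zero 2 (h0 j))
    (fun j => ENNReal.pow_ne_top (hT j)) k
  have hd0 := mon_ne_zero h0 (d.1.1 + d.1.2)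
  refine ⟨K * (mon V (d.1.1 + d.1.2))⁻¹, ENNReal.mul_ne_top hK (ENNReal.inv_ne_top.2 hd0),
    fun z => ?_⟩
  obtain ⟨⟨m, d'⟩, rfl⟩ := splitEquiv.surjective z
  by_cases h : d' = d
  · subst h
    rw [mon_split]
    simp only [clsTay, Equiv.symm_apply_apply, if_true, enorm_ofReal']
    calc _ ≤ K * mon (fun j => V j ^ 2) m * ((mon V (d'.1.1 + d'.1.2))⁻¹ *
          mon V (d'.1.1 + d'.1.2)) := by
          rw [ENNReal.inv_mul_cancel hd0 (mon_ne_top hT _), mul_one]; exact hb m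
      _ = _ := by ring
  · simp [clsTay, h]

/-- The order of vanishing of a Poisson bracket: the sum of the orders, less the one derivative
with respect to the actions. -/
theorem VanishesToOrder.brHam {I : ℤ → ℝ} {V : ℤ → ℝ≥0∞} {κ : ℝ} (h0 : ∀ j, V j ≠ 0)
    (hT : ∀ j, V j ≠ ∞) (hκ : 0 < κ) (hκ1 : κ < 1)
    (hI : ∀ j, ‖I j‖ₑ ≤ ENNReal.ofReal (κ ^ 2) * V j ^ 2) {F G : Ham} (hFs : hamSum V F ≠ ∞)
    (hGs : hamSum V G ≠ ∞)
    (hs : ∑' i, ‖brTerm F G i‖ₑ * mon V ((brTarget i).1 + (brTarget i).2) ≠ ∞) {m n : ℕ}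
    (hF : VanishesToOrder I m F) (hG : VanishesToOrder I n G) :
    VanishesToOrder I (m + n - 1) (brHam F G) := by
  classical
  intro d k hk
  obtain ⟨K, hK, hb⟩ := exists_enorm_clsTay_le h0 hT hκ hκ1 hI d k
  have hs' : ∑' i, ‖brTerm F G i‖ₑ * ‖clsTay I d k (brTarget i)‖ₑ ≠ ∞ := by
    refine ne_top_of_le_ne_top (ENNReal.mul_ne_top hK hs) ?_
    rw [← ENNReal.tsum_mul_left]
    refine ENNReal.tsum_le_tsum fun i => ?_
    calc _ ≤ ‖brTerm F G i‖ₑ * (K * mon V ((brTarget i).1 + (brTarget i).2)) := by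
          gcongr; exact hb _
      _ = _ := by ring
  have hsum : Summable fun i => brTerm F G i * clsTay I d k (brTarget i) := by
    simp_rw [← enorm_mul] at hs'
    exact (summable_norm_of_tsum_enorm hs').of_norm
  rw [taySeq_cls_eq_tsum, tsum_brHam_mul hs']
  refine (brSplit.tsum_eq _).symm.trans
    ((Summable.tsum_prod (brSplit.summable_iff.2 hsum)).trans ?_)
  have hz : ∀ y : ℤ × Disj × Disj, ∑' z : MIdx × MIdx, brTerm F G (brSplit (y, z)) *
      clsTay I d k (brTarget (brSplit (y, z))) = 0 := by
    rintro ⟨j, d₁, d₂⟩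
    have hsF : ∀ l, Summable fun x => ‖cls F d₁ x * (tayCoeff I x l : ℝ)‖ :=
      summable_taySeq hκ hκ1 hI (fun j => pow_ne_zero _ (h0 j))
        (fun j => ENNReal.pow_ne_top (hT j)) (cls_tsum_ne_top h0 hFs d₁)
    have hsG : ∀ l, Summable fun x => ‖cls G d₂ x * (tayCoeff I x l : ℝ)‖ :=
      summable_taySeq hκ hκ1 hI (fun j => pow_ne_zero _ (h0 j))
        (fun j => ENNReal.pow_ne_top (hT j)) (cls_tsum_ne_top h0 hGs d₂)
    -- a derivative of the first or of the second factor vanishes to one order less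
    have hcd : ∀ (f : MIdx → ℂ) (l x : MIdx),
        f x * ((MvPolynomial.coeff l (MvPolynomial.pderiv j (shiftMon I x)) : ℝ) : ℂ) =
        f x * (tayCoeff I x (l + Finsupp.single j 1) : ℝ) * ((l j : ℂ) + 1) := by
      intro f l x
      rw [MvPolynomial.coeff_pderiv, tayCoeff]
      push_cast; ring
    have hdeg : ∀ l : MIdx, Finsupp.degree (l + Finsupp.single j 1) = Finsupp.degree l + 1 := by
      intro l; simp
    have hsF' : ∀ l, Summable fun x => ‖cls F d₁ x *
        ((MvPolynomial.coeff l (MvPolynomial.pderiv j (shiftMon I x)) : ℝ) : ℂ)‖ := fun l => by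
      simp_rw [hcd, norm_mul _ ((l j : ℂ) + 1)]
      exact (hsF _).mul_right _
    have hsG' : ∀ l, Summable fun x => ‖cls G d₂ x *
        ((MvPolynomial.coeff l (MvPolynomial.pderiv j (shiftMon I x)) : ℝ) : ℂ)‖ := fun l => by
      simp_rw [hcd, norm_mul _ ((l j : ℂ) + 1)]
      exact (hsG _).mul_right _
    have hvF' : ∀ l, Finsupp.degree l < m - 1 → ∑' x, cls F d₁ x *
        ((MvPolynomial.coeff l (MvPolynomial.pderiv j (shiftMon I x)) : ℝ) : ℂ) = 0 := by
      intro l hl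
      simp_rw [hcd]
      have := hF d₁ (l + Finsupp.single j 1) (by rw [hdeg]; omega)
      rw [taySeq] at this
      rw [tsum_mul_right, this, zero_mul]
    have hvG' : ∀ l, Finsupp.degree l < n - 1 → ∑' x, cls G d₂ x *
        ((MvPolynomial.coeff l (MvPolynomial.pderiv j (shiftMon I x)) : ℝ) : ℂ) = 0 := by
      intro l hl
      simp_rw [hcd]
      have := hG d₂ (l + Finsupp.single j 1) (by rw [hdeg]; omega)
      rw [taySeq] at this
      rw [tsum_mul_right, this, zero_mul]
    -- the three terms of `natCast_mul_shiftMon_eq`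
    have e1 := hasSum_coeff_mul_eq_zero hsF' hsG hvF' (hG d₂) (((d₂.1.1 j : MvPolynomial ℤ ℝ) -
      d₂.1.2 j) * shiftMon I (commonPart d₁ d₂)) (k := k) (by omega)
    have e2 := hasSum_coeff_mul_eq_zero hsF hsG' (hF d₁) hvG' (((d₁.1.2 j : MvPolynomial ℤ ℝ) -
      d₁.1.1 j) * shiftMon I (commonPart d₁ d₂)) (k := k) (by omega)
    have e3 := hasSum_coeff_mul_eq_zero hsF hsG (hF d₁) (hG d₂)
      (((d₁.1.2 j : MvPolynomial ℤ ℝ) * d₂.1.1 j - d₁.1.1 j * d₂.1.2 j) *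
        shiftMon I (commonPart d₁ d₂ - Finsupp.single j 1)) (k := k) (by omega)
    have e4 := ((e1.add e2).add e3).mul_left (Complex.I * if disjPart d₁ d₂ = d then 1 else 0)
    simp only [add_zero, mul_zero] at e4
    refine (e4.congr_fun fun z => ?_).tsum_eq
    obtain ⟨x, y⟩ := z
    have hp := congrArg (MvPolynomial.coeff k) (natCast_mul_shiftMon_eq I j d₁ d₂ x y)
    have hW : ((x j + d₁.1.2 j : ℕ) : MvPolynomial ℤ ℝ) * ((y j + d₂.1.1 j : ℕ) :
        MvPolynomial ℤ ℝ) - ((x j + d₁.1.1 j : ℕ) : MvPolynomial ℤ ℝ) *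
        ((y j + d₂.1.2 j : ℕ) : MvPolynomial ℤ ℝ) =
        MvPolynomial.C (((x j + d₁.1.2 j : ℕ) : ℝ) * ((y j + d₂.1.1 j : ℕ) : ℝ) -
          ((x j + d₁.1.1 j : ℕ) : ℝ) * ((y j + d₂.1.2 j : ℕ) : ℝ)) := by
      simp
    rw [hW, MvPolynomial.coeff_C_mul, MvPolynomial.coeff_add, MvPolynomial.coeff_add] at hp
    rw [← mul_add, ← mul_add, ← Complex.ofReal_add, ← Complex.ofReal_add, ← hp]
    by_cases hw : brWeight (j, splitEquiv (x, d₁), splitEquiv (y, d₂)) = 0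
    · have hw' : (x j + d₁.1.2 j) * (y j + d₂.1.1 j) + (x j + d₁.1.1 j) * (y j + d₂.1.2 j) = 0 :=
        hw
      rw [brSplit, Equiv.coe_fn_mk, brTerm_eq_zero hw]
      obtain ⟨w1, w2⟩ := Nat.add_eq_zero_iff.1 hw'
      rw [← Nat.cast_mul, ← Nat.cast_mul, w1, w2]
      simp
    · have ht : clsTay I d k (brTarget (j, splitEquiv (x, d₁), splitEquiv (y, d₂))) =
          (if disjPart d₁ d₂ = d then 1 else 0) *
            (tayCoeff I (x + y + commonPart d₁ d₂ - Finsupp.single j 1) k : ℝ) := by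
        rw [brTarget_split j d₁ d₂ x y hw, clsTay, Equiv.symm_apply_apply, ite_mul, one_mul,
          zero_mul]
      rw [brSplit, Equiv.coe_fn_mk, ht, brTerm]
      simp only [splitEquiv_apply, Finsupp.add_apply, cls, tayCoeff]
      push_cast
      ring
  exact (tsum_congr hz).trans tsum_zero

/-! ### The Poisson bracket of regular Hamiltonians -/

theorem brHam_conj {F G : Ham} (hF : ∀ α β, F (α, β) = conj (F (β, α)))
    (hG : ∀ α β, G (α, β) = conj (G (β, α))) (α β : MIdx) :
    brHam F G (α, β) = conj (brHam F G (β, α)) := by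
  let e : BrIdx ≃ BrIdx :=
    (Equiv.refl ℤ).prodCongr ((Equiv.prodComm _ _).prodCongr (Equiv.prodComm _ _))
  rw [brHam, brHam, Complex.conj_tsum, ← e.tsum_eq]
  refine tsum_congr fun ⟨j, x, y⟩ => ?_
  have e1 : F x.swap = conj (F x) := hF x.2 x.1
  have e2 : G y.swap = conj (G y) := hG y.2 y.1
  have e3 : e (j, x, y) = (j, x.swap, y.swap) := rfl
  have e4 : brTarget (j, x.swap, y.swap) = (brTarget (j, x, y)).swap := rfl
  have e5 : (brTarget (j, x, y)).swap = (α, β) ↔ brTarget (j, x, y) = (β, α) := by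
    rw [Prod.swap_eq_iff_eq_swap]; rfl
  rw [e3, e4, map_mul]
  simp only [e5]
  congr 1
  · simp only [brTerm, e1, e2, map_mul, map_sub, Complex.conj_I, Prod.fst_swap, Prod.snd_swap,
      map_natCast]
    ring
  · split_ifs <;> simp

theorem brHam_mass {F G : Ham} (hF : ∀ α β : MIdx, α.len ≠ β.len → F (α, β) = 0)
    (hG : ∀ α β : MIdx, α.len ≠ β.len → G (α, β) = 0) (α β : MIdx) (h : α.len ≠ β.len) :
    brHam F G (α, β) = 0 := by
  rw [brHam]
  refine (tsum_congr fun i => ?_).trans tsum_zero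
  by_cases ht : brTarget i = (α, β)
  · by_cases hw : brWeight i = 0
    · rw [brTerm_eq_zero hw, zero_mul]
    · have h1 := congrArg MIdx.len (brTarget_fst hw)
      have h2 := congrArg MIdx.len (brTarget_snd hw)
      rw [ht] at h1 h2
      simp only [len_add] at h1 h2
      by_cases hx : i.2.1.1.len = i.2.1.2.len
      · rw [brTerm, hG i.2.2.1 i.2.2.2 (by omega), mul_zero, zero_mul]
      · rw [brTerm, hF i.2.1.1 i.2.1.2 hx, mul_zero, zero_mul, zero_mul]
  · simp [ht]

/-- A summability condition under which the coefficients of the bracket are absolutely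
convergent series. -/
def BrSummable (V : ℤ → ℝ≥0∞) (F G : Ham) : Prop :=
  ∑' i, ‖brTerm F G i‖ₑ * mon V ((brTarget i).1 + (brTarget i).2) ≠ ∞

theorem BrSummable.summable {V : ℤ → ℝ≥0∞} (h0 : ∀ j, V j ≠ 0) (hT : ∀ j, V j ≠ ∞) {F G : Ham}
    (h : BrSummable V F G) (z : MIdx × MIdx) :
    Summable fun i => brTerm F G i * if brTarget i = z then 1 else 0 := by
  refine (summable_mul_of_enorm_le (K := (mon V (z.1 + z.2))⁻¹) h
    (ENNReal.inv_ne_top.2 (mon_ne_zero h0 _)) fun i => ?_).of_norm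
  split_ifs with hz
  · rw [hz, ENNReal.inv_mul_cancel (mon_ne_zero h0 _) (mon_ne_top hT _)]; simp
  · simp

theorem brHam_sub_left {V : ℤ → ℝ≥0∞} (h0 : ∀ j, V j ≠ 0) (hT : ∀ j, V j ≠ ∞) {F F' G : Ham}
    (h : BrSummable V F G) (h' : BrSummable V F' G) :
    brHam (F - F') G = brHam F G - brHam F' G := by
  funext z
  rw [Pi.sub_apply, brHam, brHam, brHam, ← (h.summable h0 hT z).tsum_sub (h'.summable h0 hT z)]
  refine tsum_congr fun i => ?_
  simp only [brTerm, Pi.sub_apply]; ring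

theorem brHam_sub_right {V : ℤ → ℝ≥0∞} (h0 : ∀ j, V j ≠ 0) (hT : ∀ j, V j ≠ ∞) {F G G' : Ham}
    (h : BrSummable V F G) (h' : BrSummable V F G') :
    brHam F (G - G') = brHam F G - brHam F G' := by
  funext z
  rw [Pi.sub_apply, brHam, brHam, brHam, ← (h.summable h0 hT z).tsum_sub (h'.summable h0 hT z)]
  refine tsum_congr fun i => ?_
  simp only [brTerm, Pi.sub_apply]; ring

/-- The coefficients of the bracket sum up to the Poisson bracket of the functions, by
multiplication of the series of the derivatives of the factors. -/
theorem hasSum_bracket {V W : ℤ → ℝ≥0∞} {u : ℤ → ℂ} (hu : ∀ j, ‖u j‖ₑ ≤ V j)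
    (huW : ∀ j, ‖u j‖ₑ ≤ W j) {F G : Ham} (h : BrSummable W F G)
    (hFD : ∀ j, hamSum V (seriesD j F) ≠ ∞) (hFDb : ∀ j, hamSum V (seriesDbar j F) ≠ ∞)
    (hGD : ∀ j, hamSum V (seriesD j G) ≠ ∞) (hGDb : ∀ j, hamSum V (seriesDbar j G) ≠ ∞) :
    HasSum (fun j => Complex.I * (eval (seriesDbar j F) u * eval (seriesD j G) u -
      eval (seriesD j F) u * eval (seriesDbar j G) u)) (eval (brHam F G) u) := by
  set T : MIdx × MIdx → ℂ := fun z => mon u z.1 * mon (fun j => conj (u j)) z.2 with hT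
  have hTle : ∀ z, ‖T z‖ₑ ≤ mon W (z.1 + z.2) := fun z => by
    rw [hT, enorm_mul, enorm_mon_conj, enorm_mon, mon_add]
    exact mul_le_mul' (mon_mono huW _) (mon_mono huW _)
  have h1 : ∑' i, ‖brTerm F G i‖ₑ * ‖T (brTarget i)‖ₑ ≠ ∞ :=
    ne_top_of_le_ne_top h (ENNReal.tsum_le_tsum fun i => mul_le_mul_right (hTle _) _)
  have h2 : eval (brHam F G) u = ∑' i, brTerm F G i * T (brTarget i) := by
    rw [← tsum_brHam_mul h1, eval]
    refine tsum_congr fun z => ?_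
    rw [term, mpow_eq_mon, mpow_eq_mon, mul_assoc]
  have h3 : Summable fun i => brTerm F G i * T (brTarget i) := by
    simp_rw [← enorm_mul] at h1
    exact (summable_norm_of_tsum_enorm h1).of_norm
  rw [h2]
  refine h3.hasSum.prod_fiberwise fun j => ?_
  have s1 := hasSum_termD hu (hFD j)
  have s2 := hasSum_termDbar hu (hFDb j)
  have s3 := hasSum_termD hu (hGD j)
  have s4 := hasSum_termDbar hu (hGDb j)
  have p1 := hasSum_mul_of_summable_norm s2.summable.norm s3.summable.norm
  have p2 := hasSum_mul_of_summable_norm s1.summable.norm s4.summable.norm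
  rw [s2.tsum_eq, s3.tsum_eq] at p1
  rw [s1.tsum_eq, s4.tsum_eq] at p2
  refine ((p1.sub p2).mul_left Complex.I).congr_fun fun ⟨x, y⟩ => ?_
  have hle : ∀ {n : MIdx}, n j ≠ 0 → Finsupp.single j 1 ≤ n := fun {n} hn => by
    rw [Finsupp.single_le_iff]; omega
  have e1 : (x.2 j : ℂ) * y.1 j * T (brTarget (j, x, y)) = x.2 j * y.1 j *
      (mon u x.1 * mon u (y.1 - Finsupp.single j 1) *
        (mon (fun j => conj (u j)) (x.2 - Finsupp.single j 1) *
          mon (fun j => conj (u j)) y.2)) := by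
    by_cases hx : x.2 j = 0
    · simp [hx]
    by_cases hy : y.1 j = 0
    · simp [hy]
    simp only [hT, brTarget]
    rw [add_tsub_assoc_of_le (hle hy), ← tsub_add_eq_add_tsub (hle hx), mon_add, mon_add]
  have e2 : (x.1 j : ℂ) * y.2 j * T (brTarget (j, x, y)) = x.1 j * y.2 j *
      (mon u (x.1 - Finsupp.single j 1) * mon u y.1 *
        (mon (fun j => conj (u j)) x.2 *
          mon (fun j => conj (u j)) (y.2 - Finsupp.single j 1))) := by
    by_cases hx : x.1 j = 0
    · simp [hx]
    by_cases hy : y.2 j = 0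
    · simp [hy]
    simp only [hT, brTarget]
    rw [add_tsub_assoc_of_le (hle hy), ← tsub_add_eq_add_tsub (hle hx), mon_add, mon_add]
  simp only [brTerm, termD, termDbar]
  linear_combination Complex.I * F x * G y * (e1 - e2)

section regular
variable {θ p s a η r r' : ℝ}

theorem IsRegular.brSummable (hp : 1 < p) (hs : 0 < s) (ha : 0 ≤ a) (hη : 0 ≤ η) (hr : 0 < r)
    {F G : Ham} (hF : IsRegular θ p s a η r F) (hG : IsRegular θ p s a η r G) :
    BrSummable (rad θ p s a r) F G := by
  rw [isRegular_iff hp hs ha hη hr] at hF hG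
  have hle : ∀ H : Ham, fieldNorm (rad θ p s a r) H ≤ fieldNorm (rad θ p s a r) (majorant η H) :=
    fun H => by
      refine (fieldNorm_le_of_enorm_le (F := majorant η H) (G := 0) fun x => ?_).trans_eq ?_
      · simpa using norm_le_majorant hη H x
      · simp [fieldNorm, fieldSum]
  exact tsum_brTerm_ne_top (rad_ne_zero hr) (rad_ne_top r) (tsum_rad_sq_ne_top hp hs ha hr)
    hF.1 hG.1 (ne_top_of_le_ne_top hF.2.2 (hle F)) (ne_top_of_le_ne_top hG.2.2 (hle G))

theorem exists_hamNorm_brHam_le (hp : 1 < p) (hs : 0 < s) (ha : 0 ≤ a) (hη : 0 ≤ η)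
    (hr' : 0 < r') (h : r' < r) : ∃ C : ℝ, ∀ F G, IsRegular θ p s a η r F →
      IsRegular θ p s a η r G → IsRegular θ p s a η r' (brHam F G) ∧
        hamNorm θ p s a η r' (brHam F G) ≤
          ENNReal.ofReal C * (hamNorm θ p s a η r F * hamNorm θ p s a η r G) := by
  have hr := hr'.trans h
  obtain ⟨C, hC⟩ := fieldNorm_brHam_le (V := rad θ p s a r) (rad_ne_zero hr) (rad_ne_top r) hη
    (div_pos hr' hr) ((div_lt_one hr).2 h)
  have hrad : (fun j => ENNReal.ofReal (r' / r) * rad θ p s a r j) = rad θ p s a r' := by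
    funext j; rw [← rad_mul (div_pos hr' hr).le, div_mul_cancel₀ _ hr.ne']
  refine ⟨C, fun F G hF hG => ?_⟩
  have hF' := (isRegular_iff hp hs ha hη hr).1 hF
  have hG' := (isRegular_iff hp hs ha hη hr).1 hG
  have hb := hC F G hF'.1 hG'.1
  rw [hrad] at hb
  have hreg : IsRegular θ p s a η r' (brHam F G) := (isRegular_iff hp hs ha hη hr').2
    ⟨brHam_conj hF'.1 hG'.1, brHam_mass hF'.2.1 hG'.2.1, ne_top_of_le_ne_top
      (ENNReal.mul_ne_top ENNReal.ofReal_ne_top (ENNReal.mul_ne_top hF'.2.2 hG'.2.2)) hb⟩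
  refine ⟨hreg, ?_⟩
  rw [hreg.hamNorm_eq hr', hF.hamNorm_eq hr, hG.hamNorm_eq hr]
  exact hb

theorem hamNorm_sub_le (hp : 1 < p) (hs : 0 < s) (ha : 0 ≤ a) (hη : 0 ≤ η) (hr : 0 < r) {F G : Ham}
    (hF : IsRegular θ p s a η r F) (hG : IsRegular θ p s a η r G) :
    hamNorm θ p s a η r (F - G) ≤ hamNorm θ p s a η r F + hamNorm θ p s a η r G := by
  rw [(hF.sub hp hs ha hη hr hG).hamNorm_eq hr, hF.hamNorm_eq hr, hG.hamNorm_eq hr]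
  refine fieldNorm_le_of_enorm_le fun x => ?_
  simp only [enorm_majorant, ← add_mul]
  gcongr
  exact enorm_sub_le

variable {O : Set (ℤ → ℝ)}

/-- Brackets of Lipschitz families are Lipschitz families, as the bracket is bilinear and
bounded. -/
theorem brHam_mem_hFam (hp : 1 < p) (hs : 0 < s) (ha : 0 ≤ a) (hη : 0 ≤ η) (hr' : 0 < r')
    (h : r' < r) {F G : O → Ham} (hF : F ∈ HFam θ p s a η r O) (hG : G ∈ HFam θ p s a η r O) :
    (fun ω => brHam (F ω) (G ω)) ∈ HFam θ p s a η r' O := by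
  have hr := hr'.trans h
  obtain ⟨C, hC⟩ := exists_hamNorm_brHam_le hp hs ha hη hr' h
  obtain ⟨hF1, hF2, hF3⟩ := hF
  obtain ⟨hG1, hG2, hG3⟩ := hG
  have hFs : ∀ ω, hamNorm θ p s a η r (F ω) ≤ famSup θ p s a η r F := fun ω =>
    le_iSup (fun ω => hamNorm θ p s a η r (F ω)) ω
  have hGs : ∀ ω, hamNorm θ p s a η r (G ω) ≤ famSup θ p s a η r G := fun ω =>
    le_iSup (fun ω => hamNorm θ p s a η r (G ω)) ω
  have hlip : ∀ {H : O → Ham} {ω ω' : O}, ω ≠ ω' →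
      hamNorm θ p s a η r (H ω - H ω') / supDist (ω : ℤ → ℝ) ω' ≤ famLip θ p s a η r H :=
    fun {H ω ω'} hne => le_iSup_of_le ω (le_iSup_of_le ω' (le_iSup_of_le hne le_rfl))
  refine ⟨fun ω => (hC _ _ (hF1 ω) (hG1 ω)).1, ?_, ?_⟩
  · refine lt_of_le_of_lt (iSup_le fun ω => ((hC _ _ (hF1 ω) (hG1 ω)).2.trans
      (mul_le_mul_right (mul_le_mul' (hFs ω) (hGs ω)) _))) ?_
    exact ENNReal.mul_lt_top ENNReal.ofReal_lt_top (ENNReal.mul_lt_top hF2 hG2)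
  · refine lt_of_le_of_lt (b := ENNReal.ofReal C * (famLip θ p s a η r F * famSup θ p s a η r G +
      famSup θ p s a η r F * famLip θ p s a η r G)) (iSup_le fun ω => iSup_le fun ω' =>
        iSup_le fun hne => ?_) ?_
    · set D := supDist (ω : ℤ → ℝ) ω'
      have hsF := (hF1 ω).sub hp hs ha hη hr (hF1 ω')
      have hsG := (hG1 ω').sub hp hs ha hη hr (hG1 ω)
      have hsG' := (hG1 ω).sub hp hs ha hη hr (hG1 ω')
      -- the Leibniz rule for differences in `ω`
      have e : brHam (F ω) (G ω) - brHam (F ω') (G ω') =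
          brHam (F ω - F ω') (G ω) - brHam (F ω') (G ω' - G ω) := by
        rw [brHam_sub_left (rad_ne_zero hr) (rad_ne_top r)
            ((hF1 ω).brSummable hp hs ha hη hr (hG1 ω))
            ((hF1 ω').brSummable hp hs ha hη hr (hG1 ω)),
          brHam_sub_right (rad_ne_zero hr) (rad_ne_top r)
            ((hF1 ω').brSummable hp hs ha hη hr (hG1 ω'))
            ((hF1 ω').brSummable hp hs ha hη hr (hG1 ω))]
        abel
      have hDs : supDist (ω' : ℤ → ℝ) ω = D := by
        simp only [D, supDist, abs_sub_comm]
      have h1 := hC _ _ hsF (hG1 ω)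
      have h2 := hC _ _ (hF1 ω') hsG
      rw [e]
      calc _ ≤ (ENNReal.ofReal C * (hamNorm θ p s a η r (F ω - F ω') * hamNorm θ p s a η r (G ω)) +
            ENNReal.ofReal C * (hamNorm θ p s a η r (F ω') *
              hamNorm θ p s a η r (G ω' - G ω))) / D := by
            gcongr
            exact (hamNorm_sub_le hp hs ha hη hr' h1.1 h2.1).trans (add_le_add h1.2 h2.2)
        _ = ENNReal.ofReal C * (hamNorm θ p s a η r (F ω - F ω') / D * hamNorm θ p s a η r (G ω) +
            hamNorm θ p s a η r (F ω') * (hamNorm θ p s a η r (G ω' - G ω) / D)) := by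
            simp only [div_eq_mul_inv]; ring
        _ ≤ _ := by
            gcongr
            · exact hlip hne
            · exact hGs ω
            · exact hFs ω'
            · rw [← hDs]; exact hlip hne.symm
    · exact ENNReal.mul_lt_top ENNReal.ofReal_lt_top (ENNReal.add_lt_top.2
        ⟨ENNReal.mul_lt_top hF3 hG2, ENNReal.mul_lt_top hF2 hG3⟩)

theorem IsRegular.isBracket (hp : 1 < p) (hs : 0 < s) (ha : 0 ≤ a) (hη : 0 ≤ η) (hr' : 0 < r')
    (h : r' < r) {F G : Ham} (hF : IsRegular θ p s a η r F) (hG : IsRegular θ p s a η r G) :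
    IsBracket θ p s a r' (eval F) (eval G) (brHam F G) := by
  intro u hu
  have hr := hr'.trans h
  obtain ⟨ρ, hρ0, hρ, huρ⟩ := exists_of_seqNorm_lt hu
  have hρr := hρ.trans h
  have hFo := OpenSummable.of_hamSum (hF.hamSum_ne_top hr)
  have hGo := OpenSummable.of_hamSum (hG.hamSum_ne_top hr)
  have hu' : seqNorm θ p s a u < ENNReal.ofReal r :=
    hu.trans_le (ENNReal.ofReal_le_ofReal h.le)
  have hFr : Represents θ p s a r (eval F) F := ⟨hFo, fun _ _ => rfl⟩
  have hGr : Represents θ p s a r (eval G) G := ⟨hGo, fun _ _ => rfl⟩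
  simp_rw [(hFr.dU _).eq_eval u hu', (hFr.dUbar _).eq_eval u hu', (hGr.dU _).eq_eval u hu',
    (hGr.dUbar _).eq_eval u hu']
  exact hasSum_bracket huρ (fun j => (huρ j).trans (rad_mono hρr.le j))
    (hF.brSummable hp hs ha hη hr hG) (fun j => hFo.seriesD j ρ hρ0 hρr)
    (fun j => hFo.seriesDbar j ρ hρ0 hρr) (fun j => hGo.seriesD j ρ hρ0 hρr)
    (fun j => hGo.seriesDbar j ρ hρ0 hρr)

end regular

end

end TorusProj

/-! ### The projections -/

open TorusProj in
theorem mainTheorem5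
    (θ p s a η : ℝ) (hθ : 0 < θ) (hθ' : θ < 1) (hp : 1 < p) (hs : 0 < s) (ha : 0 ≤ a)
    (hη : 0 ≤ η)
    (O : Set (ℤ → ℝ)) (hO : O ⊆ freqCube)
    (I : ℤ → ℝ) (hI : ∀ j, 0 ≤ I j) :
    -- `P q` is the projection of degree `d = 2 q - 2`
    ∃ P : ℕ → (O → Ham) → (O → Ham),
      ∀ r κ : ℝ, 0 < r → 0 < κ → κ < 1 →
        seqNorm θ p s a (fun j => ((Real.sqrt (I j) : ℝ) : ℂ)) ≤ ENNReal.ofReal (κ * r) →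
        -- linear operators on the space of Lipschitz families of regular Hamiltonians
        (∀ q, ∀ H ∈ HFam θ p s a η r O, P q H ∈ HFam θ p s a η r O) ∧
        (∀ q, ∀ F ∈ HFam θ p s a η r O, ∀ G ∈ HFam θ p s a η r O, ∀ b c : ℝ,
          P q (b • F + c • G) = b • P q F + c • P q G) ∧
        -- continuous
        (∀ q, ∀ μ : ℝ, 0 ≤ μ → ∃ C : ℝ, ∀ H ∈ HFam θ p s a η r O,
          famNorm θ p s a η μ r (P q H) ≤ ENNReal.ofReal C * famNorm θ p s a η μ r H) ∧
        -- given by the terms of the Taylor expansion of the auxiliary Hamiltonian at `w = I`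
        (∀ H ∈ HFam θ p s a η r O, ∀ ω, ∀ u, seqNorm θ p s a u < ENNReal.ofReal r →
          AnalyticAt ℂ (fun t : ℂ => auxHam (H ω) u (actionLine I u t)) 0 ∧
          ∀ q, eval (P q H ω) u = (1 / (q.factorial : ℂ)) *
            iteratedDeriv q (fun t : ℂ => auxHam (H ω) u (actionLine I u t)) 0) ∧
        -- (i) idempotent and mutually orthogonal
        (∀ H ∈ HFam θ p s a η r O, ∀ q, P q (P q H) = P q H ∧
          ∀ q', q' ≠ q → P q' (P q H) = 0 ∧ P q (P q' H) = 0) ∧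
        -- (ii) the norm bound
        (∀ H ∈ HFam θ p s a η r O, ∀ q, ∀ μ κ' : ℝ, 0 ≤ μ → 0 < κ' → κ' ≤ 1 →
          famNorm θ p s a η μ (κ' * r) (P q H) ≤
            ENNReal.ofReal ((κ' ^ 2)⁻¹ * (1 + κ' ^ 2 / κ ^ 2) ^ q * cKappa κ ^ q) *
              famNorm θ p s a η μ r H) ∧
        -- the functions are smooth in finitely many modes, so that the derivatives below exist
        (∀ H ∈ HFam θ p s a η r O, ∀ ω, ∀ u, seqNorm θ p s a u < ENNReal.ofReal r →
          ∀ S : Finset ℤ, ContDiffAt ℝ (⊤ : ℕ∞) (slice (eval (H ω)) u S) 0) ∧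
        -- (iii) vanishing on the torus
        (∀ H ∈ HFam θ p s a η r O, ∀ Q : ℕ, (∀ q ≤ Q, P q H = 0) →
          ∀ α β : MIdx, α.len + β.len ≤ Q → ∀ ω, ∀ u ∈ torus θ p s a I,
            dUs α (dUbars β (eval (H ω))) u = 0) ∧
        -- (iv) degrees and Poisson brackets, with `d₁ = 2 q₁ - 2` and `d₂ = 2 q₂ - 2`
        (∀ F ∈ HFam θ p s a η r O, ∀ G ∈ HFam θ p s a η r O, ∀ q₁ q₂ : ℕ,
          ∑ q ∈ Finset.range q₁, P q F = 0 → ∑ q ∈ Finset.range q₂, P q G = 0 →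
          ∀ r' : ℝ, r' < r →
            seqNorm θ p s a (fun j => ((Real.sqrt (I j) : ℝ) : ℂ)) < ENNReal.ofReal r' →
            ∃ K ∈ HFam θ p s a η r' O,
              (∀ ω, IsBracket θ p s a r' (eval (F ω)) (eval (G ω)) (K ω)) ∧
              ∑ q ∈ Finset.range (q₁ + q₂ - 1), P q K = 0) := by
  refine ⟨famProj I, fun r κ hr hκ hκ1 hsI => ?_⟩
  have hI' := enorm_action_le hr hκ hI hsI
  have h0 : ∀ j, rad θ p s a r j ≠ 0 := rad_ne_zero hr
  have hT : ∀ j, rad θ p s a r j ≠ ⊤ := rad_ne_top r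
  have hsum : ∀ H ∈ HFam θ p s a η r O, ∀ ω, hamSum (rad θ p s a r) (H ω) ≠ ⊤ :=
    fun H hH ω => (hH.1 ω).hamSum_ne_top hr
  have hsub : ∀ H ∈ HFam θ p s a η r O, ∀ q ω ω', famProj I q H ω - famProj I q H ω' =
      taylorProj I q (H ω - H ω') := by
    intro H hH q ω ω'
    have := taylorProj_linear h0 hT hκ hκ1 hI' (hsum H hH ω) (hsum H hH ω') q 1 (-1)
    simpa [sub_eq_add_neg, famProj] using this.symm
  have hlt : ∀ {u : ℤ → ℂ}, seqNorm θ p s a u < ENNReal.ofReal r →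
      ∀ j, ‖u j‖ₑ ≤ rad θ p s a r j := fun hu => (seqNorm_le_iff hr.le _).1 hu.le
  have hbound : ∀ H ∈ HFam θ p s a η r O, ∀ q, ∀ κ' : ℝ, 0 < κ' → κ' ≤ 1 →
      (∀ ω, hamNorm θ p s a η (κ' * r) (famProj I q H ω) ≤
        ENNReal.ofReal ((κ' ^ 2)⁻¹ * (1 + κ' ^ 2 / κ ^ 2) ^ q * cKappa κ ^ q) *
          hamNorm θ p s a η r (H ω)) ∧
      ∀ ω ω', hamNorm θ p s a η (κ' * r) (famProj I q H ω - famProj I q H ω') ≤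
        ENNReal.ofReal ((κ' ^ 2)⁻¹ * (1 + κ' ^ 2 / κ ^ 2) ^ q * cKappa κ ^ q) *
          hamNorm θ p s a η r (H ω - H ω') := by
    intro H hH q κ' h h'
    refine ⟨fun ω => ((hH.1 ω).taylorProj hp hs ha hη hr hκ hκ1 hI' h h' q).2, fun ω ω' => ?_⟩
    rw [hsub H hH]
    exact (((hH.1 ω).sub hp hs ha hη hr (hH.1 ω')).taylorProj hp hs ha hη hr hκ hκ1 hI' h h' q).2
  have hnorm : ∀ H ∈ HFam θ p s a η r O, ∀ q, ∀ μ κ' : ℝ, 0 ≤ μ → 0 < κ' → κ' ≤ 1 →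
      famNorm θ p s a η μ (κ' * r) (famProj I q H) ≤
        ENNReal.ofReal ((κ' ^ 2)⁻¹ * (1 + κ' ^ 2 / κ ^ 2) ^ q * cKappa κ ^ q) *
          famNorm θ p s a η μ r H :=
    fun H hH q μ κ' _ h h' => famNorm_le (hbound H hH q κ' h h').1 (hbound H hH q κ' h h').2
  have hvan : ∀ H ∈ HFam θ p s a η r O, ∀ n, ∑ q ∈ Finset.range n, famProj I q H = 0 →
      ∀ ω, VanishesToOrder I n (H ω) := by
    intro H hH n h ω
    refine vanishesToOrder_of_sum h0 hT hκ hκ1 hI' (hsum H hH ω) ?_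
    simpa [famProj] using congrFun h ω
  refine ⟨fun q H hH => ?_, fun q F hF G hG b c => ?_, fun q μ hμ => ?_, fun H hH ω u hu => ?_,
    fun H hH q => ?_, hnorm, fun H hH ω u hu S => ?_, fun H hH Q hQ α β hαβ ω u hu => ?_,
    fun F hF G hG q₁ q₂ hF0 hG0 r' hr' hsI' => ?_⟩
  · have hb := hbound H hH q 1 one_pos le_rfl
    have hreg := fun ω => ((hH.1 ω).taylorProj hp hs ha hη hr hκ hκ1 hI' one_pos le_rfl q).1
    rw [one_mul] at hb hreg
    exact ⟨hreg, (famSup_le hb.1).trans_lt (ENNReal.mul_lt_top ENNReal.ofReal_lt_top hH.2.1),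
      (famLip_le hb.2).trans_lt (ENNReal.mul_lt_top ENNReal.ofReal_lt_top hH.2.2)⟩
  · funext ω
    exact taylorProj_linear h0 hT hκ hκ1 hI' (hsum F hF ω) (hsum G hG ω) q b c
  · exact ⟨_, fun H hH => by simpa only [one_mul] using hnorm H hH q μ 1 hμ one_pos le_rfl⟩
  · exact ⟨(hasFPowerSeriesAt_auxHam hκ hκ1 h0 hI' (hlt hu) (hsum H hH ω)).analyticAt,
      eval_taylorProj hκ hκ1 h0 hI' (hlt hu) (hsum H hH ω)⟩
  · have h : ∀ q q', famProj I q' (famProj I q H) = if q' = q then famProj I q H else 0 := by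
      intro q q'
      funext ω
      have := taylorProj_taylorProj h0 hT hκ hκ1 hI' (hsum H hH ω) q q'
      split_ifs at this ⊢ <;> exact this
    refine ⟨by rw [h, if_pos rfl], fun q' hq => ⟨by rw [h, if_neg hq], by rw [h, if_neg hq.symm]⟩⟩
  · exact contDiffAt_slice (OpenSummable.of_hamSum (hsum H hH ω)) hu S
  · refine dUs_dUbars_eq_zero hI (hsI.trans_lt ?_) (OpenSummable.of_hamSum (hsum H hH ω))
      ((vanishesToOrder_iff h0 hT hκ hκ1 hI' (hsum H hH ω) _).2 fun q hq =>
        congrFun (hQ q (Nat.lt_succ_iff.1 hq)) ω) hαβ hu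
    exact (ENNReal.ofReal_lt_ofReal_iff hr).2 (by nlinarith)
  · have hr0 : 0 < r' := ENNReal.ofReal_pos.1 (zero_le.trans_lt hsI')
    have hK := brHam_mem_hFam hp hs ha hη hr0 hr' hF hG
    refine ⟨_, hK, fun ω => (hF.1 ω).isBracket hp hs ha hη hr0 hr' (hG.1 ω),
      Finset.sum_eq_zero fun q hq => funext fun ω => ?_⟩
    -- the bracket is regular only on the smaller ball, which still contains the torus inside
    obtain ⟨ρ, κ', hρ0, hρ, hκ', hκ'1, hIρ⟩ := exists_interior_radius hI hsI'
    have hKs : hamSum (rad θ p s a ρ) (brHam (F ω) (G ω)) ≠ ⊤ :=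
      ne_top_of_le_ne_top ((hK.1 ω).hamSum_ne_top hr0) (hamSum_mono (rad_mono hρ.le) _)
    exact (vanishesToOrder_iff (rad_ne_zero hρ0) (rad_ne_top ρ) hκ' hκ'1 hIρ hKs _).1
      (VanishesToOrder.brHam h0 hT hκ hκ1 hI' (hsum F hF ω) (hsum G hG ω)
        ((hF.1 ω).brSummable hp hs ha hη hr (hG.1 ω)) (hvan F hF q₁ hF0 ω) (hvan G hG q₂ hG0 ω))
      q (Finset.mem_range.1 hq)
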